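/- **Setting.** Let $\mathcal H$ be a complex Hilbert space with scalar product $\langle\cdot,\cdot\rangle$ and let $\mathcal F(\mathcal H)=\bigoplus_{n\ge 0}\mathcal H^{\otimes_s n}$ be the Bose Fock space over $\mathcal H$, with vacuum $\Omega$ and creation and annihilation operators $a(\xi)^*,a(\xi)$. For $\xi\in\mathcal H$ let $W(\xi)=\exp\bigl(i\,\overline{(a(\xi)^*+a(\xi))}\bigr)$, and for a closed real subspace $H\subset\mathcal H$ let $\mathcal M(H)=\{W(h):h\in H\}''\subset\mathcal B(\mathcal F(\mathcal H))$ and let $E_H$ be the real orthogonal projection onto $H$ with respect to $\operatorname{Re}\langle\cdot,\cdot\rangle$. For a closed real subspace $H$, let $H^\perp$ be its complex orthogonal complement and let $H_s$ be the complex orthogonal complement of $H\cap iH$ in $H$. The Tomita operator $S_H$ is the closed, densely defined antilinear operator with domain $H^\perp\oplus(H\cap iH)\oplus(H_s+iH_s)$ given by $S_H(u+v+h_1+ih_2)=h_1-ih_2$ for $u\in H^\perp$, $v\in H\cap iH$, $h_1,h_2\in H_s$, and $\Delta_H=S_H^*S_H$ is the modular operator of $H$. Its powers $\Delta_H^\alpha$,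 $\alpha>0$, are defined by the spectral calculus (and vanish on $\ker\Delta_H$). A bounded linear map $\Xi$ between two normed spaces is called $\ell^p$ ($p>0$) if $\sum_{n\ge0}\alpha_n(\Xi)^p<\infty$, where $\alpha_n(\Xi)=\inf\{\|\Xi-\Xi_n\|: \Xi_n \text{ bounded linear of rank}\le n\}$; a bounded real linear operator on $\mathcal H$ is called real $\ell^p$ if the same holds with real linear $\Xi_n$ and real rank. **Theorem.** Let $\tilde H\subset H\subset\mathcal H$ be closed real subspaces and $0<\alpha<\tfrac12$. Let $X=\bigoplus_{n\ge0}(\Delta_H^\alpha)^{\otimes n}$ be the (self-adjoint) second quantization of $\Delta_H^\alpha$ on $\mathcal F(\mathcal H)$. If $\|\Delta_H^\alpha E_{\tilde H}\|<1$ and $\Delta_H^\alpha E_{\tilde H}$ is real $\ell^p$ for all $p>0$, then $\mathcal M(\tilde H)\Omega$ is contained in the domain of $X$, and the map $$\Xi_{\tilde H,\Delta_H^\alpha}:\mathcal M(\tilde H)\to\mathcal F(\mathcal H),\qquad A\mapsto XA\Omega,$$ is bounded and $\ell^p$ for all $p>0$. -/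

import Mathlib

open scoped ClosedSubmodule

noncomputable section

namespace BoseFock

open scoped TensorProduct InnerProductSpace
open Complex UniformSpace

universe u

/-! ### Approximation numbers and maps of type `ℓ^p` -/

section Approximation

variable (𝕜 : Type*) [NontriviallyNormedField 𝕜]
  {E F : Type*} [NormedAddCommGroup E] [NormedSpace 𝕜 E] [NormedAddCommGroup F] [NormedSpace 𝕜 F]

/-- The `n`-th approximation number of a bounded `𝕜`-linear map: the distance, in operator norm,
to the bounded `𝕜`-linear maps of rank at most `n`. -/
def approxNumber (T : E →L[𝕜] F) (n : ℕ) : ℝ :=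
  sInf {r : ℝ | ∃ S : E →L[𝕜] F, S.toLinearMap.rank ≤ (n : Cardinal) ∧ r = ‖T - S‖}

/-- `T` is of type `ℓ^p` (over the scalar field `𝕜`). -/
def IsEllP (p : ℝ) (T : E →L[𝕜] F) : Prop :=
  Summable fun n : ℕ => approxNumber 𝕜 T n ^ p

end Approximation

/-! ### Hilbert tensor powers and the Bose Fock space -/

/-- A bundled complex Hilbert space. -/
structure HilbertBundle : Type (u + 1) where
  carrier : Type u
  [normed : NormedAddCommGroup carrier]
  [inner : InnerProductSpace ℂ carrier]
  [complete : CompleteSpace carrier]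

attribute [instance] HilbertBundle.normed HilbertBundle.inner HilbertBundle.complete

variable (𝓗 : Type u) [NormedAddCommGroup 𝓗] [InnerProductSpace ℂ 𝓗]

/-- Hilbert tensor powers: the zeroth one is a copy of `ℂ` in the right universe, and the
`(n + 1)`-st one is the completed tensor product of `𝓗` with the `n`-th one. -/
def tensorBundle : ℕ → HilbertBundle.{u}
  | 0 => ⟨EuclideanSpace ℂ PUnit.{u + 1}⟩
  | n + 1 => ⟨Completion (𝓗 ⊗[ℂ] (tensorBundle n).carrier)⟩

/-- The `n`-fold Hilbert tensor power of `𝓗`. -/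
abbrev TPow (n : ℕ) : Type u := (tensorBundle 𝓗 n).carrier

variable {𝓗}

/-- The bounded bilinear map `(ξ, Ψ) ↦ ξ ⊗ Ψ` into the next tensor power. -/
def tensorLeft (n : ℕ) : 𝓗 →L[ℂ] TPow 𝓗 n →L[ℂ] TPow 𝓗 (n + 1) :=
  (ContinuousLinearMap.compL ℂ (TPow 𝓗 n) (𝓗 ⊗[ℂ] TPow 𝓗 n)
    (Completion (𝓗 ⊗[ℂ] TPow 𝓗 n)) Completion.toComplL).comp
    (TensorProduct.mkL (𝕜 := ℂ) (E := 𝓗) (F := TPow 𝓗 n))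

/-- The unit vector `1` of the zeroth tensor power. -/
def unitTensor : TPow 𝓗 0 := (EuclideanSpace.single PUnit.unit (1 : ℂ) : EuclideanSpace ℂ PUnit)

/-- The tensor `x ⊗ x ⊗ ⋯ ⊗ x` (`n` factors). -/
def diagTensor (x : 𝓗) : (n : ℕ) → TPow 𝓗 n
  | 0 => unitTensor
  | n + 1 => tensorLeft n x (diagTensor x n)

variable (𝓗)

/-- The symmetric `n`-fold Hilbert tensor power, the closed span of the tensors
`x ⊗ ⋯ ⊗ x` (by polarization this is the space of all permutation invariant tensors). -/
def SymPow (n : ℕ) : Submodule ℂ (TPow 𝓗 n) :=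
  (Submodule.span ℂ (Set.range fun x : 𝓗 => diagTensor x n)).topologicalClosure

instance (n : ℕ) : CompleteSpace (SymPow 𝓗 n) :=
  inferInstanceAs (CompleteSpace
    (Submodule.span ℂ (Set.range fun x : 𝓗 => diagTensor x n)).topologicalClosure)

/-- The Bose Fock space, the Hilbert space direct sum of the symmetric tensor powers. -/
abbrev Fock : Type u := lp (fun n : ℕ => SymPow 𝓗 n) 2

variable {𝓗}

/-- `x ⊗ ⋯ ⊗ x` as an element of the symmetric tensor power. -/
def symTensor (x : 𝓗) (n : ℕ) : SymPow 𝓗 n :=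
  ⟨diagTensor x n, Submodule.le_topologicalClosure _ (Submodule.subset_span ⟨x, rfl⟩)⟩

/-- `x ⊗ ⋯ ⊗ x` (`n` factors) as a vector of the Fock space. -/
def fockTensor (x : 𝓗) (n : ℕ) : Fock 𝓗 := lp.single 2 n (symTensor x n)

variable (𝓗)

/-- The Fock vacuum. -/
def vacuum : Fock 𝓗 := fockTensor 0 0

/-- The vectors of finite particle number. -/
def finiteParticle : Submodule ℂ (Fock 𝓗) where
  carrier := {Ψ | ∃ N : ℕ, ∀ n, N ≤ n → Ψ n = 0}
  zero_mem' := ⟨0, fun n _ => rfl⟩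
  add_mem' := by
    rintro Ψ Φ ⟨N, hN⟩ ⟨M, hM⟩
    refine ⟨max N M, fun n hn => ?_⟩
    simp [hN n (le_trans (le_max_left _ _) hn), hM n (le_trans (le_max_right _ _) hn)]
  smul_mem' := by
    rintro c Ψ ⟨N, hN⟩
    exact ⟨N, fun n hn => by simp [hN n hn]⟩

variable {𝓗}

/-! ### Creation, annihilation and Weyl operators -/

/-- The creation operator `a(ξ)^*` from `n` to `n + 1` particles,
`Ψ ↦ √(n + 1) P (ξ ⊗ Ψ)` with `P` the projection onto the symmetric tensors. -/
def createLevel (ξ : 𝓗) (n : ℕ) : SymPow 𝓗 n →L[ℂ] SymPow 𝓗 (n + 1) :=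
  ((Real.sqrt (n + 1) : ℝ) : ℂ) •
    ((SymPow 𝓗 (n + 1)).orthogonalProjectionOnto.comp ((tensorLeft n ξ).comp (SymPow 𝓗 n).subtypeL))

/-- The annihilation operator `a(ξ)` from `n + 1` to `n` particles, the adjoint of creation. -/
def annihilateLevel (ξ : 𝓗) (n : ℕ) : SymPow 𝓗 (n + 1) →L[ℂ] SymPow 𝓗 n :=
  ContinuousLinearMap.adjoint (createLevel ξ n)

/-- The `n`-particle component of `(a(ξ)^* + a(ξ)) Ψ`. -/
def fieldLevel (ξ : 𝓗) (Ψ : Fock 𝓗) : (n : ℕ) → SymPow 𝓗 n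
  | 0 => annihilateLevel ξ 0 (Ψ 1)
  | n + 1 => createLevel ξ n (Ψ n) + annihilateLevel ξ (n + 1) (Ψ (n + 2))

lemma fieldLevel_memℓp (ξ : 𝓗) (Ψ : finiteParticle 𝓗) :
    Memℓp (fieldLevel ξ (Ψ : Fock 𝓗)) 2 := by
  obtain ⟨Ψ, N, hN⟩ := Ψ
  have h0 : Memℓp (fieldLevel ξ Ψ) 0 := by
    refine memℓp_zero ((Set.finite_lt_nat (N + 1)).subset ?_)
    intro n hn
    by_contra h
    refine hn ?_
    have h' : N + 1 ≤ n := by simpa using h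
    obtain ⟨m, rfl⟩ : ∃ m, n = m + 1 := ⟨n - 1, by omega⟩
    simp [fieldLevel, hN m (by omega), hN (m + 2) (by omega)]
  exact h0.of_exponent_ge (by simp)

lemma fieldLevel_add (ξ : 𝓗) (Ψ Φ : Fock 𝓗) (n : ℕ) :
    fieldLevel ξ (Ψ + Φ) n = fieldLevel ξ Ψ n + fieldLevel ξ Φ n := by
  cases n with
  | zero => simp [fieldLevel]
  | succ n => simp only [fieldLevel, lp.coeFn_add, Pi.add_apply, map_add]; abel

lemma fieldLevel_smul (ξ : 𝓗) (c : ℂ) (Ψ : Fock 𝓗) (n : ℕ) :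
    fieldLevel ξ (c • Ψ) n = c • fieldLevel ξ Ψ n := by
  cases n <;> simp [fieldLevel]

/-- The field operator `a(ξ)^* + a(ξ)` on the vectors of finite particle number. -/
def fieldOperator (ξ : 𝓗) : Fock 𝓗 →ₗ.[ℂ] Fock 𝓗 where
  domain := finiteParticle 𝓗
  toFun :=
    { toFun := fun Ψ => ⟨fieldLevel ξ Ψ, fieldLevel_memℓp ξ Ψ⟩
      map_add' := fun Ψ Φ => lp.ext (funext fun n => fieldLevel_add ξ Ψ Φ n)
      map_smul' := fun c Ψ => lp.ext (funext fun n => fieldLevel_smul ξ c Ψ n) }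

/-- `U = exp(iA)` for a self-adjoint operator `A`: `U` is the value at time `1` of the strongly
continuous one-parameter unitary group generated by `A`. -/
def IsUnitaryExp {F : Type*} [NormedAddCommGroup F] [InnerProductSpace ℂ F] [CompleteSpace F]
    (A : F →ₗ.[ℂ] F) (U : F →L[ℂ] F) : Prop :=
  ∃ V : ℝ → F →L[ℂ] F,
    (∀ t, V t ∈ unitary (F →L[ℂ] F)) ∧ V 0 = 1 ∧ (∀ s t, V (s + t) = V s * V t) ∧
    (∀ x, Continuous fun t => V t x) ∧
    (∀ x : A.domain, HasDerivAt (fun t => V t (x : F)) (I • A x) 0) ∧ V 1 = U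

/-- `U` is the Weyl operator `W(ξ) = exp(i (a(ξ)^* + a(ξ))⁻)`. -/
def IsWeyl (ξ : 𝓗) (U : Fock 𝓗 →L[ℂ] Fock 𝓗) : Prop :=
  IsUnitaryExp (fieldOperator ξ).closure U

/-- The von Neumann algebra `{W(h) : h ∈ H}''` of a closed real subspace `H`. -/
def weylAlgebra (H : ClosedSubmodule ℝ 𝓗) : Subalgebra ℂ (Fock 𝓗 →L[ℂ] Fock 𝓗) :=
  Subalgebra.centralizer ℂ (Set.centralizer {U | ∃ h ∈ H, IsWeyl h U})

/-- The second quantization `⨁ₙ A ⊗ ⋯ ⊗ A` of an operator on `𝓗`: the closure of the linear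
operator with `x ⊗ ⋯ ⊗ x ↦ A x ⊗ ⋯ ⊗ A x` for `x` in the domain of `A`. -/
def secondQuantization (A : 𝓗 →ₗ.[ℂ] 𝓗) : Fock 𝓗 →ₗ.[ℂ] Fock 𝓗 :=
  (Submodule.span ℂ {q : Fock 𝓗 × Fock 𝓗 | ∃ (n : ℕ) (x : A.domain),
    q = (fockTensor (x : 𝓗) n, fockTensor (A x) n)}).topologicalClosure.toLinearPMap

/-! ### The modular operator of a closed real subspace -/

/-- The complex orthogonal complement `H^⊥`. -/
def complexOrthogonal (H : ClosedSubmodule ℝ 𝓗) : Submodule ℂ 𝓗 :=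
  (Submodule.span ℂ (H : Set 𝓗))ᗮ

/-- The closed complex subspace `H ∩ iH`. -/
def complexPart (H : ClosedSubmodule ℝ 𝓗) : Submodule ℂ 𝓗 where
  carrier := {x | x ∈ H ∧ I • x ∈ H}
  zero_mem' := by simp
  add_mem' := by
    rintro x y ⟨hx, hx'⟩ ⟨hy, hy'⟩
    exact ⟨H.add_mem hx hy, by rw [smul_add]; exact H.add_mem hx' hy'⟩
  smul_mem' := by
    rintro c x ⟨hx, hx'⟩
    have h1 : c • x = c.re • x + c.im • (I • x) := by
      conv_lhs => rw [← Complex.re_add_im c]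
      rw [add_smul, mul_smul]
      rfl
    have h2 : I • c • x = c.re • (I • x) + (-c.im) • x := by
      rw [h1, smul_add, smul_comm I c.re, smul_comm I c.im, smul_smul I I, I_mul_I]
      simp
    refine ⟨?_, ?_⟩
    · rw [h1]; exact H.add_mem (H.smul_mem _ hx) (H.smul_mem _ hx')
    · rw [h2]; exact H.add_mem (H.smul_mem _ hx') (H.smul_mem _ hx)

lemma isClosed_complexPart (H : ClosedSubmodule ℝ 𝓗) :
    IsClosed (complexPart H : Set 𝓗) := by
  have h : (complexPart H : Set 𝓗) = (H : Set 𝓗) ∩ (fun x : 𝓗 => I • x) ⁻¹' (H : Set 𝓗) := rfl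
  rw [h]
  exact H.isClosed.inter (H.isClosed.preimage (continuous_const_smul I))

/-- The standard part of `H`, the complex orthogonal complement of `H ∩ iH` in `H`. It is a
standard subspace of the orthogonal complement of `H^⊥ ⊕ (H ∩ iH)`. -/
def standardPart (H : ClosedSubmodule ℝ 𝓗) : Submodule ℝ 𝓗 :=
  H.toSubmodule ⊓ (complexPart H)ᗮ.restrictScalars ℝ

lemma mem_standardPart {H : ClosedSubmodule ℝ 𝓗} {x : 𝓗} :
    x ∈ standardPart H ↔ x ∈ H ∧ x ∈ (complexPart H)ᗮ := Iff.rfl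

/-- The graph of the Tomita operator: it vanishes on `H^⊥` and on `H ∩ iH`, and acts as
`h₁ + i h₂ ↦ h₁ - i h₂` for `h₁, h₂` in the standard part. -/
def tomitaGraph (H : ClosedSubmodule ℝ 𝓗) : Submodule ℝ (𝓗 × 𝓗) where
  carrier := {q | ∃ u ∈ complexOrthogonal H, ∃ v ∈ complexPart H,
    ∃ h₁ ∈ standardPart H, ∃ h₂ ∈ standardPart H,
      q = (u + v + (h₁ + I • h₂), h₁ - I • h₂)}
  zero_mem' := ⟨0, zero_mem _, 0, zero_mem _, 0, zero_mem _, 0, zero_mem _, by ext <;> simp⟩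
  add_mem' := by
    rintro _ _ ⟨u, hu, v, hv, h₁, hh₁, h₂, hh₂, rfl⟩ ⟨u', hu', v', hv', h₁', hh₁', h₂', hh₂', rfl⟩
    refine ⟨u + u', add_mem hu hu', v + v', add_mem hv hv', h₁ + h₁', add_mem hh₁ hh₁',
      h₂ + h₂', add_mem hh₂ hh₂', ?_⟩
    ext <;> simp only [Prod.fst_add, Prod.snd_add, smul_add] <;> abel
  smul_mem' := by
    rintro c _ ⟨u, hu, v, hv, h₁, hh₁, h₂, hh₂, rfl⟩
    refine ⟨c • u, (complexOrthogonal H).restrictScalars ℝ |>.smul_mem c hu,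
      c • v, (complexPart H).restrictScalars ℝ |>.smul_mem c hv,
      c • h₁, Submodule.smul_mem _ c hh₁, c • h₂, Submodule.smul_mem _ c hh₂, ?_⟩
    ext <;> simp only [Prod.smul_fst, Prod.smul_snd, smul_add, smul_sub, smul_comm I c]

/-- The Tomita operator `S_H`, an antilinear operator, regarded as a real linear one. -/
def tomita (H : ClosedSubmodule ℝ 𝓗) : 𝓗 →ₗ.[ℝ] 𝓗 := (tomitaGraph H).toLinearPMap

lemma tomita_graph (H : ClosedSubmodule ℝ 𝓗) : (tomita H).graph = tomitaGraph H := by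
  refine Submodule.toLinearPMap_graph_eq _ ?_
  rintro ⟨x, y⟩ ⟨u, hu, v, hv, h₁, hh₁, h₂, hh₂, hq⟩ hx
  obtain ⟨rfl, rfl⟩ := Prod.mk.inj hq
  simp only at hx ⊢
  -- the vector `w = h₁ + i h₂` is orthogonal to `u` and to `v`
  have hspan : ∀ h ∈ H, h ∈ Submodule.span ℂ (H : Set 𝓗) := fun h hh => Submodule.subset_span hh
  have hw : h₁ + I • h₂ ∈ Submodule.span ℂ (H : Set 𝓗) :=
    add_mem (hspan _ hh₁.1) (Submodule.smul_mem _ _ (hspan _ hh₂.1))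
  have hw' : h₁ + I • h₂ ∈ (complexPart H)ᗮ :=
    add_mem (mem_standardPart.1 hh₁).2 (Submodule.smul_mem _ _ (mem_standardPart.1 hh₂).2)
  have h0 : h₁ + I • h₂ = 0 := by
    have e : inner ℂ (h₁ + I • h₂) (u + v + (h₁ + I • h₂)) = 0 := by rw [hx, inner_zero_right]
    rw [inner_add_right, inner_add_right, hu _ hw,
      (Submodule.mem_orthogonal' _ _).1 hw' v hv, zero_add, zero_add] at e
    exact inner_self_eq_zero.1 e
  have h1 : h₂ ∈ complexPart H := by
    refine ⟨hh₂.1, ?_⟩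
    rw [← neg_eq_of_add_eq_zero_right h0]
    exact H.toSubmodule.neg_mem hh₁.1
  have h2 : h₂ = 0 := inner_self_eq_zero.1 ((mem_standardPart.1 hh₂).2 h₂ h1)
  subst h2
  simpa using h0

lemma mem_tomita_graph {H : ClosedSubmodule ℝ 𝓗} {x y : 𝓗} :
    (x, y) ∈ (tomita H).graph ↔ ∃ u ∈ complexOrthogonal H, ∃ v ∈ complexPart H,
      ∃ h₁ ∈ standardPart H, ∃ h₂ ∈ standardPart H,
        x = u + v + (h₁ + I • h₂) ∧ y = h₁ - I • h₂ := by
  rw [tomita_graph]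
  simp only [tomitaGraph, Submodule.mem_mk, AddSubmonoid.mem_mk, AddSubsemigroup.mem_mk,
    Set.mem_ofPred_eq, Prod.mk.injEq]

lemma tomita_graph_I {H : ClosedSubmodule ℝ 𝓗} {x y : 𝓗} (h : (x, y) ∈ (tomita H).graph) :
    (I • x, -(I • y)) ∈ (tomita H).graph := by
  obtain ⟨u, hu, v, hv, h₁, hh₁, h₂, hh₂, rfl, rfl⟩ := mem_tomita_graph.1 h
  refine mem_tomita_graph.2 ⟨I • u, Submodule.smul_mem _ _ hu, I • v, Submodule.smul_mem _ _ hv,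
    -h₂, neg_mem hh₂, h₁, hh₁, ?_, ?_⟩
  · simp only [smul_add, smul_smul, I_mul_I, neg_smul, one_smul]; abel
  · simp only [smul_sub, smul_smul, I_mul_I, neg_smul, one_smul]; abel

variable [CompleteSpace 𝓗]

lemma dense_tomita_domain (H : ClosedSubmodule ℝ 𝓗) : Dense ((tomita H).domain : Set 𝓗) := by
  have hdom : ∀ x y, (x, y) ∈ (tomita H).graph → x ∈ (tomita H).domain := fun x y h => by
    obtain ⟨z, hz, -⟩ := (LinearPMap.mem_graph_iff _).1 h
    have hz' : (z : 𝓗) = x := hz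
    exact hz' ▸ z.2
  rw [Submodule.dense_iff_topologicalClosure_eq_top,
    Submodule.topologicalClosure_eq_top_iff, Submodule.eq_bot_iff]
  intro x hx
  have : CompleteSpace (complexPart H) := (isClosed_complexPart H).completeSpace_coe
  -- `H` is contained in the domain
  have hH : ∀ h ∈ H, h ∈ (tomita H).domain ∧ I • h ∈ (tomita H).domain := by
    intro h hh
    have hv := (complexPart H).starProjection_apply_mem h
    have hw : h - (complexPart H).starProjection h ∈ standardPart H :=
      mem_standardPart.2 ⟨H.toSubmodule.sub_mem hh hv.1,
        (complexPart H).sub_starProjection_mem_orthogonal h⟩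
    have hg : (h, h - (complexPart H).starProjection h) ∈ (tomita H).graph :=
      mem_tomita_graph.2 ⟨0, zero_mem _, _, hv, _, hw, 0, zero_mem _, by simp, by simp⟩
    exact ⟨hdom _ _ hg, hdom _ _ (tomita_graph_I hg)⟩
  have hxH : x ∈ complexOrthogonal H := by
    rw [complexOrthogonal, Submodule.mem_orthogonal]
    intro w hw
    induction hw using Submodule.span_induction with
    | mem h hh =>
      have h1 : (inner ℂ h x).re = 0 := (Submodule.mem_orthogonal _ _).1 hx h (hH h hh).1
      have h2 : (inner ℂ (I • h) x).re = 0 :=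
        (Submodule.mem_orthogonal _ _).1 hx (I • h) (hH h hh).2
      rw [inner_smul_left] at h2
      refine Complex.ext h1 ?_
      simpa using h2
    | zero => simp
    | add a b _ _ ha hb => rw [inner_add_left, ha, hb, add_zero]
    | smul c a _ ha => rw [inner_smul_left, ha, mul_zero]
  have hxd : x ∈ (tomita H).domain :=
    hdom x 0 (mem_tomita_graph.2
      ⟨x, hxH, 0, zero_mem _, 0, zero_mem _, 0, zero_mem _, by simp, by simp⟩)
  exact inner_self_eq_zero.1 ((Submodule.mem_orthogonal _ _).1 hx x hxd)

lemma tomita_adjoint_graph_I {H : ClosedSubmodule ℝ 𝓗} {x y : 𝓗}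
    (h : (x, y) ∈ (tomita H).adjoint.graph) :
    (I • x, -(I • y)) ∈ (tomita H).adjoint.graph := by
  rw [LinearPMap.adjoint_graph_eq_graph_adjoint (dense_tomita_domain H),
    Submodule.mem_adjoint_iff] at h ⊢
  intro a b hab
  have key := h _ _ (tomita_graph_I hab)
  simp only [ClosedSubmodule.inner_real_eq_re_inner, inner_neg_left, inner_neg_right,
    inner_smul_left, inner_smul_right] at key ⊢
  simp only [conj_I, neg_mul, Complex.neg_re, Complex.mul_re, I_re, I_im, zero_mul, one_mul,
    zero_sub, neg_neg] at key ⊢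
  linarith

/-- The graph of `S_H^* S_H`. -/
def modularGraph (H : ClosedSubmodule ℝ 𝓗) : Submodule ℂ (𝓗 × 𝓗) where
  carrier := {q | ∃ y, (q.1, y) ∈ (tomita H).graph ∧ (y, q.2) ∈ (tomita H).adjoint.graph}
  zero_mem' := ⟨0, zero_mem _, zero_mem _⟩
  add_mem' := by
    rintro _ _ ⟨y, hy, hy'⟩ ⟨z, hz, hz'⟩
    exact ⟨y + z, add_mem hy hz, add_mem hy' hz'⟩
  smul_mem' := by
    rintro c ⟨x, z⟩ ⟨y, hy, hz⟩
    have h1 : ∀ w : 𝓗, c • w = c.re • w + c.im • (I • w) := fun w => by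
      conv_lhs => rw [← Complex.re_add_im c]
      rw [add_smul, mul_smul]
      rfl
    refine ⟨c.re • y + c.im • -(I • y), ?_, ?_⟩
    · have := add_mem (Submodule.smul_mem _ c.re hy) (Submodule.smul_mem _ c.im (tomita_graph_I hy))
      simpa only [Prod.smul_mk, h1, Prod.mk_add_mk] using this
    · have h3 := Submodule.smul_mem _ (-c.im) (tomita_adjoint_graph_I hz)
      have := add_mem (Submodule.smul_mem _ c.re hz) h3
      simpa only [Prod.smul_mk, h1, Prod.mk_add_mk, neg_smul, smul_neg, neg_neg, Prod.neg_mk]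
        using this

/-- The modular operator `Δ_H = S_H^* S_H`. -/
def modularOperator (H : ClosedSubmodule ℝ 𝓗) : 𝓗 →ₗ.[ℂ] 𝓗 := (modularGraph H).toLinearPMap

lemma mem_modularOperator_graph {H : ClosedSubmodule ℝ 𝓗} {x z : 𝓗} :
    (x, z) ∈ (modularOperator H).graph ↔
      ∃ y, (x, y) ∈ (tomita H).graph ∧ (y, z) ∈ (tomita H).adjoint.graph := by
  rw [modularOperator, Submodule.toLinearPMap_graph_eq]
  · rfl
  · rintro ⟨x, z⟩ ⟨y, hy, hz⟩ hx
    simp only at hx hy hz ⊢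
    exact LinearPMap.graph_fst_eq_zero_snd _ hz (LinearPMap.graph_fst_eq_zero_snd _ hy hx)

/-- `B` is the bounded operator `(1 + A)⁻¹`. -/
def IsShiftInverse (A : 𝓗 →ₗ.[ℂ] 𝓗) (B : 𝓗 →L[ℂ] 𝓗) : Prop :=
  ∀ x y, (x, y) ∈ A.graph ↔ B (x + y) = x

open Classical in
/-- The bounded operator `(1 + A)⁻¹` for a positive self-adjoint operator `A`. -/
def shiftInverse (A : 𝓗 →ₗ.[ℂ] 𝓗) : 𝓗 →L[ℂ] 𝓗 :=
  if h : ∃ B, IsShiftInverse A B then h.choose else 0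

/-- The power `A ^ α`, `α > 0`, of a positive self-adjoint operator `A`, in the sense of the
spectral calculus. With `B = (1 + A)⁻¹`, a bounded operator with `0 ≤ B ≤ 1`, one has
`A = (1 - B) B⁻¹`, the domain of `A ^ α` is the range of `B ^ α = (1 + A) ^ (-α)`, and
`A ^ α (B ^ α ξ) = (1 - B) ^ α ξ`. The powers of `B` and `1 - B` are those of the continuous
functional calculus. -/
def positivePower (A : 𝓗 →ₗ.[ℂ] 𝓗) (α : ℝ) : 𝓗 →ₗ.[ℂ] 𝓗 :=
  (LinearMap.range ((shiftInverse A ^ α).toLinearMap.prod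
    ((1 - shiftInverse A) ^ α).toLinearMap)).toLinearPMap

/-- The real orthogonal projection `E_H` onto `H`, for the scalar product `Re ⟪·, ·⟫`. -/
def realProjection (H : ClosedSubmodule ℝ 𝓗) : 𝓗 →L[ℝ] 𝓗 := H.toSubmodule.starProjection

end BoseFock

end

open scoped ClosedSubmodule

noncomputable section

namespace BoseFock

open scoped TensorProduct InnerProductSpace
open Complex UniformSpace

universe u

/-! ### Taylor coefficients of entire functions along a sequence of directions -/

section Taylor

open Finset

variable {V E E' : Type*} [NormedAddCommGroup V] [NormedSpace ℂ V]
  [NormedAddCommGroup E] [NormedSpace ℂ E] [NormedAddCommGroup E'] [NormedSpace ℂ E']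

/-! Write `e(x)` for the coherent vector `coherent x`, with `⟨e(x), e(y)⟩ = exp ⟨x, y⟩`, let `K` be
the smaller subspace, `R = B ^ α` and `C = (1 - B) ^ α` with `B = (1 + Δ)⁻¹`, so that `Δ ^ α` is the
operator `R w ↦ C w`, and let `T = Δ ^ α E_K`. The vector `X A Ω` is recovered from its scalar
products with the `e(R w)`, which must be `⟨e(C w), A Ω⟩`.

An operator `A` in the Weyl algebra of `K` commutes with every displacement operator whose direction
is real orthogonal to `K`. Using this commutation once directly and once after analytic continuation
to imaginary parameters, `⟨e(η), A Ω⟩` becomes an expression in the real components of `η` and `iη`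
along `K` (`inner_coherent_vacuum`). For `η = C w` these components may be replaced by those of `T*
R w` and `T* (i R w)`, so `⟨e(C w), A Ω⟩` is the conjugate of `symbol T* A` at `R w`
(`conj_symbol_eq`). The symbol makes sense at every `ξ`, is entire, and is bounded by `‖A‖ exp(‖T*
(iξ)‖² / 2)` (`norm_symbol_le`).

It remains to find a vector `Ξ A` with `⟨e(ξ), Ξ A⟩` equal to the conjugate symbol. As `‖T‖ < 1` and
the approximation numbers of `T` decay rapidly, there are orthogonal directions `u j` and rapidly
decaying `c j ≤ θ < 1` with `‖T* (i ∑ z j u j)‖² ≤ ∑ c j |z j|²` (`exists_diagonal_bound`). Cauchy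
estimates in each `z j` bound the Taylor coefficients of the symbol and of `e` along `u`. The series
`Ξ A = ∑ n! conj(symbol coefficient) • (coefficient of e)` has terms of size at most `‖A‖` times a
product of factors `e n j (c j) ^ (n j / 2)` over the `j` with `n j > 0`, by Stirling. These
products are `p`-summable over all multi-indices for each `p > 0`: `θ < 1` controls large degrees
and the decay of `c` controls the number of variables. Thus `Ξ` is a `p`-summable series of rank one
maps, hence `ℓ^p` (`isEllP_of_hasSum`).

Finally `⟨e(C w), A Ω⟩ = ⟨e(R w), Ξ A⟩` for all `w` places `(A Ω, Ξ A)` in the graph of `X`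
(`mem_secondQuantization_graph`). -/

/-- `f` is an entire analytic function. -/
abbrev Entire (f : V → E) : Prop := AnalyticOnNhd ℂ f Set.univ

/-- The `k`-th Taylor coefficient of `f` in the direction `v`, as a function of the base point. -/
def dirCoeff (v : V) (k : ℕ) (f : V → E) (ξ : V) : E :=
  (k.factorial : ℂ)⁻¹ • iteratedDeriv k (fun z : ℂ => f (ξ + z • v)) 0

lemma Entire.differentiable_line {f : V → E} (hf : Entire f) (ξ v : V) :
    Differentiable ℂ fun z : ℂ => f (ξ + z • v) := by
  intro z
  have h1 : DifferentiableAt ℂ f (ξ + z • v) := (hf _ (Set.mem_univ _)).differentiableAt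
  exact DifferentiableAt.fun_comp' (g := f) z h1 (by fun_prop)

/-- The derivatives along parallel lines are values of one entire function on `V`. Hence `dirCoeff`
is again entire in the base point and can be iterated over several directions. -/
lemma iteratedDeriv_line [CompleteSpace E] {f : V → E} (hf : Entire f) (v : V) (k : ℕ) :
    ∃ g : V → E, Entire g ∧
      ∀ ξ w, iteratedDeriv k (fun z : ℂ => f (ξ + z • v)) w = g (ξ + w • v) := by
  induction k with
  | zero => exact ⟨f, hf, fun ξ w => by simp⟩
  | succ k ih =>
    obtain ⟨g, hg, h⟩ := ih
    refine ⟨fun ξ => fderiv ℂ g ξ v, fun ξ hξ => ?_, fun ξ w => ?_⟩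
    · exact ((ContinuousLinearMap.apply ℂ E v).analyticAt _).comp (hg.fderiv ξ hξ)
    · rw [iteratedDeriv_succ, show iteratedDeriv k (fun z : ℂ => f (ξ + z • v)) =
        fun w => g (ξ + w • v) from funext (h ξ)]
      have h1 : HasFDerivAt g (fderiv ℂ g (ξ + w • v)) (ξ + w • v) :=
        (hg _ (Set.mem_univ _)).differentiableAt.hasFDerivAt
      have h2 : HasDerivAt (fun z : ℂ => ξ + z • v) v w := by
        simpa using ((hasDerivAt_id w).smul_const v).const_add ξ
      exact (h1.comp_hasDerivAt w h2).deriv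

lemma Entire.dirCoeff [CompleteSpace E] {f : V → E} (hf : Entire f) (v : V) (k : ℕ) :
    Entire (dirCoeff v k f) := by
  obtain ⟨g, hg, h⟩ := iteratedDeriv_line hf v k
  have : BoseFock.dirCoeff v k f = fun ξ => (k.factorial : ℂ)⁻¹ • g ξ := by
    funext ξ
    simp [BoseFock.dirCoeff, h]
  rw [this]
  exact fun ξ hξ => analyticAt_const.smul (hg ξ hξ)

lemma dirCoeff_zero (v : V) (f : V → E) : dirCoeff v 0 f = f := by
  funext ξ; simp [dirCoeff]

lemma hasSum_dirCoeff [CompleteSpace E] {f : V → E} (hf : Entire f) (ξ v : V) (z : ℂ) :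
    HasSum (fun k : ℕ => z ^ k • dirCoeff v k f ξ) (f (ξ + z • v)) := by
  have := Complex.hasSum_taylorSeries_of_entire (hf.differentiable_line ξ v) 0 z
  refine this.congr_fun fun k => ?_
  rw [dirCoeff, sub_zero, smul_comm]

lemma dirCoeff_clm_comp [CompleteSpace E] (L : E →L[ℂ] E') {f : V → E} (hf : Entire f) (v : V)
    (k : ℕ) (ξ : V) :
    dirCoeff v k (fun x => L (f x)) ξ = L (dirCoeff v k f ξ) := by
  have hd : ContDiff ℂ k fun z : ℂ => f (ξ + z • v) := by
    refine ContDiff.comp (g := f) ?_ (by fun_prop)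
    exact contDiff_iff_contDiffAt.2 fun x => (hf x (Set.mem_univ _)).contDiffAt
  have := L.iteratedFDeriv_comp_left (i := k) (x := 0) hd.contDiffAt le_rfl
  simp only [dirCoeff, map_smul, iteratedDeriv_eq_iteratedFDeriv]
  congr 1
  exact congrArg (fun q => q fun _ => (1 : ℂ)) this

/-- The growth rate of the `k`-th Taylor coefficient of a function of order `exp (c |z| ^ 2 / 2)`. -/
def cauchyRate (c : ℝ) (k : ℕ) : ℝ := (Real.exp 1 * c / k) ^ ((k : ℝ) / 2)

/-- The base is a division by zero at `k = 0`, but the exponent `0` still gives the correct value.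
-/
lemma cauchyRate_zero (c : ℝ) : cauchyRate c 0 = 1 := by simp [cauchyRate]

lemma cauchyRate_nonneg {c : ℝ} (hc : 0 ≤ c) (k : ℕ) : 0 ≤ cauchyRate c k := by
  unfold cauchyRate; positivity

/-- The radius `√(k / c)` minimizes `exp (c r² / 2) / r ^ k`, and `cauchyRate` is this minimum. -/
lemma cauchyRate_eq {c : ℝ} (hc : 0 < c) {k : ℕ} (hk : k ≠ 0) :
    Real.exp (c * (k / c) / 2) / √(k / c) ^ k = cauchyRate c k := by
  have hk' : (0 : ℝ) < k := by positivity
  rw [cauchyRate, Real.sqrt_eq_rpow, ← Real.rpow_natCast, ← Real.rpow_mul (by positivity),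
    mul_div_assoc (Real.exp 1), Real.mul_rpow (by positivity) (by positivity), ← Real.exp_mul,
    ← inv_div (k : ℝ) c,
    Real.inv_rpow (by positivity), div_eq_mul_inv]
  congr 2
  · field_simp
  · congr 1; ring

/-- Cauchy's estimate on the circle of the optimal radius `√(k / c)`. -/
lemma norm_dirCoeff_le [CompleteSpace E] {f : V → E} (hf : Entire f) (ξ v : V) {M c : ℝ}
    (hc : 0 < c) (hM : ∀ z : ℂ, ‖f (ξ + z • v)‖ ≤ M * Real.exp (c * ‖z‖ ^ 2 / 2)) (k : ℕ) :
    ‖dirCoeff v k f ξ‖ ≤ M * cauchyRate c k := by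
  rcases eq_or_ne k 0 with rfl | hk
  · simpa [dirCoeff_zero, cauchyRate_zero] using hM 0
  have hk' : (0 : ℝ) < k := by positivity
  have hR : 0 < √(k / c) := by positivity
  have h := Complex.norm_iteratedDeriv_le_of_forall_mem_sphere_norm_le k hR
    (hf.differentiable_line ξ v).diffContOnCl (c := 0) (C := M * Real.exp (c * (k / c) / 2))
    (fun z hz => by
      have hz' : ‖z‖ = √(k / c) := by simpa using hz
      refine (hM z).trans_eq ?_
      rw [hz', Real.sq_sqrt (by positivity)])
  rw [dirCoeff, norm_smul, ← cauchyRate_eq hc hk]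
  simp only [norm_inv, Complex.norm_natCast]
  calc _ ≤ (k.factorial : ℝ)⁻¹ * (k.factorial * (M * Real.exp (c * (k / c) / 2)) / √(k / c) ^ k) := by
        gcongr
    _ = _ := by field_simp

/-- The Taylor coefficient of `f` in the directions `v 0, …, v (m - 1)`, of order `n j` in the
direction `v j`, as a function of the base point. -/
def multiCoeff (v : ℕ → V) (n : ℕ → ℕ) (f : V → E) : ℕ → V → E
  | 0 => f
  | m + 1 => dirCoeff (v m) (n m) (multiCoeff v n f m)

lemma Entire.multiCoeff [CompleteSpace E] {f : V → E} (hf : Entire f) (v : ℕ → V) (n : ℕ → ℕ)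
    (m : ℕ) : Entire (multiCoeff v n f m) := by
  induction m with
  | zero => exact hf
  | succ m ih => exact ih.dirCoeff _ _

lemma multiCoeff_congr (v : ℕ → V) {n n' : ℕ → ℕ} (f : V → E) {m : ℕ}
    (h : ∀ j < m, n j = n' j) : multiCoeff v n f m = multiCoeff v n' f m := by
  induction m with
  | zero => rfl
  | succ m ih =>
    simp only [multiCoeff]
    rw [ih fun j hj => h j (by omega), h m (by omega)]

lemma multiCoeff_of_le (v : ℕ → V) {n : ℕ → ℕ} (f : V → E) {m m' : ℕ} (hm : m ≤ m')
    (h : ∀ j, m ≤ j → n j = 0) : multiCoeff v n f m' = multiCoeff v n f m := by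
  induction m', hm using Nat.le_induction with
  | base => rfl
  | succ k hk ih => simp only [multiCoeff]; rw [h k hk, dirCoeff_zero, ih]

lemma multiCoeff_clm_comp [CompleteSpace E] (L : E →L[ℂ] E') {f : V → E} (hf : Entire f)
    (v : ℕ → V) (n : ℕ → ℕ) (m : ℕ) (ξ : V) :
    multiCoeff v n (fun x => L (f x)) m ξ = L (multiCoeff v n f m ξ) := by
  induction m generalizing ξ with
  | zero => rfl
  | succ m ih =>
    simp only [multiCoeff]
    rw [show multiCoeff v n (fun x => L (f x)) m = fun x => L (multiCoeff v n f m x) from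
      funext ih, dirCoeff_clm_comp L (hf.multiCoeff v n m)]

/-- Cauchy's estimate is applied to one variable at a time. The variables from `m` to `m' - 1` stay
free in the base point, with their Gaussian bound, so that the next one is available for the
induction. -/
lemma norm_multiCoeff_le [CompleteSpace E] {f : V → E} (hf : Entire f) (v : ℕ → V) {M : ℝ}
    {c : ℕ → ℝ} (hc : ∀ j, 0 < c j)
    (hM : ∀ (m : ℕ) (z : ℕ → ℂ), ‖f (∑ j ∈ range m, z j • v j)‖ ≤
      M * Real.exp ((∑ j ∈ range m, c j * ‖z j‖ ^ 2) / 2)) (n : ℕ → ℕ) (m m' : ℕ) (hm : m ≤ m')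
    (z : ℕ → ℂ) :
    ‖multiCoeff v n f m (∑ j ∈ Ico m m', z j • v j)‖ ≤
      (M * ∏ j ∈ range m, cauchyRate (c j) (n j)) *
        Real.exp ((∑ j ∈ Ico m m', c j * ‖z j‖ ^ 2) / 2) := by
  induction m generalizing z with
  | zero => simpa [multiCoeff] using hM m' z
  | succ m ih =>
    simp only [multiCoeff]
    have key := norm_dirCoeff_le (hf.multiCoeff v n m) (∑ j ∈ Ico (m + 1) m', z j • v j) (v m)
      (M := (M * ∏ j ∈ range m, cauchyRate (c j) (n j)) *
        Real.exp ((∑ j ∈ Ico (m + 1) m', c j * ‖z j‖ ^ 2) / 2)) (hc m) (fun w => by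
        -- The variable `w` of the new Cauchy estimate takes the place of `z m`; its Gaussian factor
        -- splits off.
        have h := ih (by omega) (Function.update z m w)
        rw [sum_eq_sum_Ico_succ_bot (by omega : m < m'),
          sum_eq_sum_Ico_succ_bot (by omega : m < m')] at h
        have h1 : ∀ j ∈ Ico (m + 1) m', Function.update z m w j = z j := fun j hj => by
          rw [mem_Ico] at hj
          exact Function.update_of_ne (by omega) _ _
        rw [sum_congr rfl (fun j hj => by rw [h1 j hj]),
          sum_congr (f := fun j => c j * ‖Function.update z m w j‖ ^ 2) rfl
            (fun j hj => by rw [h1 j hj])] at h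
        simp only [Function.update_self] at h
        rw [add_comm]
        refine h.trans_eq ?_
        rw [add_div, Real.exp_add]
        ring) (n m)
    refine key.trans_eq ?_
    rw [prod_range_succ]
    ring

end Taylor

section Taylor

open Finset

/-! ### Sums over multi-indices -/

/-- A multi-index in `m` variables, extended by zero. -/
def extendZero {m : ℕ} (n : Fin m → ℕ) : ℕ →₀ ℕ :=
  Finsupp.onFinset (range m) (fun j => if h : j < m then n ⟨j, h⟩ else 0) fun j hj => by
    by_contra h
    simp_all

lemma extendZero_of_lt {m : ℕ} (n : Fin m → ℕ) {j : ℕ} (h : j < m) :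
    extendZero n j = n ⟨j, h⟩ := by simp [extendZero, h]

lemma extendZero_of_le {m : ℕ} (n : Fin m → ℕ) {j : ℕ} (h : m ≤ j) :
    extendZero n j = 0 := by simp [extendZero, h]

lemma extendZero_injective (m : ℕ) : Function.Injective (extendZero (m := m)) := by
  intro n n' h
  funext j
  have := DFunLike.congr_fun h j.1
  simpa [extendZero_of_lt _ j.2] using this

lemma mem_range_extendZero {m : ℕ} {n : ℕ →₀ ℕ} (h : ∀ j, m ≤ j → n j = 0) :
    n ∈ Set.range (extendZero (m := m)) := by
  refine ⟨fun j => n j, ?_⟩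
  ext j
  rcases lt_or_ge j m with hj | hj
  · rw [extendZero_of_lt _ hj]
  · rw [extendZero_of_le _ hj, h j hj]

/-- A bound for the variables that occur in a multi-index. -/
def indexBound (n : ℕ →₀ ℕ) : ℕ := n.support.sup id + 1

lemma eq_zero_of_indexBound_le {n : ℕ →₀ ℕ} {j : ℕ} (h : indexBound n ≤ j) : n j = 0 := by
  by_contra hj
  have := le_sup (f := id) (Finsupp.mem_support_iff.2 hj)
  simp only [indexBound, id] at h this
  omega

lemma finsupp_prod_eq_prod_range {R : Type*} [CommMonoid R] {r : ℕ → ℕ → R} (hr : ∀ j, r j 0 = 1)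
    {n : ℕ →₀ ℕ} {m : ℕ} (h : ∀ j, m ≤ j → n j = 0) :
    n.prod r = ∏ j ∈ range m, r j (n j) := by
  refine Finsupp.prod_of_support_subset n (fun j hj => ?_) r fun j _ => hr j
  rw [mem_range]
  by_contra hj'
  exact Finsupp.mem_support_iff.1 hj (h j (by omega))

lemma extendZero_prod {R : Type*} [CommMonoid R] {r : ℕ → ℕ → R} (hr : ∀ j, r j 0 = 1)
    {m : ℕ} (n : Fin m → ℕ) : (extendZero n).prod r = ∏ j : Fin m, r j (n j) := by
  rw [finsupp_prod_eq_prod_range hr (m := m) (fun j hj => extendZero_of_le n hj), prod_range]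
  exact prod_congr rfl fun j _ => by rw [extendZero_of_lt n j.2]

/-- A sum of products over a box is the product of the sums, and `1 + F j ≤ exp (F j)` makes the
bound independent of the box. -/
lemma sum_piFinset_le {m N : ℕ} {r : ℕ → ℕ → ℝ} (h0 : ∀ j k, 0 ≤ r j k)
    {F : ℕ → ℝ} (hF : ∀ j (N : ℕ), ∑ k ∈ range N, r j k ≤ 1 + F j)
    (hF0 : ∀ j, 0 ≤ F j) (hs : Summable F) :
    ∑ n ∈ Fintype.piFinset (fun _ : Fin m => range N), ∏ j : Fin m, r j (n j) ≤
      Real.exp (∑' j, F j) := by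
  rw [← prod_univ_sum]
  calc ∏ j : Fin m, ∑ k ∈ range N, r j k ≤ ∏ j : Fin m, Real.exp (F j) := by
        refine prod_le_prod (fun j _ => sum_nonneg fun k _ => h0 _ _) fun j _ => ?_
        exact (hF _ _).trans (by linarith [Real.add_one_le_exp (F j)])
    _ = Real.exp (∑ j ∈ range m, F j) := by
        rw [Real.exp_sum, prod_range (fun j => Real.exp (F j))]
    _ ≤ _ := Real.exp_le_exp.2 (hs.sum_le_tsum _ fun j _ => hF0 j)

/-- Every finite set of multi-indices lies in a box, so the uniform bound on boxes gives
summability. -/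
lemma summable_finsupp_prod {r : ℕ → ℕ → ℝ} (hr : ∀ j, r j 0 = 1) (h0 : ∀ j k, 0 ≤ r j k)
    {F : ℕ → ℝ} (hF : ∀ j (N : ℕ), ∑ k ∈ range N, r j k ≤ 1 + F j)
    (hF0 : ∀ j, 0 ≤ F j) (hs : Summable F) :
    Summable fun n : ℕ →₀ ℕ => n.prod r := by
  classical
  refine summable_of_sum_le (c := Real.exp (∑' j, F j))
    (fun n => prod_nonneg fun j _ => h0 _ _) fun s => ?_
  set m := s.sup indexBound with hm
  set N := s.sup (fun n => n.support.sup n + 1) with hN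
  have hsub : s ⊆ (Fintype.piFinset (fun _ : Fin m => range N)).image extendZero := by
    intro n hn
    obtain ⟨p, rfl⟩ := mem_range_extendZero (m := m) (n := n) fun j hj =>
      eq_zero_of_indexBound_le ((le_sup (f := indexBound) hn).trans hj)
    refine mem_image_of_mem _ (Fintype.mem_piFinset.2 fun j => ?_)
    have h1 := le_sup (f := fun n : ℕ →₀ ℕ => n.support.sup n + 1) hn
    rw [← hN] at h1
    rw [mem_range]
    rcases Nat.eq_zero_or_pos (p j) with h | h
    · omega
    · have h2 : (j : ℕ) ∈ (extendZero p).support := by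
        rw [Finsupp.mem_support_iff, extendZero_of_lt p j.2]; simpa using h.ne'
      have h3 := le_sup (f := (extendZero p)) h2
      rw [extendZero_of_lt p j.2] at h3
      simp only [Fin.eta] at h3
      omega
  refine (sum_le_sum_of_subset_of_nonneg hsub
    fun n _ _ => prod_nonneg fun j _ => h0 _ _).trans ?_
  rw [sum_image fun _ _ _ _ h => extendZero_injective m h]
  exact (sum_congr rfl fun n _ => extendZero_prod hr n).trans_le (sum_piFinset_le h0 hF hF0 hs)

lemma summable_prod_fin {m : ℕ} {r : ℕ → ℕ → ℝ} (h0 : ∀ j k, 0 ≤ r j k)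
    (h : ∀ j, Summable (r j)) :
    Summable fun n : Fin m → ℕ => ∏ j : Fin m, r j (n j) := by
  induction m with
  | zero => exact (hasSum_fintype _).summable
  | succ m ih =>
    rw [← (Fin.snocEquiv fun _ => ℕ).summable_iff]
    have := Summable.mul_of_nonneg (h m) ih (h0 m) fun n => prod_nonneg fun j _ => h0 _ _
    refine this.congr fun x => ?_
    simp [Fin.prod_univ_castSucc, mul_comm, Fin.snocEquiv]

/-- As soon as `k ≥ 4 e c t²`, the base `e c t² / k` is at most `1 / 4`, and the term is at most `(1
/ 2) ^ k`. -/
lemma summable_cauchyRate {c : ℝ} (hc : 0 < c) (t : ℝ) (ht : 0 ≤ t) :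
    Summable fun k : ℕ => cauchyRate c k * t ^ k := by
  have h2 : Summable fun k : ℕ => (1 / 2 : ℝ) ^ k := summable_geometric_two
  obtain ⟨K, hK⟩ := exists_nat_gt (4 * Real.exp 1 * c * t ^ 2)
  rw [← summable_nat_add_iff (K + 1)]
  rw [← summable_nat_add_iff (K + 1)] at h2
  refine Summable.of_nonneg_of_le (fun k => by have := cauchyRate_nonneg hc.le (k + (K + 1)); positivity)
    (fun k => ?_) h2
  set n := k + (K + 1)
  have hn : (0 : ℝ) < n := by positivity
  have hn' : (K : ℝ) ≤ n := by exact_mod_cast (by omega : K ≤ n)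
  have e1 : ∀ s : ℝ, 0 ≤ s → s ^ n = (s ^ 2) ^ ((n : ℝ) / 2) := fun s hs => by
    rw [← Real.rpow_natCast, ← Real.rpow_natCast, ← Real.rpow_mul hs]
    congr 1; push_cast; ring
  rw [cauchyRate, e1 t ht, e1 (1 / 2) (by norm_num), ← Real.mul_rpow (by positivity) (by positivity)]
  refine Real.rpow_le_rpow (by positivity) ?_ (by positivity)
  rw [div_mul_eq_mul_div, div_le_iff₀ hn]
  nlinarith

/-! ### Taylor expansion in finitely many directions -/

variable {V E E' : Type*} [NormedAddCommGroup V] [NormedSpace ℂ V]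
  [NormedAddCommGroup E] [NormedSpace ℂ E] [NormedAddCommGroup E'] [NormedSpace ℂ E']

/-- One variable is expanded at a time. The Cauchy bounds give absolute convergence over all `m + 1`
indices, and summing first over the last index reduces the value of the sum to the case of `m`
variables. -/
lemma hasSum_multiCoeff [CompleteSpace E] {f : V → E} (hf : Entire f) (v : ℕ → V) {M : ℝ}
    {c : ℕ → ℝ} (hc : ∀ j, 0 < c j)
    (hM : ∀ (m : ℕ) (z : ℕ → ℂ), ‖f (∑ j ∈ range m, z j • v j)‖ ≤
      M * Real.exp ((∑ j ∈ range m, c j * ‖z j‖ ^ 2) / 2)) (m m' : ℕ) (hm : m ≤ m')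
    (z : ℕ → ℂ) :
    HasSum (fun n : Fin m → ℕ => (∏ j : Fin m, z j ^ n j) •
      multiCoeff v (extendZero n) f m (∑ j ∈ Ico m m', z j • v j))
      (f (∑ j ∈ range m', z j • v j)) := by
  induction m with
  | zero =>
    simp [multiCoeff]
  | succ m ih =>
    specialize ih (by omega)
    set ξ := ∑ j ∈ Ico (m + 1) m', z j • v j with hξ
    have hsum : Summable fun n : Fin (m + 1) → ℕ => (∏ j : Fin (m + 1), z j ^ n j) •
        multiCoeff v (extendZero n) f (m + 1) ξ := by
      have hs := (summable_prod_fin (m := m + 1)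
        (fun j k => mul_nonneg (cauchyRate_nonneg (hc j).le k) (pow_nonneg (norm_nonneg (z j)) k))
        fun j => summable_cauchyRate (hc j) ‖z j‖ (norm_nonneg _)).mul_left
          (M * Real.exp ((∑ j ∈ Ico (m + 1) m', c j * ‖z j‖ ^ 2) / 2))
      refine Summable.of_norm_bounded hs fun n => ?_
      rw [norm_smul]
      have h1 := norm_multiCoeff_le hf v hc hM (extendZero n) (m + 1) m' hm z
      rw [prod_range, prod_congr (g := fun j : Fin (m + 1) => cauchyRate (c j) (n j)) rfl
        (fun j _ => by rw [extendZero_of_lt n j.2])] at h1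
      rw [prod_mul_distrib, norm_prod]
      simp only [norm_pow]
      calc _ ≤ _ := mul_le_mul_of_nonneg_left h1 (by positivity)
        _ = _ := by ring
    obtain ⟨S, hS⟩ := hsum
    have hS' := hS
    rw [← ((Equiv.prodComm _ _).trans (Fin.snocEquiv fun _ => ℕ)).hasSum_iff] at hS'
    -- For a fixed multi-index in the first `m` variables, the inner sum is the Taylor series in the
    -- direction `v m`.
    have h2 := hS'.prod_fiberwise (g := fun n : Fin m → ℕ => (∏ j : Fin m, z j ^ n j) •
      multiCoeff v (extendZero n) f m (∑ j ∈ Ico m m', z j • v j)) (fun n => by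
        have h3 := (hasSum_dirCoeff (hf.multiCoeff v (extendZero n) m) ξ (v m) (z m)).const_smul
          (∏ j : Fin m, z j ^ n j)
        have e0 : ∑ j ∈ Ico m m', z j • v j = ξ + z m • v m := by
          rw [sum_eq_sum_Ico_succ_bot (by omega : m < m'), add_comm]
        rw [e0]
        refine h3.congr_fun fun k => ?_
        have e1 : multiCoeff v (extendZero (Fin.snoc (α := fun _ => ℕ) n k)) f m =
            multiCoeff v (extendZero n) f m := multiCoeff_congr v f fun j hj => by
          rw [extendZero_of_lt _ (by omega : j < m + 1), extendZero_of_lt _ hj]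
          exact Fin.snoc_castSucc (α := fun _ => ℕ) k n ⟨j, hj⟩
        have e2 : extendZero (Fin.snoc (α := fun _ => ℕ) n k) m = k := by
          rw [extendZero_of_lt _ (by omega : m < m + 1)]
          exact Fin.snoc_last (α := fun _ => ℕ) k n
        simp only [Function.comp, Equiv.trans_apply, Equiv.prodComm_apply, Prod.swap,
          Fin.snocEquiv, Equiv.coe_fn_mk, multiCoeff]
        rw [e1, e2, Fin.prod_univ_castSucc, smul_smul]
        simp)
    rwa [h2.unique ih] at hS

/-- The Taylor coefficient at `0` of `f` for a multi-index `n` and the directions `v`. -/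
def taylorCoeff (v : ℕ → V) (f : V → E) (n : ℕ →₀ ℕ) : E := multiCoeff v n f (indexBound n) 0

lemma taylorCoeff_eq (v : ℕ → V) (f : V → E) {n : ℕ →₀ ℕ} {m : ℕ} (h : ∀ j, m ≤ j → n j = 0) :
    taylorCoeff v f n = multiCoeff v n f m 0 := by
  rw [taylorCoeff]
  rcases le_total m (indexBound n) with hm | hm
  · rw [multiCoeff_of_le v f hm h]
  · rw [multiCoeff_of_le v f hm fun j hj => eq_zero_of_indexBound_le hj]

lemma norm_taylorCoeff_le [CompleteSpace E] {f : V → E} (hf : Entire f) (v : ℕ → V) {M : ℝ}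
    {c : ℕ → ℝ} (hc : ∀ j, 0 < c j)
    (hM : ∀ (m : ℕ) (z : ℕ → ℂ), ‖f (∑ j ∈ range m, z j • v j)‖ ≤
      M * Real.exp ((∑ j ∈ range m, c j * ‖z j‖ ^ 2) / 2)) (n : ℕ →₀ ℕ) :
    ‖taylorCoeff v f n‖ ≤ M * n.prod fun j k => cauchyRate (c j) k := by
  have h := norm_multiCoeff_le hf v hc hM n (indexBound n) (indexBound n) le_rfl 0
  rw [finsupp_prod_eq_prod_range (fun j => cauchyRate_zero _)
    fun j hj => eq_zero_of_indexBound_le hj]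
  simpa [taylorCoeff] using h

lemma hasSum_taylorCoeff [CompleteSpace E] {f : V → E} (hf : Entire f) (v : ℕ → V) {M : ℝ}
    {c : ℕ → ℝ} (hc : ∀ j, 0 < c j)
    (hM : ∀ (m : ℕ) (z : ℕ → ℂ), ‖f (∑ j ∈ range m, z j • v j)‖ ≤
      M * Real.exp ((∑ j ∈ range m, c j * ‖z j‖ ^ 2) / 2)) (m : ℕ) (z : ℕ → ℂ)
    (hz : ∀ j, m ≤ j → z j = 0) :
    HasSum (fun n : ℕ →₀ ℕ => (n.prod fun j k => z j ^ k) • taylorCoeff v f n)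
      (f (∑ j ∈ range m, z j • v j)) := by
  rw [← (extendZero_injective m).hasSum_iff]
  · have := hasSum_multiCoeff hf v hc hM m m le_rfl z
    refine this.congr_fun fun n => ?_
    simp only [Function.comp]
    rw [extendZero_prod (fun j => pow_zero _),
      taylorCoeff_eq v f (m := m) fun j hj => extendZero_of_le n hj]
    simp
  · intro n hn
    obtain ⟨j, hj, hj'⟩ : ∃ j, m ≤ j ∧ n j ≠ 0 := by
      by_contra! h
      exact hn (mem_range_extendZero h)
    -- A multi-index involving a variable beyond `m` contributes nothing, since there `z j = 0` is
    -- raised to a positive power.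
    rw [Finsupp.prod, prod_eq_zero (Finsupp.mem_support_iff.2 hj'), zero_smul]
    simp [hz j hj, hj']

lemma taylorCoeff_clm_comp [CompleteSpace E] (L : E →L[ℂ] E') {f : V → E} (hf : Entire f)
    (v : ℕ → V) (n : ℕ →₀ ℕ) :
    taylorCoeff v (fun x => L (f x)) n = L (taylorCoeff v f n) :=
  multiCoeff_clm_comp L hf v n _ _

lemma dirCoeff_const_smul_exp (a : ℂ) (φ : V →L[ℂ] ℂ) (v : V) (k : ℕ) (ξ : V) :
    dirCoeff v k (fun x => a * Complex.exp (φ x)) ξ =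
      ((k.factorial : ℂ)⁻¹ * φ v ^ k * a) * Complex.exp (φ ξ) := by
  have h : (fun z : ℂ => a * Complex.exp (φ (ξ + z • v))) =
      fun z => (a * Complex.exp (φ ξ)) * Complex.exp (φ v * z) := by
    funext z
    rw [map_add, map_smul, Complex.exp_add, smul_eq_mul, mul_comm z, mul_assoc]
  rw [dirCoeff, h, iteratedDeriv_const_mul_field, iteratedDeriv_cexp_const_mul]
  simp
  ring

lemma taylorCoeff_exp (φ : V →L[ℂ] ℂ) (v : ℕ → V) (n : ℕ →₀ ℕ) :
    taylorCoeff v (fun x => Complex.exp (φ x)) n =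
      n.prod fun j k => (k.factorial : ℂ)⁻¹ * φ (v j) ^ k := by
  have h : ∀ m, multiCoeff v n (fun x => Complex.exp (φ x)) m =
      fun ξ => (∏ j ∈ range m, ((n j).factorial : ℂ)⁻¹ * φ (v j) ^ n j) * Complex.exp (φ ξ) := by
    intro m
    induction m with
    | zero => simp [multiCoeff]
    | succ m ih =>
      simp only [multiCoeff]
      rw [ih]
      funext ξ
      rw [dirCoeff_const_smul_exp, prod_range_succ]
      ring
  rw [taylorCoeff, h, finsupp_prod_eq_prod_range (fun j => by simp)
    fun j hj => eq_zero_of_indexBound_le hj]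
  simp

end Taylor

/-! ### Approximation numbers -/

section ApproxNumbers

section General

variable {𝕜 : Type*} [NontriviallyNormedField 𝕜]
  {E F : Type*} [NormedAddCommGroup E] [NormedSpace 𝕜 E] [NormedAddCommGroup F] [NormedSpace 𝕜 F]

lemma bddBelow_approx (T : E →L[𝕜] F) (n : ℕ) :
    BddBelow {r : ℝ | ∃ S : E →L[𝕜] F, S.toLinearMap.rank ≤ (n : Cardinal) ∧ r = ‖T - S‖} :=
  ⟨0, by rintro _ ⟨S, -, rfl⟩; exact norm_nonneg _⟩

lemma nonempty_approx (T : E →L[𝕜] F) (n : ℕ) :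
    {r : ℝ | ∃ S : E →L[𝕜] F, S.toLinearMap.rank ≤ (n : Cardinal) ∧ r = ‖T - S‖}.Nonempty :=
  ⟨_, 0, by simp, rfl⟩

lemma approxNumber_le (T S : E →L[𝕜] F) {n : ℕ} (hS : S.toLinearMap.rank ≤ (n : Cardinal)) :
    approxNumber 𝕜 T n ≤ ‖T - S‖ :=
  csInf_le (bddBelow_approx T n) ⟨S, hS, rfl⟩

lemma approxNumber_nonneg (T : E →L[𝕜] F) (n : ℕ) : 0 ≤ approxNumber 𝕜 T n :=
  Real.sInf_nonneg (by rintro _ ⟨S, -, rfl⟩; exact norm_nonneg _)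

lemma approxNumber_antitone (T : E →L[𝕜] F) : Antitone (approxNumber 𝕜 T) := by
  intro m n hmn
  refine csInf_le_csInf (bddBelow_approx T n) (nonempty_approx T m) ?_
  rintro _ ⟨S, hS, rfl⟩
  exact ⟨S, hS.trans (by exact_mod_cast hmn), rfl⟩

lemma exists_norm_sub_lt (T : E →L[𝕜] F) (n : ℕ) {ε : ℝ} (hε : 0 < ε) :
    ∃ S : E →L[𝕜] F, S.toLinearMap.rank ≤ (n : Cardinal) ∧
      ‖T - S‖ < approxNumber 𝕜 T n + ε := by
  obtain ⟨_, ⟨S, hS, rfl⟩, h⟩ := exists_lt_of_csInf_lt (nonempty_approx T n)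
    (lt_add_of_pos_right (approxNumber 𝕜 T n) hε)
  exact ⟨S, hS, h⟩

/-- A sequence that decays faster than every power. -/
def RapidDecay (a : ℕ → ℝ) : Prop := ∀ q : ℕ, ∃ C : ℝ, ∀ n : ℕ, a n * ((n : ℝ) + 1) ^ q ≤ C

/-- For a decreasing sequence, `(n + 1) a n ^ p ≤ ∑ a k ^ p`; taking `p = 1 / q` and raising to the
power `q` gives the decay of order `q`. -/
lemma rapidDecay_of_summable {a : ℕ → ℝ} (ha : Antitone a) (h0 : ∀ n, 0 ≤ a n)
    (hs : ∀ p : ℝ, 0 < p → Summable fun n => a n ^ p) : RapidDecay a := by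
  have key : ∀ q : ℕ, q ≠ 0 → ∃ C : ℝ, ∀ n : ℕ, a n * ((n : ℝ) + 1) ^ q ≤ C := by
    intro q hq
    have hq' : (0 : ℝ) < q := by positivity
    set p : ℝ := (q : ℝ)⁻¹ with hp
    have hp0 : 0 < p := by positivity
    refine ⟨(∑' n, a n ^ p) ^ q, fun n => ?_⟩
    have h1 : ((n : ℝ) + 1) * a n ^ p ≤ ∑' n, a n ^ p := by
      refine le_trans ?_ ((hs p hp0).sum_le_tsum (Finset.range (n + 1))
        fun i _ => Real.rpow_nonneg (h0 i) p)
      have := Finset.card_nsmul_le_sum (Finset.range (n + 1)) (fun i => a i ^ p) (a n ^ p)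
        fun i hi => Real.rpow_le_rpow (h0 n) (ha (by simp at hi; omega)) hp0.le
      simpa using this
    calc a n * ((n : ℝ) + 1) ^ q = (((n : ℝ) + 1) * a n ^ p) ^ q := by
          rw [mul_pow, ← Real.rpow_natCast (a n ^ p), ← Real.rpow_mul (h0 n), hp,
            inv_mul_cancel₀ hq'.ne', Real.rpow_one, mul_comm]
      _ ≤ _ := by have := Real.rpow_nonneg (h0 n) p; gcongr
  intro q
  rcases eq_or_ne q 0 with rfl | hq
  · exact ⟨a 0, fun n => by simpa using ha (Nat.zero_le n)⟩
  · exact key q hq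

lemma RapidDecay.add {a b : ℕ → ℝ} (ha : RapidDecay a) (hb : RapidDecay b) :
    RapidDecay fun n => a n + b n := by
  intro q
  obtain ⟨C, hC⟩ := ha q
  obtain ⟨D, hD⟩ := hb q
  exact ⟨C + D, fun n => by rw [add_mul]; exact add_le_add (hC n) (hD n)⟩

lemma RapidDecay.const_mul {a : ℕ → ℝ} (ha : RapidDecay a) {K : ℝ} (hK : 0 ≤ K) :
    RapidDecay fun n => K * a n := by
  intro q
  obtain ⟨C, hC⟩ := ha q
  exact ⟨K * C, fun n => by rw [mul_assoc]; exact mul_le_mul_of_nonneg_left (hC n) hK⟩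

lemma RapidDecay.mono {a b : ℕ → ℝ} (ha : RapidDecay a) (h : ∀ n, b n ≤ a n) :
    RapidDecay b := by
  intro q
  obtain ⟨C, hC⟩ := ha q
  exact ⟨C, fun n => (mul_le_mul_of_nonneg_right (h n) (by positivity)).trans (hC n)⟩

/-- Since `n + 1 ≤ (√n + 1)²` also for the integer square root, decay of order `2 q` of `a` suffices
for order `q`. -/
lemma RapidDecay.comp_sqrt {a : ℕ → ℝ} (ha : RapidDecay a) (h0 : ∀ n, 0 ≤ a n) :
    RapidDecay fun n => a n.sqrt := by
  intro q
  obtain ⟨C, hC⟩ := ha (2 * q)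
  refine ⟨C, fun n => le_trans ?_ (hC n.sqrt)⟩
  refine mul_le_mul_of_nonneg_left ?_ (h0 _)
  rw [pow_mul]
  refine pow_le_pow_left₀ (by positivity) ?_ q
  have := Nat.lt_succ_sqrt n
  rw [sq]
  exact_mod_cast this

lemma RapidDecay.of_succ {a : ℕ → ℝ} (ha : RapidDecay fun n => a (n + 1)) : RapidDecay a := by
  intro q
  obtain ⟨C, hC⟩ := ha q
  refine ⟨max (a 0) (2 ^ q * max C 0), fun n => ?_⟩
  rcases n with _ | n
  · simp
  · refine le_trans ?_ (le_max_right _ _)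
    push_cast
    have hC' := (hC n).trans (le_max_left C 0)
    rcases le_or_gt (a (n + 1)) 0 with h | h
    · refine (mul_nonpos_of_nonpos_of_nonneg h (by positivity)).trans (by positivity)
    · calc a (n + 1) * ((n : ℝ) + 1 + 1) ^ q ≤ a (n + 1) * (2 * ((n : ℝ) + 1)) ^ q := by
            gcongr; linarith [(Nat.cast_nonneg n : (0 : ℝ) ≤ n)]
        _ = 2 ^ q * (a (n + 1) * ((n : ℝ) + 1) ^ q) := by rw [mul_pow]; ring
        _ ≤ _ := by gcongr

lemma rapidDecay_geometric : RapidDecay fun n => (1 / 2 : ℝ) ^ n := by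
  intro q
  have h : Summable fun n : ℕ => (n : ℝ) ^ q * (1 / 2 : ℝ) ^ n :=
    summable_pow_mul_geometric_of_norm_lt_one q (by norm_num)
  refine ⟨2 * ∑' n : ℕ, (n : ℝ) ^ q * (1 / 2 : ℝ) ^ n, fun n => ?_⟩
  have := h.le_tsum (n + 1) fun i _ => by positivity
  push_cast at this
  rw [pow_succ] at this
  linarith

lemma RapidDecay.summable_rpow {a : ℕ → ℝ} (ha : RapidDecay a) (h0 : ∀ n, 0 ≤ a n) {p : ℝ}
    (hp : 0 < p) : Summable fun n => a n ^ p := by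
  obtain ⟨q, hq⟩ := exists_nat_gt (2 / p)
  obtain ⟨C, hC⟩ := ha q
  have hC0 : 0 ≤ C := le_trans (by have := h0 0; positivity) (hC 0)
  have h2 : Summable fun n : ℕ => C ^ p * (1 / ((n : ℝ) + 1) ^ 2) := by
    refine Summable.mul_left _ ?_
    have := (summable_nat_add_iff 1).2 (Real.summable_one_div_nat_pow.2 one_lt_two)
    simpa using this
  refine Summable.of_nonneg_of_le (fun n => Real.rpow_nonneg (h0 n) p) (fun n => ?_) h2
  have hn : (1 : ℝ) ≤ (n : ℝ) + 1 := by linarith [(Nat.cast_nonneg n : (0 : ℝ) ≤ n)]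
  have h3 : a n ≤ C / ((n : ℝ) + 1) ^ q := by rw [le_div_iff₀ (by positivity)]; exact hC n
  calc a n ^ p ≤ (C / ((n : ℝ) + 1) ^ q) ^ p := Real.rpow_le_rpow (h0 n) h3 hp.le
    _ = C ^ p * (1 / (((n : ℝ) + 1) ^ q) ^ p) := by
        rw [Real.div_rpow hC0 (by positivity)]; ring
    _ ≤ _ := by
        have : ((n : ℝ) + 1) ^ 2 ≤ (((n : ℝ) + 1) ^ q) ^ p := by
          rw [← Real.rpow_natCast, ← Real.rpow_natCast, ← Real.rpow_mul (by positivity)]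
          refine Real.rpow_le_rpow_of_exponent_le hn ?_
          rw [div_lt_iff₀ hp] at hq
          exact_mod_cast hq.le
        gcongr

lemma rapidDecay_approxNumber {T : E →L[𝕜] F} (hT : ∀ p : ℝ, 0 < p → IsEllP 𝕜 p T) :
    RapidDecay (approxNumber 𝕜 T) :=
  rapidDecay_of_summable (approxNumber_antitone T) (approxNumber_nonneg T) hT

lemma rank_sum_smulRight_le {ι : Type*} (s : Finset ι) (φ : ι → E →L[𝕜] 𝕜) (v : ι → F) :
    (∑ i ∈ s, (φ i).smulRight (v i)).toLinearMap.rank ≤ (s.card : Cardinal) := by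
  have h1 : (∑ i ∈ s, (φ i).smulRight (v i)).toLinearMap =
      ∑ i ∈ s, ((φ i).smulRight (v i)).toLinearMap := by
    ext x; simp
  rw [h1]
  refine (LinearMap.rank_finsetSum_le s _).trans ?_
  refine (Finset.sum_le_card_nsmul s _ 1 fun i _ => ?_).trans (by simp)
  refine (Submodule.rank_mono (t := Submodule.span 𝕜 {v i}) ?_).trans (rank_span_le _ |>.trans (by simp))
  rintro _ ⟨x, rfl⟩
  exact Submodule.smul_mem _ _ (Submodule.mem_span_singleton_self _)

end General

/-! ### Approximation numbers of sums of rank one maps -/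

variable {𝕜 : Type*} [NontriviallyNormedField 𝕜]
  {E F : Type*} [NormedAddCommGroup E] [NormedSpace 𝕜 E] [NormedAddCommGroup F] [NormedSpace 𝕜 F]

/-- A partial sum over `s` has rank at most the cardinality of `s`, and the remaining terms bound
the error in norm. -/
lemma approxNumber_le_tsum {ι : Type*} {T : E →L[𝕜] F} {φ : ι → E →L[𝕜] 𝕜} {v : ι → F} {l : ι → ℝ}
    (hl : Summable l) (hφ : ∀ i x, ‖φ i x • v i‖ ≤ l i * ‖x‖)
    (hT : ∀ x, HasSum (fun i => φ i x • v i) (T x)) (s : Finset ι) {n : ℕ} (hn : s.card ≤ n) :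
    approxNumber 𝕜 T n ≤ ∑' i : {i // i ∉ s}, |l i| := by
  refine (approxNumber_le T (∑ i ∈ s, (φ i).smulRight (v i))
    ((rank_sum_smulRight_le s φ v).trans (by exact_mod_cast hn))).trans ?_
  refine ContinuousLinearMap.opNorm_le_bound _ (tsum_nonneg fun i => abs_nonneg _) fun x => ?_
  have hs' : Summable fun i : {i // i ∉ s} => |l i| := hl.abs.subtype _
  have h1 : HasSum (fun i : {i // i ∉ s} => φ i x • v i) (T x - ∑ i ∈ s, φ i x • v i) := by
    rw [s.hasSum_compl_iff (f := fun i => φ i x • v i)]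
    simpa using hT x
  have h2 : (T - ∑ i ∈ s, (φ i).smulRight (v i)) x = T x - ∑ i ∈ s, φ i x • v i := by
    simp
  rw [h2, ← tsum_mul_right]
  exact h1.norm_le_of_bounded (hs'.mul_right ‖x‖).hasSum fun i =>
    (hφ i x).trans (mul_le_mul_of_nonneg_right (le_abs_self _) (norm_nonneg _))

/-- A thresholding argument: the terms with `l i ≥ θ` are kept, their number is controlled by `∑ l i
^ q`, and the rest sums to at most `θ ^ (1 - q) ∑ l i ^ q`. -/
lemma isEllP_of_hasSum {ι : Type*} {T : E →L[𝕜] F} {φ : ι → E →L[𝕜] 𝕜} {v : ι → F} {l : ι → ℝ}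
    (h0 : ∀ i, 0 ≤ l i) (hl : ∀ p : ℝ, 0 < p → Summable fun i => l i ^ p)
    (hφ : ∀ i x, ‖φ i x • v i‖ ≤ l i * ‖x‖)
    (hT : ∀ x, HasSum (fun i => φ i x • v i) (T x)) {p : ℝ} (hp : 0 < p) : IsEllP 𝕜 p T := by
  have hl1 : Summable l := by simpa using hl 1 one_pos
  -- This choice gives `(1 - q) / q = 2 / p`, so that the `n`-th approximation number to the power
  -- `p` is of order `n ^ (-2)`.
  set q : ℝ := p / (p + 2) with hq
  have hq0 : 0 < q := by positivity
  have hq1 : q < 1 := by rw [hq, div_lt_one (by positivity)]; linarith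
  -- The summand `1` only makes `S` positive.
  set S : ℝ := ∑' i, l i ^ q + 1 with hS
  have hS0 : 0 < S := by
    have : 0 ≤ ∑' i, l i ^ q := tsum_nonneg fun i => Real.rpow_nonneg (h0 i) q
    positivity
  have key : ∀ n : ℕ, 0 < n → approxNumber 𝕜 T n ≤ S * (S / n) ^ ((1 - q) / q) := by
    intro n hn
    have hn' : (0 : ℝ) < n := by exact_mod_cast hn
    -- With `θ ^ q = S / n`, at most `n` of the `l i` can reach the threshold.
    set θ : ℝ := (S / n) ^ (1 / q) with hθ
    have hθ0 : 0 < θ := by positivity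
    have hθq : θ ^ q = S / n := by
      rw [hθ, ← Real.rpow_mul (by positivity), one_div, inv_mul_cancel₀ hq0.ne', Real.rpow_one]
    have hfin : {i | θ ≤ l i}.Finite := by
      have := (hl1.tendsto_cofinite_zero).eventually_lt_const hθ0
      rw [Filter.eventually_cofinite] at this
      simpa using this
    set s := hfin.toFinset with hs
    have hcard : s.card ≤ n := by
      have h1 : (s.card : ℝ) * θ ^ q ≤ S := by
        have h2 := Finset.card_nsmul_le_sum s (fun i => l i ^ q) (θ ^ q) fun i hi =>
          Real.rpow_le_rpow hθ0.le (by simpa [hs] using hi) hq0.le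
        have h3 := (hl q hq0).sum_le_tsum s fun i _ => Real.rpow_nonneg (h0 i) q
        rw [nsmul_eq_mul] at h2
        linarith
      rw [hθq, mul_div_assoc', div_le_iff₀ hn', mul_comm] at h1
      exact_mod_cast le_of_mul_le_mul_left h1 hS0
    refine (approxNumber_le_tsum hl1 hφ hT s hcard).trans ?_
    have h4 : ∀ i : {i // i ∉ s}, |l i| ≤ θ ^ (1 - q) * l i ^ q := fun i => by
      have hi : l i < θ := by
        have := i.2
        simpa [hs] using this
      rw [abs_of_nonneg (h0 _)]
      rcases (h0 i).eq_or_lt with h | h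
      · rw [← h, Real.zero_rpow hq0.ne']; simp
      · calc l i = l i ^ (1 - q) * l i ^ q := by rw [← Real.rpow_add h]; simp
          _ ≤ _ := by gcongr
    have hsub : Summable fun i : {i // i ∉ s} => l i ^ q :=
      (hl q hq0).subtype {i | i ∉ s}
    calc ∑' i : {i // i ∉ s}, |l i| ≤ ∑' i : {i // i ∉ s}, θ ^ (1 - q) * l i ^ q :=
          Summable.tsum_le_tsum h4 (hl1.abs.subtype {i | i ∉ s}) (hsub.mul_left _)
      _ = θ ^ (1 - q) * ∑' i : {i // i ∉ s}, l i ^ q := tsum_mul_left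
      _ ≤ θ ^ (1 - q) * S := by
          gcongr
          have := Summable.tsum_subtype_le (fun i => l i ^ q) {i | i ∉ s}
            (fun i => Real.rpow_nonneg (h0 i) q) (hl q hq0)
          exact this.trans (by rw [hS]; linarith)
      _ = S * (S / n) ^ ((1 - q) / q) := by
          rw [hθ, ← Real.rpow_mul (by positivity), mul_comm]
          congr 2
          ring
  have hexp : (1 - q) / q = 2 / p := by
    rw [hq]; field_simp; ring
  rw [IsEllP, ← summable_nat_add_iff 1]
  have h2 : Summable fun n : ℕ => (S ^ p * S ^ (2 : ℝ)) * (1 / ((n + 1 : ℕ) : ℝ) ^ 2) :=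
    ((summable_nat_add_iff 1).2 (Real.summable_one_div_nat_pow.2 one_lt_two)).mul_left _
  refine Summable.of_nonneg_of_le (fun n => Real.rpow_nonneg (approxNumber_nonneg T _) p)
    (fun n => ?_) h2
  refine (Real.rpow_le_rpow (approxNumber_nonneg T _) (key (n + 1) n.succ_pos) hp.le).trans_eq ?_
  have hn' : (0 : ℝ) < ((n + 1 : ℕ) : ℝ) := by positivity
  rw [hexp, Real.mul_rpow hS0.le (by positivity), ← Real.rpow_mul (by positivity),
    div_mul_cancel₀ _ hp.ne', Real.div_rpow hS0.le hn'.le, ← Real.rpow_natCast]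
  push_cast
  ring

end ApproxNumbers

/-! ### Diagonal bounds for the one-particle operator -/

section OneParticle

open Finset ContinuousLinearMap

variable {𝓗 : Type u} [NormedAddCommGroup 𝓗] [InnerProductSpace ℂ 𝓗]

lemma norm_sq_sum_smul_le {u : ℕ → 𝓗} (huo : ∀ i j, i ≠ j → inner ℂ (u i) (u j) = 0)
    (hu1 : ∀ i, ‖u i‖ ≤ 1) (s : Finset ℕ) (z : ℕ → ℂ) :
    ‖∑ j ∈ s, z j • u j‖ ^ 2 ≤ ∑ j ∈ s, ‖z j‖ ^ 2 := by
  classical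
  induction s using Finset.induction_on with
  | empty => simp
  | insert i s hi ih =>
    rw [sum_insert hi, sum_insert hi, norm_add_sq (𝕜 := ℂ)]
    have h1 : inner ℂ (z i • u i) (∑ j ∈ s, z j • u j) = 0 := by
      rw [inner_sum]
      refine sum_eq_zero fun j hj => ?_
      rw [inner_smul_left, inner_smul_right, huo i j (by rintro rfl; exact hi hj)]
      simp
    have h2 : ‖z i • u i‖ ≤ ‖z i‖ := by
      rw [norm_smul]; exact mul_le_of_le_one_right (norm_nonneg _) (hu1 i)
    rw [h1]
    have := pow_le_pow_left₀ (norm_nonneg _) h2 2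
    simp only [map_zero, mul_zero, add_zero]
    linarith

lemma inner_sum_inner_smul {u : ℕ → 𝓗} (huo : ∀ i j, i ≠ j → inner ℂ (u i) (u j) = 0)
    (hu1 : ∀ i, ‖u i‖ = 1 ∨ u i = 0) (m : ℕ) (ξ : 𝓗) (i : ℕ) :
    inner ℂ (u i) (∑ j ∈ range m, inner ℂ (u j) ξ • u j) = if i < m then inner ℂ (u i) ξ else 0 := by
  rw [inner_sum]
  have h : ∀ j ∈ range m, inner ℂ (u i) (inner ℂ (u j) ξ • u j) =
      if i = j then inner ℂ (u i) ξ else 0 := fun j _ => by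
    rw [inner_smul_right]
    split_ifs with hij
    · subst hij
      rcases hu1 i with h | h
      · rw [inner_self_eq_norm_sq_to_K, h]; simp
      · simp [h]
    · rw [huo i j hij, mul_zero]
  rw [sum_congr rfl h]
  simp

lemma exists_generators [CompleteSpace 𝓗] (S : 𝓗 →L[ℝ] 𝓗) (k : ℕ)
    (hS : S.toLinearMap.rank ≤ (k : Cardinal)) :
    ∃ g : ℕ → 𝓗, ∀ x, S x ∈ Submodule.span ℝ (g '' Set.Iio k) := by
  have hfin : Module.Finite ℝ (LinearMap.range S.toLinearMap) := by
    rw [← Module.rank_lt_aleph0_iff]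
    exact lt_of_le_of_lt hS (Cardinal.natCast_lt_aleph0)
  set b := Module.finBasis ℝ (LinearMap.range S.toLinearMap)
  have hd : Module.finrank ℝ (LinearMap.range S.toLinearMap) ≤ k :=
    Module.finrank_le_of_rank_le hS
  refine ⟨fun i => if h : i < Module.finrank ℝ (LinearMap.range S.toLinearMap) then b ⟨i, h⟩ else 0,
    fun x => ?_⟩
  have h1 := b.sum_repr ⟨S x, ⟨x, rfl⟩⟩
  have h2 := congrArg Subtype.val h1
  simp only [Submodule.coe_sum, Submodule.coe_smul] at h2
  rw [← h2]
  refine Submodule.sum_mem _ fun i _ => Submodule.smul_mem _ _ (Submodule.subset_span ?_)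
  exact ⟨i, lt_of_lt_of_le i.2 hd, by simp⟩

/-- An orthonormal system that exhausts the ranges of a sequence of operators `S k` of rank at
most `k`; some of its members may vanish. -/
lemma exists_orthonormal_sequence [CompleteSpace 𝓗] (S : ℕ → 𝓗 →L[ℝ] 𝓗)
    (hS : ∀ k, (S k).toLinearMap.rank ≤ (k : Cardinal)) :
    ∃ u : ℕ → 𝓗, (∀ i j, i ≠ j → inner ℂ (u i) (u j) = 0) ∧ (∀ i, ‖u i‖ = 1 ∨ u i = 0) ∧
      ∀ k x, S k x ∈ Submodule.span ℂ (u '' Set.Iio ((k + 1) ^ 2)) := by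
  choose g hg using fun k => exists_generators (S k) k (hS k)
  set f : ℕ → 𝓗 := fun j => g j.unpair.1 j.unpair.2 with hf
  refine ⟨InnerProductSpace.gramSchmidtNormed ℂ f, fun i j hij => ?_, fun i => ?_, fun k x => ?_⟩
  · simp [InnerProductSpace.gramSchmidtNormed,
      InnerProductSpace.gramSchmidt_orthogonal ℂ f hij]
  · rcases eq_or_ne (InnerProductSpace.gramSchmidtNormed ℂ f i) 0 with h | h
    · exact Or.inr h
    · exact Or.inl (InnerProductSpace.gramSchmidtNormed_unit_length' h)
  · rw [InnerProductSpace.span_gramSchmidtNormed, InnerProductSpace.span_gramSchmidt_Iio]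
    refine Submodule.span_le_restrictScalars ℝ ℂ _ (Submodule.span_mono ?_ (hg k x))
    rintro _ ⟨i, hi, rfl⟩
    -- The generators of all ranges are listed by the pairing function; for `i < k` the index stays
    -- below `(k + 1) ^ 2`.
    refine ⟨Nat.pair k i, ?_, by simp [hf]⟩
    have := Nat.pair_lt_max_add_one_sq k i
    rwa [max_eq_left (le_of_lt hi)] at this

lemma inner_eq_zero_of_mem_span {u : ℕ → 𝓗} {N : ℕ} {ξ : 𝓗}
    (h : ∀ i < N, inner ℂ (u i) ξ = 0) : ∀ w ∈ Submodule.span ℂ (u '' Set.Iio N), inner ℂ w ξ = 0 := by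
  intro w hw
  induction hw using Submodule.span_induction with
  | mem x hx => obtain ⟨i, hi, rfl⟩ := hx; exact h i hi
  | zero => simp
  | add x y _ _ hx hy => rw [inner_add_left, hx, hy, add_zero]
  | smul c x _ hx => rw [inner_smul_left, hx, mul_zero]

variable [CompleteSpace 𝓗]

/-- A vector orthogonal to the range of `S` is killed by the real adjoint of `S`, so only the error
`T - S` is felt. -/
lemma norm_adjoint_apply_le_of_orthogonal (T S : 𝓗 →L[ℝ] 𝓗) (W : Submodule ℂ 𝓗)
    (hS : ∀ x, S x ∈ W) {ξ : 𝓗} (hξ : ∀ w ∈ W, inner ℂ w ξ = 0) :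
    ‖adjoint T ξ‖ ≤ ‖T - S‖ * ‖ξ‖ := by
  have h0 : adjoint S ξ = 0 := by
    refine ext_inner_left ℝ fun y => ?_
    rw [adjoint_inner_right, inner_zero_right, ClosedSubmodule.inner_real_eq_re_inner, hξ _ (hS y)]
    simp
  have h1 : adjoint T ξ = adjoint (T - S) ξ := by rw [map_sub]; simp [h0]
  rw [h1]
  refine (le_opNorm _ _).trans_eq ?_
  rw [LinearIsometryEquiv.norm_map]

/-- A real linear operator of type `ℓ^p` for all `p` with norm less than one: its adjoint is
bounded by a rapidly decaying diagonal form of norm less than one. -/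
theorem exists_diagonal_bound (T : 𝓗 →L[ℝ] 𝓗) (hT1 : ‖T‖ < 1)
    (hT : ∀ p : ℝ, 0 < p → IsEllP ℝ p T) :
    ∃ (u : ℕ → 𝓗) (c : ℕ → ℝ) (θ : ℝ), (∀ i j, i ≠ j → inner ℂ (u i) (u j) = 0) ∧
      (∀ i, ‖u i‖ = 1 ∨ u i = 0) ∧ θ < 1 ∧ (∀ j, 0 < c j) ∧ (∀ j, c j ≤ θ) ∧ RapidDecay c ∧
      (∀ (m : ℕ) (z : ℕ → ℂ), ‖adjoint T (I • ∑ j ∈ range m, z j • u j)‖ ^ 2 ≤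
        ∑ j ∈ range m, c j * ‖z j‖ ^ 2) ∧
      ∀ ξ : 𝓗, Filter.Tendsto (fun m => adjoint T (∑ j ∈ range m, inner ℂ (u j) ξ • u j))
        Filter.atTop (nhds (adjoint T ξ)) := by
  classical
  choose S hS hS' using fun k : ℕ =>
    exists_norm_sub_lt T k (show (0 : ℝ) < (1 / 2) ^ k by positivity)
  obtain ⟨u, huo, hu1, hSu⟩ := exists_orthonormal_sequence S hS
  have hu1' : ∀ i, ‖u i‖ ≤ 1 := fun i => by
    rcases hu1 i with h | h
    · exact h.le
    · simp [h]
  -- The first `m` directions contain the range of `S k` when `(k + 1) ^ 2 ≤ m`. The best such `k`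
  -- is `m.sqrt - 1`, whence the shift here and the square root in `ε`.
  set b : ℕ → ℝ := fun n => ‖T - S (n - 1)‖ with hb
  have hbR : RapidDecay b := by
    refine RapidDecay.of_succ ?_
    refine ((rapidDecay_approxNumber hT).add rapidDecay_geometric).mono fun n => ?_
    simpa [hb] using (hS' n).le
  set ε : ℕ → ℝ := fun n => b n.sqrt with hε
  have hε0 : ∀ n, 0 ≤ ε n := fun n => norm_nonneg _
  have hεR : RapidDecay ε := hbR.comp_sqrt fun n => norm_nonneg _
  have key : ∀ m : ℕ, 0 < m → ∀ ξ : 𝓗, (∀ i < m, inner ℂ (u i) ξ = 0) →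
      ‖adjoint T ξ‖ ≤ ε m * ‖ξ‖ := by
    intro m hm ξ hξ
    have h1 : (m.sqrt - 1 + 1) ^ 2 ≤ m := by
      have : 0 < m.sqrt := Nat.sqrt_pos.2 hm
      rw [Nat.sub_add_cancel this]
      exact Nat.sqrt_le' m
    exact norm_adjoint_apply_le_of_orthogonal T _ _ (hSu _)
      (inner_eq_zero_of_mem_span fun i hi => hξ i (hi.trans_le h1))
  set τ := ‖T‖ with hτ
  have hτ0 : 0 ≤ τ := norm_nonneg _
  have hτ2 : τ ^ 2 < 1 := by nlinarith
  -- Room left by `τ < 1`: the inequality `(1 + δ) τ² ≤ θ` below amounts to `0 ≤ (1 - τ²)²`.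
  set δ : ℝ := (1 - τ ^ 2) / 2 with hδ
  have hδ0 : 0 < δ := by rw [hδ]; linarith
  set θ : ℝ := (1 + τ ^ 2) / 2 with hθ
  have hθ0 : 0 < θ := by rw [hθ]; nlinarith
  have hδθ : (1 + δ) * τ ^ 2 ≤ θ := by rw [hδ, hθ]; nlinarith [sq_nonneg τ]
  -- The constant matching `1 + δ` in `‖x + y‖² ≤ (1 + δ) ‖x‖² + L ‖y‖²`.
  set L : ℝ := 1 + 1 / δ with hL
  have hL0 : 0 < L := by positivity
  have hεs : Summable ε := by simpa using hεR.summable_rpow hε0 one_pos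
  -- choice of the number of modes that are treated exactly
  obtain ⟨J, hJ1, hJs, hJθ⟩ : ∃ J : ℕ, 1 ≤ J ∧
      (∀ t : Finset ℕ, (∀ j ∈ t, J ≤ j) → ∑ j ∈ t, ε j ≤ 1) ∧
      ∀ j, J ≤ j → L * (ε j + (1 / 2) ^ j) ≤ θ := by
    obtain ⟨s, hs⟩ := summable_iff_vanishing_norm.1 hεs 1 one_pos
    obtain ⟨J₁, hJ₁⟩ := s.exists_nat_subset_range
    have hlim : Filter.Tendsto (fun j => L * (ε j + (1 / 2) ^ j)) Filter.atTop (nhds (L * (0 + 0))) :=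
      (hεs.tendsto_atTop_zero.add
        (tendsto_pow_atTop_nhds_zero_of_lt_one (by norm_num) (by norm_num))).const_mul L
    obtain ⟨J₂, hJ₂⟩ := Filter.eventually_atTop.1
      (hlim.eventually_lt_const (show L * (0 + 0) < θ by simpa using hθ0))
    refine ⟨max 1 (max J₁ J₂), le_max_left _ _, fun t ht => ?_, fun j hj => (hJ₂ j ?_).le⟩
    · refine (le_abs_self _).trans (hs t ?_).le
      rw [Finset.disjoint_left]
      intro j hj hjs
      have h1 := mem_range.1 (hJ₁ hjs)
      have h2 := ht j hj
      simp only [max_le_iff] at h2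
      omega
    · simp only [max_le_iff] at hj
      omega
  -- The first `J` modes are bounded together by `‖T‖`, the others one by one by `ε j`. The term `(1
  -- / 2) ^ j` makes `c j` strictly positive.
  set c : ℕ → ℝ := fun j => if j < J then θ else L * (ε j + (1 / 2) ^ j) with hc
  refine ⟨u, c, θ, huo, hu1, by rw [hθ]; linarith, fun j => ?_, fun j => ?_, ?_, fun m z => ?_,
    fun ξ => ?_⟩
  · simp only [hc]
    split_ifs
    · exact hθ0
    · have := hε0 j; positivity
  · simp only [hc]
    split_ifs with h
    · exact le_rfl
    · exact hJθ j (by omega)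
  · refine (((rapidDecay_geometric.const_mul (show 0 ≤ θ * 2 ^ J by positivity))).add
      ((hεR.add rapidDecay_geometric).const_mul hL0.le)).mono fun j => ?_
    have h1 : 0 ≤ L * (ε j + (1 / 2) ^ j) := by have := hε0 j; positivity
    simp only [hc]
    split_ifs with h
    · have h2 : (1 : ℝ) ≤ 2 ^ J * (1 / 2) ^ j := by
        rw [one_div, inv_pow, ← div_eq_mul_inv, one_le_div (by positivity)]
        exact pow_le_pow_right₀ one_le_two h.le
      nlinarith
    · have : 0 ≤ θ * 2 ^ J * (1 / 2 : ℝ) ^ j := by positivity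
      linarith
  · set s₁ := (range m).filter (· < J) with hs₁
    set s₂ := (range m).filter (¬ · < J) with hs₂
    set x := adjoint T (I • ∑ j ∈ s₁, z j • u j) with hx
    set y := adjoint T (I • ∑ j ∈ s₂, z j • u j) with hy
    have hxy : adjoint T (I • ∑ j ∈ range m, z j • u j) = x + y := by
      rw [hx, hy, ← map_add, ← smul_add, sum_filter_add_sum_filter_not]
    have hx2 : ‖x‖ ^ 2 ≤ τ ^ 2 * ∑ j ∈ s₁, ‖z j‖ ^ 2 := by
      have h1 : ‖x‖ ≤ τ * ‖∑ j ∈ s₁, z j • u j‖ := by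
        refine (le_opNorm _ _).trans_eq ?_
        rw [LinearIsometryEquiv.norm_map, norm_smul]; simp [hτ]
      calc ‖x‖ ^ 2 ≤ (τ * ‖∑ j ∈ s₁, z j • u j‖) ^ 2 := by gcongr
        _ = τ ^ 2 * ‖∑ j ∈ s₁, z j • u j‖ ^ 2 := by ring
        _ ≤ _ := by gcongr; exact norm_sq_sum_smul_le huo hu1' s₁ z
    have hy1 : ‖y‖ ≤ ∑ j ∈ s₂, ε j * ‖z j‖ := by
      rw [hy, smul_sum, map_sum]
      refine norm_sum_le_of_le _ fun j hj => ?_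
      have hj' : J ≤ j := by simpa [hs₂] using (mem_filter.1 hj).2
      refine (key j (by omega) _ fun i hi => ?_).trans ?_
      · rw [inner_smul_right, inner_smul_right, huo i j (by omega)]; simp
      · rw [norm_smul, norm_smul]
        have := hu1' j
        have h3 := hε0 j
        simp only [norm_I, one_mul]
        gcongr
        exact mul_le_of_le_one_right (norm_nonneg _) this
    -- Cauchy–Schwarz with weights `√(ε j)` turns the sum of the norms into a diagonal form; the
    -- tail sum of `ε` is at most `1` by the choice of `J`.
    have hy2 : ‖y‖ ^ 2 ≤ ∑ j ∈ s₂, ε j * ‖z j‖ ^ 2 := by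
      calc ‖y‖ ^ 2 ≤ (∑ j ∈ s₂, ε j * ‖z j‖) ^ 2 := by gcongr
        _ = (∑ j ∈ s₂, √(ε j) * (√(ε j) * ‖z j‖)) ^ 2 := by
            congr 1; refine sum_congr rfl fun j _ => ?_
            rw [← mul_assoc, Real.mul_self_sqrt (hε0 j)]
        _ ≤ (∑ j ∈ s₂, √(ε j) ^ 2) * ∑ j ∈ s₂, (√(ε j) * ‖z j‖) ^ 2 :=
            sum_mul_sq_le_sq_mul_sq _ _ _
        _ = (∑ j ∈ s₂, ε j) * ∑ j ∈ s₂, ε j * ‖z j‖ ^ 2 := by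
            congr 1
            · exact sum_congr rfl fun j _ => Real.sq_sqrt (hε0 j)
            · exact sum_congr rfl fun j _ => by rw [mul_pow, Real.sq_sqrt (hε0 j)]
        _ ≤ _ := by
            refine mul_le_of_le_one_left (sum_nonneg fun j _ => mul_nonneg (hε0 j) (by positivity)) ?_
            exact hJs s₂ fun j hj => by simpa [hs₂] using (mem_filter.1 hj).2
    rw [hxy]
    have hsq : ‖x + y‖ ^ 2 ≤ (1 + δ) * ‖x‖ ^ 2 + L * ‖y‖ ^ 2 := by
      have h1 : ‖x + y‖ ^ 2 ≤ (‖x‖ + ‖y‖) ^ 2 := by gcongr; exact norm_add_le _ _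
      have h2 : 2 * (‖x‖ * ‖y‖) ≤ δ * ‖x‖ ^ 2 + 1 / δ * ‖y‖ ^ 2 := by
        have h3 : δ * ‖x‖ ^ 2 + 1 / δ * ‖y‖ ^ 2 - 2 * (‖x‖ * ‖y‖) = (δ * ‖x‖ - ‖y‖) ^ 2 / δ := by
          field_simp; ring
        have : 0 ≤ (δ * ‖x‖ - ‖y‖) ^ 2 / δ := by positivity
        linarith
      rw [hL]
      nlinarith
    refine hsq.trans ?_
    rw [← sum_filter_add_sum_filter_not (range m) (· < J)]
    refine add_le_add ?_ ?_
    · calc (1 + δ) * ‖x‖ ^ 2 ≤ (1 + δ) * (τ ^ 2 * ∑ j ∈ s₁, ‖z j‖ ^ 2) := by gcongr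
        _ = ((1 + δ) * τ ^ 2) * ∑ j ∈ s₁, ‖z j‖ ^ 2 := by ring
        _ ≤ θ * ∑ j ∈ s₁, ‖z j‖ ^ 2 := by gcongr
        _ = ∑ j ∈ s₁, c j * ‖z j‖ ^ 2 := by
            rw [mul_sum]
            exact sum_congr rfl fun j hj => by simp [hc, (mem_filter.1 hj).2]
    · calc L * ‖y‖ ^ 2 ≤ L * ∑ j ∈ s₂, ε j * ‖z j‖ ^ 2 := by gcongr
        _ ≤ ∑ j ∈ s₂, c j * ‖z j‖ ^ 2 := by
            rw [mul_sum]
            refine sum_le_sum fun j hj => ?_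
            have hj' : ¬ j < J := (mem_filter.1 hj).2
            simp only [hc, if_neg hj']
            rw [← mul_assoc]
            have : (0 : ℝ) ≤ (1 / 2) ^ j := by positivity
            gcongr
            linarith
  -- The remainder `ξ - P m` is orthogonal to the first `m` directions and no longer than `ξ`, so
  -- its image is at most `ε m ‖ξ‖`. The system `u` need not be total.
  · set P := fun m : ℕ => ∑ j ∈ range m, inner ℂ (u j) ξ • u j with hP
    have horth : ∀ m, ∀ i < m, inner ℂ (u i) (ξ - P m) = 0 := fun m i hi => by
      rw [inner_sub_right, hP]
      simp only
      rw [inner_sum_inner_smul huo hu1, if_pos hi, sub_self]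
    have hnorm : ∀ m, ‖ξ - P m‖ ≤ ‖ξ‖ := fun m => by
      have h1 : inner ℂ (P m) (ξ - P m) = 0 := by
        conv_lhs => rw [hP]
        rw [sum_inner]
        refine sum_eq_zero fun j hj => ?_
        rw [inner_smul_left, horth m j (mem_range.1 hj), mul_zero]
      have h2 := norm_add_sq (𝕜 := ℂ) (P m) (ξ - P m)
      rw [h1] at h2
      simp only [add_sub_cancel, map_zero, mul_zero, add_zero] at h2
      exact abs_le_of_sq_le_sq' (by nlinarith [sq_nonneg ‖P m‖]) (norm_nonneg _) |>.2
    rw [tendsto_iff_norm_sub_tendsto_zero]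
    have hlim : Filter.Tendsto (fun m => ε m * ‖ξ‖) Filter.atTop (nhds 0) := by
      simpa using hεs.tendsto_atTop_zero.mul_const ‖ξ‖
    refine squeeze_zero' (Filter.Eventually.of_forall fun m => norm_nonneg _) ?_ hlim
    filter_upwards [Filter.eventually_gt_atTop 0] with m hm
    rw [← map_sub, ← norm_neg, ← map_neg, neg_sub]
    refine (key m hm _ (horth m)).trans ?_
    have := hε0 m
    gcongr
    exact hnorm m

end OneParticle

/-! ### Coherent vectors -/

section Coherent

variable {𝓗 : Type u} [NormedAddCommGroup 𝓗] [InnerProductSpace ℂ 𝓗]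

lemma tensorLeft_apply (n : ℕ) (x : 𝓗) (Ψ : TPow 𝓗 n) :
    tensorLeft n x Ψ = ((x ⊗ₜ[ℂ] Ψ : 𝓗 ⊗[ℂ] TPow 𝓗 n) : Completion (𝓗 ⊗[ℂ] TPow 𝓗 n)) := rfl

lemma inner_tensorLeft (n : ℕ) (x y : 𝓗) (Ψ Φ : TPow 𝓗 n) :
    inner ℂ (tensorLeft n x Ψ) (tensorLeft n y Φ) = inner ℂ x y * inner ℂ Ψ Φ := by
  rw [tensorLeft_apply, tensorLeft_apply]
  exact (Completion.inner_coe _ _).trans (TensorProduct.inner_tmul _ _ _ _ _)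

lemma norm_tensorLeft (n : ℕ) (x : 𝓗) (Ψ : TPow 𝓗 n) : ‖tensorLeft n x Ψ‖ = ‖x‖ * ‖Ψ‖ := by
  rw [tensorLeft_apply]
  exact (Completion.norm_coe _).trans (TensorProduct.norm_tmul _ _)

lemma inner_unitTensor : inner ℂ (unitTensor : TPow 𝓗 0) unitTensor = 1 := by
  change inner ℂ (EuclideanSpace.single PUnit.unit (1 : ℂ) : EuclideanSpace ℂ PUnit)
    (EuclideanSpace.single PUnit.unit (1 : ℂ)) = 1
  simp

lemma norm_unitTensor : ‖(unitTensor : TPow 𝓗 0)‖ = 1 := by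
  have h := inner_self_eq_norm_sq_to_K (𝕜 := ℂ) (unitTensor : TPow 𝓗 0)
  rw [inner_unitTensor] at h
  have h2 : ((‖(unitTensor : TPow 𝓗 0)‖ ^ 2 : ℝ) : ℂ) = ((1 : ℝ) : ℂ) := by
    push_cast; exact h.symm
  exact (pow_eq_one_iff_of_nonneg (norm_nonneg _) two_ne_zero).1 (ofReal_inj.1 h2)

lemma inner_diagTensor (x y : 𝓗) (n : ℕ) :
    inner ℂ (diagTensor x n) (diagTensor y n) = inner ℂ x y ^ n := by
  induction n with
  | zero => simpa [diagTensor] using inner_unitTensor (𝓗 := 𝓗)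
  | succ n ih => rw [diagTensor, diagTensor, inner_tensorLeft, ih, pow_succ']

lemma norm_diagTensor (x : 𝓗) (n : ℕ) : ‖diagTensor x n‖ = ‖x‖ ^ n := by
  induction n with
  | zero => simpa [diagTensor] using norm_unitTensor (𝓗 := 𝓗)
  | succ n ih => rw [diagTensor, norm_tensorLeft, ih, pow_succ']

/-- The `n`-fold tensor product of vectors, as a continuous multilinear map. -/
def tensorMulti : (n : ℕ) → ContinuousMultilinearMap ℂ (fun _ : Fin n => 𝓗) (TPow 𝓗 n)
  | 0 => ContinuousMultilinearMap.constOfIsEmpty ℂ _ unitTensor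
  | n + 1 => ContinuousLinearMap.uncurryLeft (Ei := fun _ : Fin (n + 1) => 𝓗)
      (((ContinuousLinearMap.compContinuousMultilinearMapL ℂ (fun _ : Fin n => 𝓗) (TPow 𝓗 n)
        (TPow 𝓗 (n + 1))).flip (tensorMulti n)).comp (tensorLeft n))

lemma norm_tensorMulti_apply (n : ℕ) (v : Fin n → 𝓗) : ‖tensorMulti n v‖ = ∏ i, ‖v i‖ := by
  induction n with
  | zero => simpa [tensorMulti] using norm_unitTensor (𝓗 := 𝓗)
  | succ n ih =>
    have h : tensorMulti (n + 1) v = tensorLeft n (v 0) (tensorMulti n (Fin.tail v)) := rfl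
    rw [h, norm_tensorLeft, ih, Fin.prod_univ_succ]
    rfl

lemma tensorMulti_diag (n : ℕ) (x : 𝓗) : tensorMulti n (fun _ => x) = diagTensor x n := by
  induction n with
  | zero => rfl
  | succ n ih =>
    have h : tensorMulti (n + 1) (fun _ => x) = tensorLeft n x (tensorMulti n fun _ => x) := rfl
    rw [h, ih, diagTensor]

lemma continuous_diagTensor (n : ℕ) : Continuous fun x : 𝓗 => diagTensor x n := by
  have : (fun x : 𝓗 => diagTensor x n) = fun x => tensorMulti n fun _ => x :=
    funext fun x => (tensorMulti_diag n x).symm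
  rw [this]
  exact (tensorMulti n).cont.comp (continuous_pi fun _ => continuous_id)

lemma diagTensor_zero (n : ℕ) (hn : n ≠ 0) : diagTensor (0 : 𝓗) n = 0 := by
  rw [← norm_eq_zero, norm_diagTensor, norm_zero, zero_pow hn]

lemma diagTensor_smul (c : ℂ) (x : 𝓗) (n : ℕ) : diagTensor (c • x) n = c ^ n • diagTensor x n := by
  induction n with
  | zero => simp [diagTensor]
  | succ n ih => rw [diagTensor, diagTensor, ih, map_smul, map_smul, smul_apply,
      smul_smul, pow_succ]

lemma inner_symTensor (x y : 𝓗) (n : ℕ) :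
    inner ℂ (symTensor x n) (symTensor y n) = inner ℂ x y ^ n := inner_diagTensor x y n

lemma norm_symTensor (x : 𝓗) (n : ℕ) : ‖symTensor x n‖ = ‖x‖ ^ n := norm_diagTensor x n

lemma symTensor_smul (c : ℂ) (x : 𝓗) (n : ℕ) : symTensor (c • x) n = c ^ n • symTensor x n :=
  Subtype.ext (diagTensor_smul c x n)

lemma continuous_symTensor (n : ℕ) : Continuous fun x : 𝓗 => symTensor x n :=
  (continuous_diagTensor n).subtype_mk _

/-- Vectors of the symmetric tensor power are determined by their scalar products with the
tensors `x ⊗ ⋯ ⊗ x`. -/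
lemma symPow_ext {n : ℕ} {p q : SymPow 𝓗 n}
    (h : ∀ x : 𝓗, inner ℂ (symTensor x n) p = inner ℂ (symTensor x n) q) : p = q := by
  have h1 : SymPow 𝓗 n ≤ (Submodule.span ℂ {(p : TPow 𝓗 n) - q})ᗮ := by
    refine Submodule.topologicalClosure_minimal _ ?_ (Submodule.isClosed_orthogonal _)
    rw [Submodule.span_le]
    rintro _ ⟨x, rfl⟩
    refine (Submodule.mem_orthogonal_singleton_iff_inner_left).2 ?_
    rw [inner_sub_right, sub_eq_zero]
    exact h x
  rw [← sub_eq_zero, ← Submodule.coe_eq_zero]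
  exact inner_self_eq_zero.1 (Submodule.mem_orthogonal_singleton_iff_inner_left.1 (h1 (p - q).2))

lemma summable_pow_div_sqrt_factorial (r : ℝ) (hr : 0 ≤ r) :
    Summable fun n : ℕ => r ^ n / √(n.factorial) := by
  have h1 : Summable fun n : ℕ => (2 * r ^ 2) ^ n / n.factorial + (1 / 2 : ℝ) ^ n :=
    (Real.summable_pow_div_factorial _).add summable_geometric_two
  refine Summable.of_nonneg_of_le (fun n => by positivity) (fun n => ?_) h1
  have hn : (0 : ℝ) < n.factorial := by exact_mod_cast n.factorial_pos
  have h2 : (r ^ n / √(n.factorial)) ^ 2 = (2 * r ^ 2) ^ n / n.factorial * (1 / 2 : ℝ) ^ n := by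
    rw [div_pow, Real.sq_sqrt hn.le, div_mul_eq_mul_div, ← mul_pow, ← pow_mul, mul_comm n, pow_mul]
    congr 2; ring
  have ha : 0 ≤ (2 * r ^ 2) ^ n / (n.factorial : ℝ) := by positivity
  have hb : 0 ≤ (1 / 2 : ℝ) ^ n := by positivity
  refine abs_le_of_sq_le_sq' ?_ (by positivity) |>.2
  rw [h2]
  nlinarith

/-- The coherent vector `exp(a(x)^*) Ω`. -/
def coherent (x : 𝓗) : Fock 𝓗 :=
  ⟨fun n => ((√(n.factorial) : ℝ) : ℂ)⁻¹ • symTensor x n, by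
    refine memℓp_gen ?_
    have h := Real.summable_pow_div_factorial (‖x‖ ^ 2)
    refine h.congr fun n => ?_
    have hn : (0 : ℝ) ≤ n.factorial := by positivity
    rw [norm_smul, norm_symTensor]
    simp only [norm_inv, norm_real, Real.norm_eq_abs, abs_of_nonneg (Real.sqrt_nonneg _),
      ENNReal.toReal_ofNat, Real.rpow_ofNat]
    rw [mul_pow, inv_pow, Real.sq_sqrt hn]
    ring⟩

lemma coherent_apply (x : 𝓗) (n : ℕ) :
    coherent x n = ((√(n.factorial) : ℝ) : ℂ)⁻¹ • symTensor x n := rfl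

lemma coherent_zero : coherent (0 : 𝓗) = vacuum 𝓗 := by
  refine lp.ext (funext fun n => ?_)
  rw [coherent_apply, vacuum, fockTensor]
  rcases eq_or_ne n 0 with rfl | hn
  · simp
  · rw [lp.single_apply_ne _ _ _ hn]
    have : symTensor (0 : 𝓗) n = 0 := Subtype.ext (diagTensor_zero n hn)
    rw [this, smul_zero]

lemma inv_sqrt_mul_self (n : ℕ) : ((√(n.factorial) : ℝ) : ℂ)⁻¹ * ((√(n.factorial) : ℝ) : ℂ)⁻¹ =
    (n.factorial : ℂ)⁻¹ := by
  rw [← mul_inv, ← ofReal_mul, Real.mul_self_sqrt (by positivity)]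
  simp

lemma inner_coherent (x y : 𝓗) : inner ℂ (coherent x) (coherent y) = Complex.exp (inner ℂ x y) := by
  have h1 := lp.hasSum_inner (𝕜 := ℂ) (coherent x) (coherent y)
  have h2 : HasSum (fun n : ℕ => (n.factorial : ℂ)⁻¹ • (inner ℂ x y) ^ n) (Complex.exp (inner ℂ x y)) := by
    rw [Complex.exp_eq_exp_ℂ]
    exact NormedSpace.exp_series_hasSum_exp' _
  refine h1.unique (h2.congr_fun fun n => ?_)
  rw [coherent_apply, coherent_apply, inner_smul_left, inner_smul_right, inner_symTensor,
    ← mul_assoc, map_inv₀, conj_ofReal, inv_sqrt_mul_self, smul_eq_mul]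

lemma norm_coherent (x : 𝓗) : ‖coherent x‖ = Real.exp (‖x‖ ^ 2 / 2) := by
  have h := inner_self_eq_norm_sq_to_K (𝕜 := ℂ) (coherent x)
  rw [inner_coherent, inner_self_eq_norm_sq_to_K] at h
  have h2 : ‖coherent x‖ ^ 2 = Real.exp (‖x‖ ^ 2) := by
    have h3 : ((‖coherent x‖ ^ 2 : ℝ) : ℂ) = ((Real.exp (‖x‖ ^ 2) : ℝ) : ℂ) := by
      push_cast; exact h.symm
    exact_mod_cast h3
  have h4 : Real.exp (‖x‖ ^ 2) = Real.exp (‖x‖ ^ 2 / 2) ^ 2 := by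
    rw [← Real.exp_nat_mul]; congr 1; push_cast; ring
  rw [h4] at h2
  exact (pow_left_inj₀ (norm_nonneg _) (Real.exp_pos _).le two_ne_zero).1 h2

/-- The `n`-particle part of the power series of `coherent`. -/
def coherentSeries : FormalMultilinearSeries ℂ 𝓗 (Fock 𝓗) := fun n =>
  (((√(n.factorial) : ℝ) : ℂ)⁻¹ • (lp.singleContinuousLinearMap ℂ (fun n => SymPow 𝓗 n) 2 n).comp
    (SymPow 𝓗 n).orthogonalProjectionOnto).compContinuousMultilinearMap (tensorMulti n)

lemma coherentSeries_diag (n : ℕ) (x : 𝓗) :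
    coherentSeries n (fun _ => x) = lp.single 2 n (coherent x n) := by
  have h1 : coherentSeries n (fun _ => x) = ((√(n.factorial) : ℝ) : ℂ)⁻¹ • lp.single 2 n
      ((SymPow 𝓗 n).orthogonalProjectionOnto (tensorMulti n fun _ => x)) := rfl
  rw [h1, tensorMulti_diag, coherent_apply, lp.single_smul]
  congr 2
  exact Submodule.orthogonalProjectionOnto_mem_subspace_eq_self (symTensor x n)

lemma norm_coherentSeries_apply_le (n : ℕ) (v : Fin n → 𝓗) :
    ‖coherentSeries n v‖ ≤ (√(n.factorial))⁻¹ * ∏ i, ‖v i‖ := by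
  have h1 : coherentSeries n v = ((√(n.factorial) : ℝ) : ℂ)⁻¹ • lp.single 2 n
      ((SymPow 𝓗 n).orthogonalProjectionOnto (tensorMulti n v)) := rfl
  rw [h1, norm_smul, lp.norm_single (by simp)]
  simp only [norm_inv, norm_real, Real.norm_eq_abs, abs_of_nonneg (Real.sqrt_nonneg _)]
  gcongr
  rw [← norm_tensorMulti_apply]
  exact Submodule.norm_orthogonalProjectionOnto_apply_le _ _

lemma hasSum_coherentSeries (x : 𝓗) :
    HasSum (fun n => coherentSeries n fun _ => x) (coherent x) := by
  simp only [coherentSeries_diag]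
  exact lp.hasSum_single (by simp) (coherent x)

/-- Coefficients of size `r ^ n / √(n!)` have infinite radius of convergence. -/
lemma entire_of_hasSum {V E : Type*} [NormedAddCommGroup V] [NormedSpace ℂ V]
    [NormedAddCommGroup E] [NormedSpace ℂ E] [CompleteSpace E] {f : V → E}
    (p : FormalMultilinearSeries ℂ V E) {C r : ℝ} (hr : 0 ≤ r)
    (hp : ∀ n, ‖p n‖ ≤ C * r ^ n / √(n.factorial))
    (h : ∀ x, HasSum (fun n => p n fun _ => x) (f x)) : Entire f := by
  have hrad : p.radius = ⊤ := by
    refine p.radius_eq_top_of_summable_norm fun s => ?_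
    have hs := (summable_pow_div_sqrt_factorial (r * s) (by positivity)).mul_left C
    refine Summable.of_nonneg_of_le (fun n => by positivity) (fun n => ?_) hs
    refine (mul_le_mul_of_nonneg_right (hp n) (by positivity)).trans_eq ?_
    rw [mul_pow]; ring
  have hb : HasFPowerSeriesOnBall f p 0 ⊤ :=
    ⟨hrad.ge, by simp, fun {y} _ => by simpa using h y⟩
  have := hb.analyticOnNhd
  simpa [Entire] using this

lemma entire_coherent : Entire (coherent : 𝓗 → Fock 𝓗) :=
  entire_of_hasSum coherentSeries (C := 1) (r := 1) zero_le_one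
    (fun n => ContinuousMultilinearMap.opNorm_le_bound (by positivity) fun v => by
      simpa using norm_coherentSeries_apply_le n v) hasSum_coherentSeries

/-- A continuous multilinear map between two conjugate linear ones. -/
def conjMultilinear {V W E F : Type*} [NormedAddCommGroup V] [NormedSpace ℂ V]
    [NormedAddCommGroup W] [NormedSpace ℂ W] [NormedAddCommGroup E] [NormedSpace ℂ E]
    [NormedAddCommGroup F] [NormedSpace ℂ F] {n : ℕ} (σ : E →L⋆[ℂ] F) (τ : V →L⋆[ℂ] W)
    (p : ContinuousMultilinearMap ℂ (fun _ : Fin n => W) E) :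
    ContinuousMultilinearMap ℂ (fun _ : Fin n => V) F where
  toFun v := σ (p fun i => τ (v i))
  map_update_add' := by
    intro _ v i x y
    have h : ∀ a, (fun j => τ (Function.update v i a j)) =
        Function.update (fun j => τ (v j)) i (τ a) := fun a => by
      funext j; rcases eq_or_ne j i with rfl | hj <;> simp [*]
    simp only [h, map_add, ContinuousMultilinearMap.map_update_add]
  map_update_smul' := by
    intro _ v i c x
    have h : ∀ a, (fun j => τ (Function.update v i a j)) =
        Function.update (fun j => τ (v j)) i (τ a) := fun a => by
      funext j; rcases eq_or_ne j i with rfl | hj <;> simp [*]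
    simp only [h, map_smulₛₗ, ContinuousMultilinearMap.map_update_smul]
    simp
  cont := σ.cont.comp (p.cont.comp (continuous_pi fun i => τ.cont.comp (continuous_apply i)))

/-- Composing `coherent` with conjugate linear maps on both sides gives an entire function. -/
lemma entire_conj_coherent_conj {V E : Type*} [NormedAddCommGroup V] [NormedSpace ℂ V]
    [NormedAddCommGroup E] [NormedSpace ℂ E] [CompleteSpace E] (σ : Fock 𝓗 →L⋆[ℂ] E)
    (τ : V →L⋆[ℂ] 𝓗) : Entire fun v => σ (coherent (τ v)) := by
  refine entire_of_hasSum (fun n => conjMultilinear σ τ (coherentSeries n)) (C := ‖σ‖) (r := ‖τ‖)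
    (norm_nonneg _) (fun n => ?_) fun v => ?_
  · refine ContinuousMultilinearMap.opNorm_le_bound (by positivity) fun v => ?_
    have h1 : conjMultilinear σ τ (coherentSeries n) v = σ (coherentSeries n fun i => τ (v i)) := rfl
    rw [h1]
    refine (σ.le_opNorm _).trans ?_
    refine (mul_le_mul_of_nonneg_left (norm_coherentSeries_apply_le n _) (norm_nonneg _)).trans ?_
    have h2 : ∏ i, ‖τ (v i)‖ ≤ ‖τ‖ ^ n * ∏ i, ‖v i‖ := by
      have := Finset.prod_le_prod (s := Finset.univ) (f := fun i => ‖τ (v i)‖)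
        (g := fun i => ‖τ‖ * ‖v i‖) (fun i _ => norm_nonneg _) fun i _ => τ.le_opNorm _
      simpa [Finset.prod_mul_distrib] using this
    calc _ ≤ ‖σ‖ * ((√(n.factorial))⁻¹ * (‖τ‖ ^ n * ∏ i, ‖v i‖)) := by gcongr
      _ = _ := by ring
  · exact (hasSum_coherentSeries (τ v)).map σ σ.cont

lemma eq_zero_of_hasSum_pow {a : ℕ → ℂ} (h : ∀ z : ℂ, HasSum (fun n => z ^ n * a n) 0) (n : ℕ) :
    a n = 0 := by
  have h2 : HasFPowerSeriesAt (fun _ : ℂ => (0 : ℂ))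
      (fun k => ContinuousMultilinearMap.mkPiRing ℂ (Fin k) (a k)) 0 := by
    refine hasFPowerSeriesAt_iff.2 (Filter.Eventually.of_forall fun z => ?_)
    simpa [FormalMultilinearSeries.coeff] using h z
  have h3 := congrArg (fun p => p.coeff n) h2.eq_zero
  simpa [FormalMultilinearSeries.coeff] using h3

/-- The coherent vectors are total. -/
lemma eq_zero_of_inner_coherent {Φ : Fock 𝓗} (h : ∀ x : 𝓗, inner ℂ Φ (coherent x) = 0) : Φ = 0 := by
  refine lp.ext (funext fun n => ?_)
  refine symPow_ext fun x => ?_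
  -- Replacing `x` by `z • x` turns the particle number expansion into a power series in `z`, which
  -- separates the levels.
  have h1 : ∀ z : ℂ, HasSum (fun n : ℕ => z ^ n * inner ℂ (Φ n) (coherent x n)) 0 := fun z => by
    rw [← h (z • x)]
    refine (lp.hasSum_inner Φ (coherent (z • x))).congr_fun fun n => ?_
    rw [coherent_apply, coherent_apply, symTensor_smul, smul_comm, inner_smul_right (Φ n) _ (z ^ n)]
  have h3 := eq_zero_of_hasSum_pow h1 n
  rw [coherent_apply, inner_smul_right] at h3
  rw [← inner_conj_symm]
  have h4 : inner ℂ (Φ n) (symTensor x n) = 0 := by simpa [Nat.factorial_ne_zero] using h3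
  simp [h4]

end Coherent

/-! ### Displacement operators -/

section Displacement

variable {𝓗 : Type u} [NormedAddCommGroup 𝓗] [InnerProductSpace ℂ 𝓗]

lemma clm_mul_apply {F : Type*} [NormedAddCommGroup F] [NormedSpace ℂ F] (U V : F →L[ℂ] F) (x : F) :
    (U * V) x = U (V x) := rfl

/-- Equal Gram matrices mean that `v i ↦ w i` is isometric on linear combinations; totality of `v`
allows the extension to the whole space. -/
lemma exists_clm_of_inner_eq {ι F : Type*} [NormedAddCommGroup F] [InnerProductSpace ℂ F]
    [CompleteSpace F] (v w : ι → F) (h : ∀ i j, inner ℂ (v i) (v j) = inner ℂ (w i) (w j))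
    (hv : ∀ x : F, (∀ i, inner ℂ x (v i) = 0) → x = 0) :
    ∃ U : F →L[ℂ] F, ∀ i, U (v i) = w i := by
  have hnorm : ∀ c : ι →₀ ℂ, ‖Finsupp.linearCombination ℂ w c‖ = ‖Finsupp.linearCombination ℂ v c‖ := by
    intro c
    have : inner ℂ (Finsupp.linearCombination ℂ w c) (Finsupp.linearCombination ℂ w c) =
        inner ℂ (Finsupp.linearCombination ℂ v c) (Finsupp.linearCombination ℂ v c) := by
      simp only [Finsupp.linearCombination_apply, Finsupp.sum, sum_inner, inner_sum,
        inner_smul_left, inner_smul_right, h]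
    rw [norm_eq_sqrt_re_inner (𝕜 := ℂ), this, ← norm_eq_sqrt_re_inner (𝕜 := ℂ)]
  have hdense : DenseRange (Finsupp.linearCombination ℂ v) := by
    have h1 : (LinearMap.range (Finsupp.linearCombination ℂ v)).topologicalClosure = ⊤ := by
      rw [Submodule.topologicalClosure_eq_top_iff, Submodule.eq_bot_iff]
      intro x hx
      refine hv x fun i => ?_
      refine (Submodule.mem_orthogonal' _ _).1 hx _ ⟨Finsupp.single i 1, by simp⟩
    rw [← Submodule.dense_iff_topologicalClosure_eq_top] at h1
    exact h1
  refine ⟨(Finsupp.linearCombination ℂ w).extendOfNorm (Finsupp.linearCombination ℂ v), fun i => ?_⟩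
  have := (Finsupp.linearCombination ℂ w).extendOfNorm_eq (e := Finsupp.linearCombination ℂ v) hdense
    ⟨1, fun c => by rw [hnorm, one_mul]⟩ (Finsupp.single i 1)
  simpa using this

lemma clm_ext_coherent {F : Type*} [NormedAddCommGroup F] [NormedSpace ℂ F]
    {U V : Fock 𝓗 →L[ℂ] F} (h : ∀ x, U (coherent x) = V (coherent x)) : U = V := by
  have h1 : (Submodule.span ℂ (Set.range (coherent : 𝓗 → Fock 𝓗))).topologicalClosure = ⊤ := by
    rw [Submodule.topologicalClosure_eq_top_iff, Submodule.eq_bot_iff]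
    intro x hx
    exact eq_zero_of_inner_coherent fun y =>
      (Submodule.mem_orthogonal' _ _).1 hx _ (Submodule.subset_span ⟨y, rfl⟩)
  refine ContinuousLinearMap.ext_on (s := Set.range (coherent : 𝓗 → Fock 𝓗)) ?_ ?_
  · exact Submodule.dense_iff_topologicalClosure_eq_top.2 h1
  · rintro _ ⟨x, rfl⟩; exact h x

lemma exists_displacement (f : 𝓗) : ∃ U : Fock 𝓗 →L[ℂ] Fock 𝓗, ∀ y : 𝓗,
    U (coherent y) = Complex.exp (-(‖f‖ ^ 2 / 2 : ℝ) + inner ℂ f y) • coherent (y - f) := by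
  refine exists_clm_of_inner_eq coherent _ (fun x y => ?_) fun Φ hΦ => eq_zero_of_inner_coherent hΦ
  rw [inner_smul_left, inner_smul_right, inner_coherent, inner_coherent, ← Complex.exp_conj,
    ← Complex.exp_add, ← Complex.exp_add]
  congr 1
  have hf : (inner ℂ f f : ℂ) = ((‖f‖ ^ 2 : ℝ) : ℂ) := by
    rw [inner_self_eq_norm_sq_to_K]; push_cast; rfl
  simp only [map_add, map_neg, conj_ofReal, inner_conj_symm, inner_sub_left, inner_sub_right, hf]
  push_cast
  ring

/-- The displacement operator `W(i f)`, which maps `exp(a(y)^*) Ω` to a multiple of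
`exp(a(y - f)^*) Ω`. -/
def displacement (f : 𝓗) : Fock 𝓗 →L[ℂ] Fock 𝓗 := (exists_displacement f).choose

lemma displacement_coherent (f y : 𝓗) : displacement f (coherent y) =
    Complex.exp (-(‖f‖ ^ 2 / 2 : ℝ) + inner ℂ f y) • coherent (y - f) :=
  (exists_displacement f).choose_spec y

lemma adjoint_displacement (f : 𝓗) :
    ContinuousLinearMap.adjoint (displacement f) = displacement (-f) := by
  refine clm_ext_coherent fun x => ?_
  rw [← sub_eq_zero]
  refine eq_zero_of_inner_coherent fun y => ?_
  rw [inner_sub_left, ContinuousLinearMap.adjoint_inner_left, displacement_coherent,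
    displacement_coherent, inner_smul_left, inner_smul_right, inner_coherent, inner_coherent,
    ← Complex.exp_conj, ← Complex.exp_add, ← Complex.exp_add, sub_eq_zero]
  congr 1
  simp only [map_add, map_neg, conj_ofReal, inner_conj_symm, inner_sub_left, inner_sub_right,
    inner_neg_left, norm_neg]
  ring

/-- The two products differ by the phase `exp (⟨g, f⟩ - ⟨f, g⟩)`, up to orientation, which is
trivial when the scalar product is real. -/
lemma displacement_commute {f g : 𝓗} (h : inner ℂ f g = inner ℂ g f) :
    displacement f * displacement g = displacement g * displacement f := by
  refine clm_ext_coherent fun y => ?_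
  simp only [clm_mul_apply, displacement_coherent, map_smul, smul_smul,
    ← Complex.exp_add, inner_sub_right, h]
  rw [sub_right_comm]
  congr 2
  ring

/-- The trajectories of a strongly continuous unitary group are determined by its generator. -/
lemma unitaryGroup_apply_eq {F : Type*} [NormedAddCommGroup F] [InnerProductSpace ℂ F]
    [CompleteSpace F] {A : F →ₗ.[ℂ] F} {V : ℝ → F →L[ℂ] F}
    (hV : ∀ t, V t ∈ unitary (F →L[ℂ] F)) (hV0 : V 0 = 1) (hVadd : ∀ s t, V (s + t) = V s * V t)
    (hVc : ∀ x, Continuous fun t => V t x)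
    (hVd : ∀ x : A.domain, HasDerivAt (fun t => V t (x : F)) (I • A x) 0)
    {w z : ℝ → F} (hw : ∀ t, (w t, z t) ∈ A.graph) (hd : ∀ t, HasDerivAt w (I • z t) t) (t : ℝ) :
    V t (w 0) = w t := by
  have hiso : ∀ t x, ‖V t x‖ = ‖x‖ := fun t x =>
    ((V t).norm_map_iff_adjoint_comp_self).2 (Unitary.mem_iff.1 (hV t)).1 x
  -- The curve `V (-s) (w s)` is constant: the contribution of the group and that of the curve to
  -- its derivative cancel.
  have hg : ∀ t, HasDerivAt (fun s => V (-s) (w s)) 0 t := by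
    intro t
    rw [hasDerivAt_iff_tendsto_slope_zero]
    have hdec : ∀ s : ℝ, s⁻¹ • (V (-(t + s)) (w (t + s)) - V (-t) (w t)) =
        V (-t) (V (-s) (s⁻¹ • (w (t + s) - w t)) + s⁻¹ • (V (-s) (w t) - w t)) := by
      intro s
      rw [show -(t + s) = -t + -s by ring, hVadd, clm_mul_apply, ← map_sub,
        ← (V (-t)).map_smul_of_tower, (V (-s)).map_smul_of_tower, ← smul_add, map_sub,
        sub_add_sub_cancel]
    simp only [hdec]
    have h1 : Filter.Tendsto (fun s : ℝ => s⁻¹ • (V (-s) (w t) - w t)) (nhdsWithin 0 {0}ᶜ)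
        (nhds (-(I • z t))) := by
      obtain ⟨x, hx, hx'⟩ := (LinearPMap.mem_graph_iff _).1 (hw t)
      have h2 := hVd x
      rw [hx, hx'] at h2
      have h3 : HasDerivAt (fun s : ℝ => V (-s) (w t)) (-(I • z t)) 0 := by
        have := HasDerivAt.scomp (h := fun s : ℝ => -s) (x := (0 : ℝ)) (h' := -1)
          (g₁ := fun s => V s (w t)) (g₁' := I • z t) (by simpa using h2) (hasDerivAt_neg 0)
        simpa [Function.comp_def] using this
      have := hasDerivAt_iff_tendsto_slope_zero.1 h3
      simpa [hV0] using this
    -- Since the operators `V (-s)` are isometric, the error in the difference quotient of `w` stays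
    -- small after applying them; strong continuity handles the limit `I • z t`.
    have h4 : Filter.Tendsto (fun s : ℝ => V (-s) (s⁻¹ • (w (t + s) - w t))) (nhdsWithin 0 {0}ᶜ)
        (nhds (I • z t)) := by
      have h5 := hasDerivAt_iff_tendsto_slope_zero.1 (hd t)
      have h6 : Filter.Tendsto (fun s : ℝ => V (-s) (I • z t)) (nhdsWithin 0 {0}ᶜ)
          (nhds (I • z t)) := by
        have h7 : Continuous fun s : ℝ => V (-s) (I • z t) := (hVc _).comp continuous_neg
        have := h7.tendsto 0
        simp only [neg_zero, hV0] at this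
        exact this.mono_left nhdsWithin_le_nhds
      rw [tendsto_iff_norm_sub_tendsto_zero] at h5
      have h8 : Filter.Tendsto (fun s : ℝ => V (-s) (s⁻¹ • (w (t + s) - w t) - I • z t))
          (nhdsWithin 0 {0}ᶜ) (nhds 0) := by
        rw [tendsto_zero_iff_norm_tendsto_zero]
        simpa only [hiso] using h5
      have h9 := h8.add h6
      simpa only [map_sub, sub_add_cancel, zero_add] using h9
    have := ((V (-t)).continuous.tendsto _).comp (h4.add h1)
    simpa [Function.comp_def] using this
  have hconst := is_const_of_deriv_eq_zero (fun s => (hg s).differentiableAt)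
    (fun s => (hg s).deriv) t 0
  have h1 : V (-t) (w t) = w 0 := by simpa [hV0] using hconst
  rw [← h1, ← clm_mul_apply, ← hVadd, add_neg_cancel, hV0]
  rfl

end Displacement

/-! ### The field operator on coherent vectors -/

section Field

open Finset

variable {𝓗 : Type u} [NormedAddCommGroup 𝓗] [InnerProductSpace ℂ 𝓗]

/-- The part of a Fock space vector with less than `N` particles. -/
def truncate (N : ℕ) (Ψ : Fock 𝓗) : Fock 𝓗 := ∑ n ∈ range N, lp.single 2 n (Ψ n)

lemma truncate_apply (N : ℕ) (Ψ : Fock 𝓗) (n : ℕ) :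
    truncate N Ψ n = if n < N then Ψ n else 0 := by
  rw [truncate, lp.coeFn_sum, Finset.sum_apply]
  split_ifs with h
  · rw [sum_eq_single_of_mem n (mem_range.2 h) fun m _ hm => lp.single_apply_ne _ _ _ hm.symm,
      lp.single_apply_self]
  · refine sum_eq_zero fun m hm => lp.single_apply_ne _ _ _ ?_
    rintro rfl
    exact h (mem_range.1 hm)

lemma truncate_mem_finiteParticle (N : ℕ) (Ψ : Fock 𝓗) : truncate N Ψ ∈ finiteParticle 𝓗 :=
  ⟨N, fun n hn => by rw [truncate_apply, if_neg (by omega)]⟩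

lemma tendsto_truncate (Ψ : Fock 𝓗) :
    Filter.Tendsto (fun N => truncate N Ψ) Filter.atTop (nhds Ψ) :=
  (lp.hasSum_single (by simp) Ψ).tendsto_sum_nat

lemma dense_finiteParticle : Dense (finiteParticle 𝓗 : Set (Fock 𝓗)) := fun Ψ =>
  mem_closure_of_tendsto (tendsto_truncate Ψ)
    (Filter.Eventually.of_forall fun N => truncate_mem_finiteParticle N Ψ)

lemma inner_eq_sum_of_vanish (Ψ Φ : Fock 𝓗) {N : ℕ} (h : ∀ n, N ≤ n → Φ n = 0) :
    inner ℂ Ψ Φ = ∑ n ∈ range N, inner ℂ (Ψ n) (Φ n) := by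
  rw [lp.inner_eq_tsum]
  exact tsum_eq_sum fun n hn => by rw [h n (by simpa using hn), inner_zero_right]

lemma fieldOperator_apply (ξ : 𝓗) (Ψ : (fieldOperator ξ).domain) (n : ℕ) :
    (fieldOperator ξ Ψ) n = fieldLevel ξ (Ψ : Fock 𝓗) n := rfl

lemma fieldOperator_inner_left (ξ : 𝓗) (Ψ Φ : (fieldOperator ξ).domain) {N : ℕ}
    (hΨ : ∀ n, N ≤ n → (Ψ : Fock 𝓗) n = 0) (hΦ : ∀ n, N ≤ n → (Φ : Fock 𝓗) n = 0) :
    inner ℂ (fieldOperator ξ Ψ) (Φ : Fock 𝓗) =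
      ∑ n ∈ range N, inner ℂ (createLevel ξ n ((Ψ : Fock 𝓗) n)) ((Φ : Fock 𝓗) (n + 1)) +
      ∑ n ∈ range N, inner ℂ ((Ψ : Fock 𝓗) (n + 1)) (createLevel ξ n ((Φ : Fock 𝓗) n)) := by
  have h1 : ∑ n ∈ range N, inner ℂ ((Ψ : Fock 𝓗) (n + 1)) (createLevel ξ n ((Φ : Fock 𝓗) n)) =
      ∑ n ∈ range (N + 1), inner ℂ ((Ψ : Fock 𝓗) (n + 1)) (createLevel ξ n ((Φ : Fock 𝓗) n)) := by
    rw [sum_range_succ, hΨ (N + 1) (by omega), inner_zero_left, add_zero]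
  rw [inner_eq_sum_of_vanish _ _ (N := N + 1) fun n hn => hΦ n (by omega), sum_range_succ', h1,
    sum_range_succ', ← add_assoc, ← sum_add_distrib]
  simp only [fieldOperator_apply, fieldLevel, annihilateLevel, inner_add_left,
    ContinuousLinearMap.adjoint_inner_left]

lemma fieldOperator_isFormalAdjoint (ξ : 𝓗) :
    (fieldOperator ξ).IsFormalAdjoint (fieldOperator ξ) := by
  intro Ψ Φ
  obtain ⟨N, hN⟩ := Ψ.2
  obtain ⟨M, hM⟩ := Φ.2
  have h1 : ∀ n, max N M ≤ n → (Ψ : Fock 𝓗) n = 0 := fun n hn => hN n ((le_max_left _ _).trans hn)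
  have h2 : ∀ n, max N M ≤ n → (Φ : Fock 𝓗) n = 0 := fun n hn => hM n ((le_max_right _ _).trans hn)
  rw [← inner_conj_symm (Ψ : Fock 𝓗), fieldOperator_inner_left ξ Ψ Φ h1 h2,
    fieldOperator_inner_left ξ Φ Ψ h2 h1, map_add, map_sum, map_sum, add_comm]
  simp only [inner_conj_symm]

/-- A densely defined symmetric operator is contained in its adjoint, which is closed. -/
lemma isClosable_fieldOperator (ξ : 𝓗) : (fieldOperator ξ).IsClosable :=
  (LinearPMap.adjoint_isClosed (T := fieldOperator ξ) dense_finiteParticle).isClosable.leIsClosable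
    (LinearPMap.IsFormalAdjoint.le_adjoint dense_finiteParticle (fieldOperator_isFormalAdjoint ξ))

lemma inner_symTensor_createLevel (x h y : 𝓗) (n : ℕ) :
    inner ℂ (symTensor x (n + 1)) (createLevel h n (symTensor y n)) =
      ((√(n + 1) : ℝ) : ℂ) * (inner ℂ x h * inner ℂ x y ^ n) := by
  have h1 : createLevel h n (symTensor y n) = ((√(n + 1) : ℝ) : ℂ) •
      (SymPow 𝓗 (n + 1)).orthogonalProjectionOnto (tensorLeft n h (diagTensor y n)) := rfl
  rw [h1, inner_smul_right, Submodule.inner_orthogonalProjectionOnto_eq_of_mem_left]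
  congr 1
  have h2 : ((symTensor x (n + 1) : SymPow 𝓗 (n + 1)) : TPow 𝓗 (n + 1)) =
    tensorLeft n x (diagTensor x n) := rfl
  rw [h2, inner_tensorLeft, inner_diagTensor]

lemma sqrt_factorial_succ (n : ℕ) : √((n + 1).factorial : ℝ) = √(n + 1) * √(n.factorial) := by
  rw [Nat.factorial_succ, Nat.cast_mul, Real.sqrt_mul (by positivity)]
  push_cast
  rfl

/-- Coherent vectors are eigenvectors of annihilation: the factor `√(n + 1)` of the creation
operator cancels against the normalizations `1 / √(n!)`. -/
lemma annihilateLevel_coherent (h y : 𝓗) (n : ℕ) :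
    annihilateLevel h n (coherent y (n + 1)) = inner ℂ h y • coherent y n := by
  refine symPow_ext fun x => ?_
  rw [annihilateLevel, ContinuousLinearMap.adjoint_inner_right, coherent_apply, coherent_apply,
    inner_smul_right, inner_smul_right, inner_smul_right, inner_symTensor, ← inner_conj_symm,
    inner_symTensor_createLevel, sqrt_factorial_succ]
  have h1 : ((√(n + 1) : ℝ) : ℂ) ≠ 0 := by
    exact_mod_cast (Real.sqrt_pos.2 (by positivity : (0 : ℝ) < n + 1)).ne'
  simp only [map_mul, map_pow, conj_ofReal, inner_conj_symm]
  push_cast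
  rw [mul_inv]
  field_simp

/-- The derivative of `coherent` at `y` in the direction `h`, which is `a(h)^* exp(a(y)^*) Ω`. -/
def coherentDeriv (y h : 𝓗) : Fock 𝓗 := fderiv ℂ coherent y h

lemma hasDerivAt_coherent (y h : 𝓗) (z : ℂ) :
    HasDerivAt (fun z : ℂ => coherent (y + z • h)) (coherentDeriv (y + z • h) h) z := by
  have h1 : HasFDerivAt coherent (fderiv ℂ coherent (y + z • h)) (y + z • h) :=
    (entire_coherent _ (Set.mem_univ _)).differentiableAt.hasFDerivAt
  have h2 : HasDerivAt (fun z : ℂ => y + z • h) h z := by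
    simpa using ((hasDerivAt_id z).smul_const h).const_add y
  exact h1.comp_hasDerivAt z h2

lemma inner_symTensor_coherentDeriv (x y h : 𝓗) (n : ℕ) :
    inner ℂ (symTensor x n) (coherentDeriv y h n) =
      ((√(n.factorial) : ℝ) : ℂ)⁻¹ * (n * inner ℂ x y ^ (n - 1) * inner ℂ x h) := by
  have h1 := hasDerivAt_coherent y h 0
  rw [zero_smul, add_zero] at h1
  have h2 := (((innerSL ℂ (symTensor x n)).comp
    (lp.evalCLM ℂ (fun n => SymPow 𝓗 n) 2 n)).hasFDerivAt.comp_hasDerivAt 0 h1)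
  have h3 : HasDerivAt (fun z : ℂ => ((√(n.factorial) : ℝ) : ℂ)⁻¹ * (inner ℂ x y + z * inner ℂ x h) ^ n)
      (((√(n.factorial) : ℝ) : ℂ)⁻¹ * (n * inner ℂ x y ^ (n - 1) * inner ℂ x h)) 0 := by
    have h4 : HasDerivAt (fun z : ℂ => inner ℂ x y + z * inner ℂ x h) (inner ℂ x h) 0 := by
      simpa using ((hasDerivAt_id (0 : ℂ)).mul_const (inner ℂ x h)).const_add (inner ℂ x y)
    simpa using (h4.pow n).const_mul (((√(n.factorial) : ℝ) : ℂ)⁻¹)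
  refine h2.unique (h3.congr_of_eventuallyEq (Filter.Eventually.of_forall fun z => ?_))
  change inner ℂ (symTensor x n) (coherent (y + z • h) n) = _
  rw [coherent_apply, inner_smul_right, inner_symTensor, inner_add_right, inner_smul_right]

lemma createLevel_coherent (h y : 𝓗) (n : ℕ) :
    createLevel h n (coherent y n) = coherentDeriv y h (n + 1) := by
  refine symPow_ext fun x => ?_
  rw [coherent_apply, map_smul, inner_smul_right, inner_symTensor_createLevel,
    inner_symTensor_coherentDeriv, sqrt_factorial_succ]
  have h0 : (0 : ℝ) < n + 1 := by positivity
  have h1 : ((√(n + 1) : ℝ) : ℂ) ≠ 0 := by exact_mod_cast (Real.sqrt_pos.2 h0).ne'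
  have h2 : ((√(n + 1) : ℝ) : ℂ) * ((√(n + 1) : ℝ) : ℂ) = n + 1 := by
    rw [← ofReal_mul, Real.mul_self_sqrt h0.le]; push_cast; rfl
  rw [ofReal_mul, mul_inv, add_tsub_cancel_right]
  push_cast
  rw [← h2]
  field_simp

lemma coherentDeriv_zero (y h : 𝓗) : coherentDeriv y h 0 = 0 :=
  symPow_ext fun x => by rw [inner_symTensor_coherentDeriv]; simp

/-- Creation raises and annihilation lowers the cutoff by one, so both parts are exact truncations.
This yields the convergence needed for the closure. -/
lemma fieldLevel_truncate_coherent (h y : 𝓗) (N n : ℕ) :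
    fieldLevel h (truncate (N + 1) (coherent y)) n =
      (truncate (N + 2) (coherentDeriv y h) + inner ℂ h y • truncate N (coherent y)) n := by
  rw [lp.coeFn_add, Pi.add_apply, lp.coeFn_smul, Pi.smul_apply, truncate_apply, truncate_apply]
  cases n with
  | zero =>
    rw [fieldLevel, truncate_apply, coherentDeriv_zero, ite_self]
    refine Eq.trans ?_ (zero_add _).symm
    by_cases hN : 0 < N
    · rw [if_pos (by omega), if_pos hN, annihilateLevel_coherent]
    · rw [if_neg (by omega), if_neg hN, map_zero, smul_zero]
  | succ n =>
    rw [fieldLevel, truncate_apply, truncate_apply]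
    congr 1
    · by_cases hN : n < N + 1
      · rw [if_pos hN, if_pos (by omega), createLevel_coherent]
      · rw [if_neg hN, if_neg (by omega), map_zero]
    · by_cases hN : n + 1 < N
      · rw [if_pos (by omega), if_pos hN, annihilateLevel_coherent]
      · rw [if_neg (by omega), if_neg hN, map_zero, smul_zero]

/-- Coherent vectors lie in the domain of the closed field operators. -/
lemma coherent_mem_graph_closure (h y : 𝓗) :
    (coherent y, coherentDeriv y h + inner ℂ h y • coherent y) ∈ (fieldOperator h).closure.graph := by
  rw [← (isClosable_fieldOperator h).graph_closure_eq_closure_graph]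
  have hlim : Filter.Tendsto (fun N => (truncate (N + 1) (coherent y),
      truncate (N + 2) (coherentDeriv y h) + inner ℂ h y • truncate N (coherent y))) Filter.atTop
      (nhds (coherent y, coherentDeriv y h + inner ℂ h y • coherent y)) := by
    refine Filter.Tendsto.prodMk_nhds ?_ (Filter.Tendsto.add ?_ ?_)
    · exact (tendsto_truncate _).comp (Filter.tendsto_add_atTop_nat 1)
    · exact (tendsto_truncate _).comp (Filter.tendsto_add_atTop_nat 2)
    · exact (tendsto_truncate _).const_smul _
  refine mem_closure_of_tendsto hlim (Filter.Eventually.of_forall fun N => ?_)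
  refine (LinearPMap.mem_graph_iff _).2
    ⟨⟨truncate (N + 1) (coherent y), truncate_mem_finiteParticle _ _⟩, rfl, ?_⟩
  exact lp.ext (funext fun n => fieldLevel_truncate_coherent h y N n)

lemma hasDerivAt_comp_ofReal {F : Type*} [NormedAddCommGroup F] [InnerProductSpace ℂ F]
    {w : ℂ → F} {w' : F} {t : ℝ} (h : HasDerivAt w w' t) :
    HasDerivAt (fun s : ℝ => w s) w' t := by
  simpa [Function.comp_def] using h.scomp t Complex.ofRealCLM.hasDerivAt

lemma isWeyl_apply_coherent {h : 𝓗} {U : Fock 𝓗 →L[ℂ] Fock 𝓗} (hU : IsWeyl h U) (y : 𝓗) :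
    U (coherent y) = Complex.exp (-(‖h‖ ^ 2 / 2 : ℝ) + I * inner ℂ h y) • coherent (y + I • h) := by
  obtain ⟨V, hV, hV0, hVadd, hVc, hVd, rfl⟩ := hU
  -- The explicit trajectory of `coherent y` under the group generated by the field operator; it is
  -- differentiated in a complex time and then restricted to real times.
  set w : ℂ → Fock 𝓗 := fun t =>
    Complex.exp (-(‖h‖ ^ 2 / 2 : ℝ) * t ^ 2 + I * inner ℂ h y * t) • coherent (y + t • (I • h)) with hw
  set z : ℂ → Fock 𝓗 := fun t => Complex.exp (-(‖h‖ ^ 2 / 2 : ℝ) * t ^ 2 + I * inner ℂ h y * t) •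
    (coherentDeriv (y + t • (I • h)) h + inner ℂ h (y + t • (I • h)) • coherent (y + t • (I • h)))
    with hz
  have hd : ∀ t : ℂ, HasDerivAt w (I • z t) t := by
    intro t
    have h1 : HasDerivAt (fun t : ℂ => Complex.exp (-(‖h‖ ^ 2 / 2 : ℝ) * t ^ 2 + I * inner ℂ h y * t))
        (Complex.exp (-(‖h‖ ^ 2 / 2 : ℝ) * t ^ 2 + I * inner ℂ h y * t) *
          (-(‖h‖ ^ 2 : ℝ) * t + I * inner ℂ h y)) t := by
      refine HasDerivAt.cexp ?_
      have h2 := ((hasDerivAt_pow 2 t).const_mul (-(‖h‖ ^ 2 / 2 : ℝ) : ℂ)).add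
        ((hasDerivAt_id t).const_mul (I * inner ℂ h y))
      refine h2.congr_deriv ?_
      push_cast
      simp
      ring
    have h3 := h1.smul (hasDerivAt_coherent y (I • h) t)
    refine h3.congr_deriv ?_
    have h4 : coherentDeriv (y + t • (I • h)) (I • h) = I • coherentDeriv (y + t • (I • h)) h := by
      simp [coherentDeriv]
    have h5 : inner ℂ h (y + t • (I • h)) = inner ℂ h y + t * I * (‖h‖ ^ 2 : ℝ) := by
      rw [inner_add_right, inner_smul_right, inner_smul_right, inner_self_eq_norm_sq_to_K]
      push_cast
      ring_nf
      rfl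
    rw [h4, hz]
    simp only
    rw [h5]
    generalize Complex.exp (-(‖h‖ ^ 2 / 2 : ℝ) * t ^ 2 + I * inner ℂ h y * t) = E
    simp only [smul_add, smul_smul]
    congr 2
    · ring
    · linear_combination (-E * t * (‖h‖ ^ 2 : ℝ)) * I_mul_I
  have key := unitaryGroup_apply_eq hV hV0 hVadd hVc hVd (w := fun t : ℝ => w t)
    (z := fun t : ℝ => z t) (fun t => ?_) (fun t => ?_) 1
  · simpa [hw] using key
  · exact Submodule.smul_mem _ _ (coherent_mem_graph_closure h (y + (t : ℂ) • (I • h)))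
  · exact hasDerivAt_comp_ofReal (hd t)

/-- Every Weyl operator is a displacement operator. -/
lemma isWeyl_eq_displacement {h : 𝓗} {U : Fock 𝓗 →L[ℂ] Fock 𝓗} (hU : IsWeyl h U) :
    U = displacement (-(I • h)) := by
  refine clm_ext_coherent fun y => ?_
  rw [isWeyl_apply_coherent hU, displacement_coherent, inner_neg_left, inner_smul_left, norm_neg,
    norm_smul, sub_neg_eq_add]
  simp

/-- `displacement f` commutes with the Weyl operators of `K`, because `⟨f, -I h⟩` is real when `Re
⟨h, f⟩ = 0`. It then commutes with the bicommutant. -/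
lemma commute_displacement_of_mem_weylAlgebra {K : ClosedSubmodule ℝ 𝓗}
    {A : Fock 𝓗 →L[ℂ] Fock 𝓗} (hA : A ∈ weylAlgebra K) {f : 𝓗}
    (hf : ∀ h ∈ K, (inner ℂ h f).re = 0) : displacement f * A = A * displacement f := by
  refine Subalgebra.mem_centralizer_iff ℂ |>.1 hA _ ?_
  rw [Set.mem_centralizer_iff]
  rintro U ⟨h, hh, hU⟩
  rw [isWeyl_eq_displacement hU]
  refine displacement_commute ?_
  rw [inner_neg_left, inner_neg_right, inner_smul_left, inner_smul_right, ← inner_conj_symm f h]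
  have h1 : (starRingEnd ℂ) (inner ℂ h f) = -inner ℂ h f := by
    have h2 := hf h hh
    generalize inner ℂ h f = q at h2
    refine Complex.ext ?_ ?_ <;> simp [h2]
  rw [h1]
  simp

end Field

/-! ### Matrix elements of the Weyl algebra between coherent vectors -/

section Kernel

variable {𝓗 : Type u} [NormedAddCommGroup 𝓗] [InnerProductSpace ℂ 𝓗]

/-- The displacement is moved from one coherent vector through `A` to the other; the Gaussian
factors on the two sides are equal and cancel. -/
lemma inner_coherent_shift {A : Fock 𝓗 →L[ℂ] Fock 𝓗} {f : 𝓗}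
    (hA : displacement f * A = A * displacement f) (x y : 𝓗) :
    inner ℂ (coherent (x + f)) (A (coherent y)) =
      Complex.exp (inner ℂ f y + inner ℂ x f) * inner ℂ (coherent x) (A (coherent (y - f))) := by
  have h1 : inner ℂ (coherent x) ((displacement f * A) (coherent y)) =
      inner ℂ (coherent x) ((A * displacement f) (coherent y)) := by rw [hA]
  rw [clm_mul_apply, clm_mul_apply, ← ContinuousLinearMap.adjoint_inner_left, adjoint_displacement,
    displacement_coherent, displacement_coherent, map_smul, inner_smul_left, inner_smul_right,
    ← Complex.exp_conj, sub_neg_eq_add, norm_neg] at h1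
  simp only [map_add, map_neg, conj_ofReal, inner_conj_symm, inner_neg_left] at h1
  rw [Complex.exp_add, Complex.exp_add, mul_assoc, mul_assoc] at h1
  have h2 := mul_left_cancel₀ (Complex.exp_ne_zero _) h1
  have h3 : Complex.exp (inner ℂ x f) * Complex.exp (-inner ℂ x f) = 1 := by
    rw [← Complex.exp_add]; simp
  rw [Complex.exp_add]
  linear_combination Complex.exp (inner ℂ x f) * h2 -
    inner ℂ (coherent (x + f)) (A (coherent y)) * h3

/-- The shift identity holds for the directions `s f` with real `s`, and both sides continue
analytically in `s`. Evaluation at `s = I` gives a relation that no unitary displacement provides.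
-/
lemma inner_coherent_shift_I {A : Fock 𝓗 →L[ℂ] Fock 𝓗} {f : 𝓗}
    (hA : ∀ s : ℝ, displacement ((s : ℂ) • f) * A = A * displacement ((s : ℂ) • f)) (x y : 𝓗) :
    inner ℂ (coherent (x - I • f)) (A (coherent y)) =
      Complex.exp (I * inner ℂ f y + I * inner ℂ x f) *
        inner ℂ (coherent x) (A (coherent (y - I • f))) := by
  -- The first slot is antiholomorphic in its vector, so the parameter is conjugated there. This is
  -- why the shift at `z = I` is `-I • f` on both sides.
  set F₁ : ℂ → ℂ := fun z => (starRingEnd ℂ)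
    (inner ℂ (A (coherent y)) (coherent (x + (starRingEnd ℂ) z • f))) with hF₁
  set F₂ : ℂ → ℂ := fun z => Complex.exp (z * inner ℂ f y + z * inner ℂ x f) *
    inner ℂ (coherent x) (A (coherent (y + z • (-f)))) with hF₂
  have hd₁ : Differentiable ℂ F₁ := by
    intro z
    have h1 : Differentiable ℂ fun z : ℂ => inner ℂ (A (coherent y)) (coherent (x + z • f)) := fun z =>
      (((innerSL ℂ (A (coherent y))).hasFDerivAt.comp_hasDerivAt z
        (hasDerivAt_coherent x f z))).differentiableAt
    have h2 := (h1 ((starRingEnd ℂ) z)).conj_conj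
    simpa [hF₁, Function.comp_def] using h2
  have hd₂ : Differentiable ℂ F₂ := by
    intro z
    have h1 : Differentiable ℂ fun z : ℂ => inner ℂ (coherent x) (A (coherent (y + z • (-f)))) :=
      fun z => (((innerSL ℂ (coherent x)).comp A).hasFDerivAt.comp_hasDerivAt z
        (hasDerivAt_coherent y (-f) z)).differentiableAt
    exact DifferentiableAt.mul (by fun_prop) (h1 z)
  have heq : ∀ s : ℝ, F₁ s = F₂ s := fun s => by
    have := inner_coherent_shift (hA s) x y
    simp only [hF₁, hF₂, conj_ofReal, inner_conj_symm, smul_neg, ← sub_eq_add_neg]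
    rw [this]
    congr 2
    rw [inner_smul_left, inner_smul_right, conj_ofReal]
  have hfun : F₁ = F₂ := by
    have hfr : ∃ᶠ z in nhdsWithin (0 : ℂ) {0}ᶜ, F₁ z = F₂ z := by
      have ht : Filter.Tendsto (fun s : ℝ => (s : ℂ)) (nhdsWithin 0 {0}ᶜ) (nhdsWithin 0 {0}ᶜ) := by
        refine tendsto_nhdsWithin_iff.2 ⟨?_, ?_⟩
        · have := continuous_ofReal.tendsto 0
          rw [ofReal_zero] at this
          exact this.mono_left nhdsWithin_le_nhds
        · filter_upwards [self_mem_nhdsWithin] with s hs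
          simpa using hs
      exact ht.frequently (Filter.Eventually.frequently (Filter.Eventually.of_forall heq))
    exact AnalyticOnNhd.eq_of_frequently_eq (fun z _ => hd₁.analyticAt z)
      (fun z _ => hd₂.analyticAt z) hfr
  have := congrFun hfun I
  simpa [hF₁, hF₂, sub_eq_add_neg] using this

/-- Matrix elements of an element of the Weyl algebra with the vacuum, in terms of the real
components of the argument along the real subspace. -/
lemma inner_coherent_vacuum {K : ClosedSubmodule ℝ 𝓗} {A : Fock 𝓗 →L[ℂ] Fock 𝓗}
    (hA : A ∈ weylAlgebra K) {η e₁ e₂ : 𝓗}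
    (h₁ : ∀ h ∈ K, (inner ℂ h ((2 : ℂ)⁻¹ • η - e₁)).re = 0)
    (h₂ : ∀ h ∈ K, (inner ℂ h ((2 : ℂ)⁻¹ • (I • η) - e₂)).re = 0) :
    inner ℂ (coherent η) (A (vacuum 𝓗)) =
      Complex.exp (-inner ℂ (e₁ - I • e₂) (e₁ + I • e₂)) *
        inner ℂ (coherent (e₁ - I • e₂)) (A (coherent (e₁ + I • e₂))) := by
  set f₁ := (2 : ℂ)⁻¹ • η - e₁ with hf₁
  set f₂ := (2 : ℂ)⁻¹ • (I • η) - e₂ with hf₂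
  have hI : I • f₂ = -((2 : ℂ)⁻¹ • η) - I • e₂ := by
    rw [hf₂, smul_sub, smul_comm I, smul_smul I I, I_mul_I]; simp
  -- The remainder `f₁` is removed by the real shift and `f₂` by the continued one.
  have hη : η = (e₁ - I • e₂ + f₁) - I • f₂ := by
    rw [hI, hf₁]
    have : η = (2 : ℂ)⁻¹ • η + (2 : ℂ)⁻¹ • η := by rw [← add_smul]; norm_num
    conv_lhs => rw [this]
    abel
  have hy : (0 : 𝓗) - I • f₂ - f₁ = e₁ + I • e₂ := by rw [hI, hf₁]; abel
  have hc₂ : ∀ s : ℝ, displacement ((s : ℂ) • f₂) * A = A * displacement ((s : ℂ) • f₂) :=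
    fun s => commute_displacement_of_mem_weylAlgebra hA fun h hh => by
      rw [inner_smul_right, re_ofReal_mul, h₂ h hh, mul_zero]
  rw [← coherent_zero]
  conv_lhs => rw [hη]
  rw [inner_coherent_shift_I hc₂, inner_coherent_shift
    (commute_displacement_of_mem_weylAlgebra hA h₁), hy, ← mul_assoc, ← Complex.exp_add]
  congr 2
  have h5 : e₁ + I • e₂ = -(I • f₂) - f₁ := by rw [← hy, zero_sub]
  rw [h5]
  simp only [inner_zero_right, inner_add_left, inner_sub_right, inner_neg_right, inner_smul_right,
    zero_sub]
  ring

/-- The two norms contribute the exponent `‖e₁‖² + ‖e₂‖²` and the prefactor `-‖e₁‖² + ‖e₂‖²`, so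
`e₁` drops out. -/
lemma norm_coherent_mul_norm_coherent (e₁ e₂ : 𝓗) :
    ‖Complex.exp (-inner ℂ (e₁ - I • e₂) (e₁ + I • e₂))‖ *
      (‖coherent (e₁ - I • e₂)‖ * ‖coherent (e₁ + I • e₂)‖) = Real.exp (2 * ‖e₂‖ ^ 2) := by
  rw [Complex.norm_exp, norm_coherent, norm_coherent, ← Real.exp_add, ← Real.exp_add]
  congr 1
  have h1 := norm_add_sq (𝕜 := ℂ) e₁ (I • e₂)
  have h2 := norm_sub_sq (𝕜 := ℂ) e₁ (I • e₂)
  have h3 : (inner ℂ (e₁ - I • e₂) (e₁ + I • e₂)).re = ‖e₁‖ ^ 2 - ‖I • e₂‖ ^ 2 := by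
    rw [inner_sub_left, inner_add_right, inner_add_right, inner_self_eq_norm_sq_to_K,
      inner_self_eq_norm_sq_to_K]
    have h4 : (inner ℂ (I • e₂) e₁).re = (inner ℂ e₁ (I • e₂)).re := inner_re_symm (𝕜 := ℂ) _ _
    simp only [sub_re, add_re, h4, coe_algebraMap, ← ofReal_pow, ofReal_re]
    ring
  rw [neg_re, h3, h1, h2, norm_smul]
  simp
  ring

lemma smul_eq_re_add_im (c : ℂ) (w : 𝓗) : c • w = c.re • w + c.im • (I • w) := by
  conv_lhs => rw [← Complex.re_add_im c]
  rw [add_smul, mul_smul]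
  rfl

lemma map_complex_smul (S : 𝓗 →L[ℝ] 𝓗) (c : ℂ) (ξ : 𝓗) :
    S (c • ξ) = (c.re : ℂ) • S ξ + (c.im : ℂ) • S (I • ξ) := by
  rw [smul_eq_re_add_im, map_add, map_smul, map_smul]; rfl

lemma map_I_smul_complex_smul (S : 𝓗 →L[ℝ] 𝓗) (c : ℂ) (ξ : 𝓗) :
    S (I • c • ξ) = (c.re : ℂ) • S (I • ξ) - (c.im : ℂ) • S ξ := by
  rw [smul_comm I c ξ, map_complex_smul, smul_smul I I, I_mul_I, neg_one_smul, map_neg, smul_neg,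
    ← sub_eq_add_neg]

/-- The complex linear part of a real linear operator. -/
def linPart (S : 𝓗 →L[ℝ] 𝓗) : 𝓗 →L[ℂ] 𝓗 where
  toFun ξ := (2 : ℂ)⁻¹ • S ξ - I • ((2 : ℂ)⁻¹ • S (I • ξ))
  map_add' ξ ζ := by simp only [map_add, smul_add]; abel
  map_smul' c ξ := by
    have hc := (Complex.re_add_im c).symm
    rw [map_complex_smul, map_I_smul_complex_smul, RingHom.id_apply]
    generalize (c.re : ℂ) = a at *
    generalize (c.im : ℂ) = b at *
    subst hc
    match_scalars
    · ring
    · linear_combination (b / 2) * I_mul_I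
  cont := by fun_prop

/-- The conjugate linear part of a real linear operator. -/
def conjPart (S : 𝓗 →L[ℝ] 𝓗) : 𝓗 →L⋆[ℂ] 𝓗 where
  toFun ξ := (2 : ℂ)⁻¹ • S ξ + I • ((2 : ℂ)⁻¹ • S (I • ξ))
  map_add' ξ ζ := by simp only [map_add, smul_add]; abel
  map_smul' c ξ := by
    have hc : (starRingEnd ℂ) c = c.re - c.im * I := by
      conv_lhs => rw [← Complex.re_add_im c]
      simp only [map_add, map_mul, conj_ofReal, conj_I]
      ring
    rw [map_complex_smul, map_I_smul_complex_smul, hc]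
    match_scalars
    · ring
    · linear_combination ((c.im : ℂ) / 2) * I_mul_I
  cont := by fun_prop

/-- The entire function whose Taylor coefficients are the conjugates of the components of the
vector `X A Ω`, where `X` is a second quantization and `S` is the real adjoint of the restriction
of the one-particle operator to the real subspace. -/
def symbol (S : 𝓗 →L[ℝ] 𝓗) (A : Fock 𝓗 →L[ℂ] Fock 𝓗) (ξ : 𝓗) : ℂ :=
  Complex.exp (-inner ℂ (conjPart S ξ) (linPart S ξ)) *
    inner ℂ (A (coherent (conjPart S ξ))) (coherent (linPart S ξ))

lemma entire_symbol (S : 𝓗 →L[ℝ] 𝓗) (A : Fock 𝓗 →L[ℂ] Fock 𝓗) : Entire (symbol S A) := by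
  have h1 : Entire fun ξ => innerSL ℂ (A (coherent (conjPart S ξ))) :=
    entire_conj_coherent_conj ((innerSL ℂ).comp A) (conjPart S)
  have h2 : Entire fun ξ => coherent (linPart S ξ) := fun ξ _ =>
    (entire_coherent _ (Set.mem_univ _)).comp_of_eq ((linPart S).analyticAt ξ) rfl
  have h3 : Entire fun ξ => innerSL ℂ (conjPart S ξ) := fun ξ _ =>
    ((innerSL ℂ).comp (conjPart S)).analyticAt ξ
  have h4 : Entire fun ξ => inner ℂ (A (coherent (conjPart S ξ))) (coherent (linPart S ξ)) :=
    fun ξ hξ => ((ContinuousLinearMap.id ℂ (Fock 𝓗 →L[ℂ] ℂ)).analyticAt_bilinear _).comp₂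
      (h1 ξ hξ) (h2 ξ hξ)
  have h5 : Entire fun ξ => inner ℂ (conjPart S ξ) (linPart S ξ) :=
    fun ξ hξ => ((ContinuousLinearMap.id ℂ (𝓗 →L[ℂ] ℂ)).analyticAt_bilinear _).comp₂
      (h3 ξ hξ) ((linPart S).analyticAt ξ)
  exact fun ξ hξ => ((h5 ξ hξ).neg.cexp).mul (h4 ξ hξ)

/-- With `e₁ = S ξ / 2` and `e₂ = S (I ξ) / 2`, the Gaussian growth in `e₁` cancels and the exponent
is `2 ‖e₂‖²`. Thus `‖S‖ < 1` gives growth strictly below that of a coherent vector. -/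
lemma norm_symbol_le (S : 𝓗 →L[ℝ] 𝓗) (A : Fock 𝓗 →L[ℂ] Fock 𝓗) (ξ : 𝓗) :
    ‖symbol S A ξ‖ ≤ ‖A‖ * Real.exp (‖S (I • ξ)‖ ^ 2 / 2) := by
  set e₁ := (2 : ℂ)⁻¹ • S ξ
  set e₂ := (2 : ℂ)⁻¹ • S (I • ξ) with he₂
  have h1 : symbol S A ξ = (starRingEnd ℂ) (Complex.exp (-inner ℂ (e₁ - I • e₂) (e₁ + I • e₂)) *
      inner ℂ (coherent (e₁ - I • e₂)) (A (coherent (e₁ + I • e₂)))) := by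
    rw [map_mul, inner_conj_symm, ← Complex.exp_conj, map_neg, inner_conj_symm]
    rfl
  rw [h1, RCLike.norm_conj, norm_mul]
  calc _ ≤ ‖Complex.exp (-inner ℂ (e₁ - I • e₂) (e₁ + I • e₂))‖ *
        (‖coherent (e₁ - I • e₂)‖ * (‖A‖ * ‖coherent (e₁ + I • e₂)‖)) := by
        gcongr
        refine (norm_inner_le_norm _ _).trans ?_
        gcongr
        exact A.le_opNorm _
    _ = ‖A‖ * (‖Complex.exp (-inner ℂ (e₁ - I • e₂) (e₁ + I • e₂))‖ *
        (‖coherent (e₁ - I • e₂)‖ * ‖coherent (e₁ + I • e₂)‖)) := by ring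
    _ = _ := by
        rw [norm_coherent_mul_norm_coherent, he₂, norm_smul]
        congr 2
        simp
        ring

variable [CompleteSpace 𝓗]

/-- On `K`, the vectors `C w` and `T* R w` have the same real scalar products, by `C h = R (T h)`
and self-adjointness. Hence the halves of `T* R w` and `T* (I R w)` serve as `e₁` and `e₂` for `η =
C w`. -/
lemma conj_symbol_eq {K : ClosedSubmodule ℝ 𝓗} {A : Fock 𝓗 →L[ℂ] Fock 𝓗}
    (hA : A ∈ weylAlgebra K) {T : 𝓗 →L[ℝ] 𝓗} {R C : 𝓗 →L[ℂ] 𝓗} (hR : IsSelfAdjoint R)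
    (hC : IsSelfAdjoint C) (hT : ∀ h ∈ K, C h = R (T h)) (w : 𝓗) :
    (starRingEnd ℂ) (symbol (ContinuousLinearMap.adjoint T) A (R w)) =
      inner ℂ (coherent (C w)) (A (vacuum 𝓗)) := by
  have key : ∀ h ∈ K, ∀ w, (inner ℂ h (C w)).re =
      (inner ℂ h (ContinuousLinearMap.adjoint T (R w))).re := by
    intro h hh w
    rw [← ClosedSubmodule.inner_real_eq_re_inner (x := h)
      (y := ContinuousLinearMap.adjoint T (R w)), ContinuousLinearMap.adjoint_inner_right,
      ClosedSubmodule.inner_real_eq_re_inner]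
    congr 1
    calc inner ℂ h (C w) = inner ℂ (C h) w := (hC.isSymmetric h w).symm
      _ = inner ℂ (R (T h)) w := by rw [hT h hh]
      _ = _ := hR.isSymmetric _ _
  have half : ∀ h ∈ K, ∀ w, (inner ℂ h ((2 : ℂ)⁻¹ • C w -
      (2 : ℂ)⁻¹ • ContinuousLinearMap.adjoint T (R w))).re = 0 := by
    intro h hh w
    have h2 : ((2 : ℂ)⁻¹) = ((2⁻¹ : ℝ) : ℂ) := by push_cast; rfl
    rw [← smul_sub, inner_smul_right, h2, re_ofReal_mul, inner_sub_right, sub_re, key h hh w,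
      sub_self, mul_zero]
  rw [inner_coherent_vacuum hA (half · · w) (e₂ := (2 : ℂ)⁻¹ • ContinuousLinearMap.adjoint T (I • R w))
    (fun h hh => by
      have := half h hh (I • w)
      rwa [map_smul, map_smul] at this), symbol, map_mul, inner_conj_symm, ← Complex.exp_conj, map_neg,
    inner_conj_symm]
  rfl

end Kernel

/-! ### The vector with a prescribed symbol -/

section Weights

open Finset

/-- The bound for the term of multi-degree `n` in the expansion of a vector of the Fock space. -/
def termRate (c : ℝ) (k : ℕ) : ℝ := k.factorial * cauchyRate c k * cauchyRate 1 k

lemma termRate_zero (c : ℝ) : termRate c 0 = 1 := by simp [termRate, cauchyRate_zero]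

lemma termRate_nonneg {c : ℝ} (hc : 0 ≤ c) (k : ℕ) : 0 ≤ termRate c k := by
  have h1 := cauchyRate_nonneg hc k
  have h2 := cauchyRate_nonneg zero_le_one k
  unfold termRate; positivity

/-- Stirling's sequence decreases from its first value `e / √2`, which gives `k! ≤ e √k (k / e) ^
k`; then `√k ≤ k`. -/
lemma factorial_le_mul_pow (k : ℕ) :
    ((k + 1).factorial : ℝ) ≤ Real.exp 1 * (k + 1) * (((k + 1 : ℕ) : ℝ) / Real.exp 1) ^ (k + 1) := by
  have h := Stirling.stirlingSeq'_antitone (Nat.zero_le k)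
  simp only [Function.comp, Nat.succ_eq_add_one, zero_add, Stirling.stirlingSeq_one] at h
  rw [Stirling.stirlingSeq, div_le_div_iff₀ (by positivity) (by positivity),
    Real.sqrt_mul (by norm_num)] at h
  have h2 : 0 < √2 := by positivity
  have h3 : √((k + 1 : ℕ) : ℝ) ≤ k + 1 := by
    rw [Real.sqrt_le_left (by positivity)]
    push_cast
    nlinarith [(Nat.cast_nonneg k : (0 : ℝ) ≤ k)]
  have h4 : ((k + 1).factorial : ℝ) ≤
      Real.exp 1 * √((k + 1 : ℕ) : ℝ) * (((k + 1 : ℕ) : ℝ) / Real.exp 1) ^ (k + 1) := by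
    refine le_of_mul_le_mul_right (h.trans_eq ?_) h2
    ring
  exact h4.trans (by gcongr)

/-- The two Cauchy rates multiply to `(e / k) ^ k √c ^ k`, and the first factor cancels the growth
of the factorial. -/
lemma termRate_succ_le {c : ℝ} (hc : 0 < c) (k : ℕ) :
    termRate c (k + 1) ≤ Real.exp 1 * (k + 1) * √c ^ (k + 1) := by
  have hk : (0 : ℝ) < (k + 1 : ℕ) := by positivity
  have h1 : cauchyRate c (k + 1) * cauchyRate 1 (k + 1) =
      (Real.exp 1 / (k + 1 : ℕ)) ^ (k + 1) * √c ^ (k + 1) := by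
    rw [cauchyRate, cauchyRate, ← Real.mul_rpow (by positivity) (by positivity), ← mul_pow,
      ← Real.rpow_natCast, mul_one]
    have : Real.exp 1 * c / (k + 1 : ℕ) * (Real.exp 1 / (k + 1 : ℕ)) =
        (Real.exp 1 / (k + 1 : ℕ) * √c) ^ (2 : ℝ) := by
      rw [Real.rpow_two, mul_pow, Real.sq_sqrt hc.le]; ring
    rw [this, ← Real.rpow_mul (by positivity)]
    congr 1; ring
  rw [termRate, mul_assoc, h1]
  calc _ ≤ (Real.exp 1 * (k + 1) * (((k + 1 : ℕ) : ℝ) / Real.exp 1) ^ (k + 1)) *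
        ((Real.exp 1 / (k + 1 : ℕ)) ^ (k + 1) * √c ^ (k + 1)) := by
        gcongr; exact factorial_le_mul_pow k
    _ = Real.exp 1 * (k + 1) * √c ^ (k + 1) *
        ((((k + 1 : ℕ) : ℝ) / Real.exp 1) * (Real.exp 1 / (k + 1 : ℕ))) ^ (k + 1) := by
        rw [mul_pow]; ring
    _ = _ := by
        rw [div_mul_div_cancel₀ (Real.exp_pos 1).ne', div_self hk.ne', one_pow, mul_one]

lemma summable_rpow_mul_geometric {t : ℝ} (ht0 : 0 ≤ t) (ht : t < 1) (p : ℝ) :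
    Summable fun k : ℕ => (Real.exp 1 * (k + 1)) ^ p * t ^ k := by
  obtain ⟨q, hq⟩ := exists_nat_ge p
  have h1 : Summable fun k : ℕ => ((k : ℝ) + 1) ^ q * t ^ k := by
    rcases ht0.eq_or_lt with rfl | ht0
    · refine summable_of_ne_finset_zero (s := {0}) fun k hk => ?_
      rw [zero_pow (by simpa using hk), mul_zero]
    have h := (summable_nat_add_iff 1).2
      (summable_pow_mul_geometric_of_norm_lt_one q (r := t) (by rwa [Real.norm_of_nonneg ht0.le]))
    refine (h.mul_left t⁻¹).congr fun k => ?_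
    push_cast
    rw [pow_succ]
    field_simp
  refine Summable.of_nonneg_of_le (fun k => by positivity) (fun k => ?_) (h1.mul_left (Real.exp 1 ^ p))
  rw [Real.mul_rpow (by positivity) (by positivity), mul_assoc]
  gcongr
  rw [← Real.rpow_natCast]
  exact Real.rpow_le_rpow_of_exponent_le (by linarith [(Nat.cast_nonneg k : (0 : ℝ) ≤ k)]) hq

lemma summable_prod_termRate_rpow {c : ℕ → ℝ} {θ : ℝ} (hθ : θ < 1) (hc : ∀ j, 0 < c j)
    (hcθ : ∀ j, c j ≤ θ) (hR : RapidDecay c) {p : ℝ} (hp : 0 < p) :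
    Summable fun n : ℕ →₀ ℕ => (n.prod fun j k => termRate (c j) k) ^ p := by
  have hθ0 : 0 < θ := (hc 0).trans_le (hcθ 0)
  set t := θ ^ (p / 2) with ht
  have ht1 : t < 1 := Real.rpow_lt_one hθ0.le hθ (by positivity)
  have hD := summable_rpow_mul_geometric (t := t) (by positivity) ht1 p
  set D := ∑' k : ℕ, (Real.exp 1 * (k + 1)) ^ p * t ^ k with hDdef
  have hD0 : 0 ≤ D := tsum_nonneg fun k => by positivity
  have hw : ∀ j k, 0 ≤ termRate (c j) k := fun j k => termRate_nonneg (hc j).le k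
  have key := summable_finsupp_prod (r := fun j k => termRate (c j) k ^ p)
    (F := fun j => c j ^ (p / 2) * D) (fun j => by simp [termRate_zero])
    (fun j k => Real.rpow_nonneg (hw j k) p) ?_
    (fun j => mul_nonneg (Real.rpow_nonneg (hc j).le _) hD0)
    ((hR.summable_rpow (fun j => (hc j).le) (by positivity : 0 < p / 2)).mul_right D)
  · refine key.congr fun n => ?_
    rw [Finsupp.prod, Finsupp.prod, Real.finsetProd_rpow _ _ fun j _ => hw _ _]
  · intro j N
    have hcj := hc j
    have hterm : ∀ k : ℕ, termRate (c j) (k + 1) ^ p ≤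
        c j ^ (p / 2) * ((Real.exp 1 * (k + 1)) ^ p * t ^ k) := by
      intro k
      -- One factor `c j ^ (p / 2)` is kept for the summation over `j`; the other `k` factors are
      -- bounded by `t ^ k` uniformly in `j`.
      have e1 : (√(c j) ^ (k + 1)) ^ p = c j ^ (p / 2) * (c j ^ (p / 2)) ^ k := by
        rw [← pow_succ', ← Real.rpow_natCast, ← Real.rpow_natCast, Real.sqrt_eq_rpow,
          ← Real.rpow_mul hcj.le, ← Real.rpow_mul hcj.le, ← Real.rpow_mul hcj.le]
        congr 1; ring
      calc termRate (c j) (k + 1) ^ p ≤ (Real.exp 1 * (k + 1) * √(c j) ^ (k + 1)) ^ p :=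
            Real.rpow_le_rpow (hw _ _) (termRate_succ_le hcj k) hp.le
        _ = c j ^ (p / 2) * ((Real.exp 1 * (k + 1)) ^ p * (c j ^ (p / 2)) ^ k) := by
            rw [Real.mul_rpow (by positivity) (by positivity), e1]; ring
        _ ≤ _ := by
            gcongr
            exact Real.rpow_le_rpow hcj.le (hcθ j) (by positivity)
    calc ∑ k ∈ range N, termRate (c j) k ^ p ≤ ∑ k ∈ range (N + 1), termRate (c j) k ^ p :=
          sum_le_sum_of_subset_of_nonneg (range_mono (by omega))
            fun k _ _ => Real.rpow_nonneg (hw _ _) _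
      _ = 1 + ∑ k ∈ range N, termRate (c j) (k + 1) ^ p := by
          rw [sum_range_succ', termRate_zero, Real.one_rpow, add_comm]
      _ ≤ 1 + c j ^ (p / 2) * D := by
          gcongr
          refine (sum_le_sum fun k _ => hterm k).trans ?_
          rw [← mul_sum]
          gcongr
          exact hD.sum_le_tsum _ fun k _ => by positivity

end Weights

/-! ### Linearity of Taylor coefficients -/

section Coefficients

variable {V : Type*} [NormedAddCommGroup V] [NormedSpace ℂ V]

/-- Compatibility with continuous linear maps is applied to the pair `(f, g)`, with the two
projections and their sum. -/
lemma taylorCoeff_add {f g : V → ℂ} (hf : Entire f) (hg : Entire g) (v : ℕ → V) (n : ℕ →₀ ℕ) :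
    taylorCoeff v (fun x => f x + g x) n = taylorCoeff v f n + taylorCoeff v g n := by
  have hfg : Entire fun x => (f x, g x) := fun x hx => (hf x hx).prod (hg x hx)
  have h1 := taylorCoeff_clm_comp (ContinuousLinearMap.fst ℂ ℂ ℂ) hfg v n
  have h2 := taylorCoeff_clm_comp (ContinuousLinearMap.snd ℂ ℂ ℂ) hfg v n
  have h3 := taylorCoeff_clm_comp
    (ContinuousLinearMap.fst ℂ ℂ ℂ + ContinuousLinearMap.snd ℂ ℂ ℂ) hfg v n
  rw [add_apply, ← h1, ← h2] at h3
  exact h3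

lemma taylorCoeff_const_mul (a : ℂ) {f : V → ℂ} (hf : Entire f) (v : ℕ → V) (n : ℕ →₀ ℕ) :
    taylorCoeff v (fun x => a * f x) n = a * taylorCoeff v f n :=
  taylorCoeff_clm_comp (a • ContinuousLinearMap.id ℂ ℂ) hf v n

end Coefficients

/-! ### The map `Ξ` defined by a diagonal bound -/

section Xi

open Finset

variable {𝓗 : Type u} [NormedAddCommGroup 𝓗] [InnerProductSpace ℂ 𝓗]

lemma symbol_add (S : 𝓗 →L[ℝ] 𝓗) (A B : Fock 𝓗 →L[ℂ] Fock 𝓗) :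
    symbol S (A + B) = fun ξ => symbol S A ξ + symbol S B ξ := by
  funext ξ
  rw [symbol, symbol, symbol, add_apply, inner_add_left, mul_add]

lemma symbol_smul (S : 𝓗 →L[ℝ] 𝓗) (a : ℂ) (A : Fock 𝓗 →L[ℂ] Fock 𝓗) :
    symbol S (a • A) = fun ξ => (starRingEnd ℂ) a * symbol S A ξ := by
  funext ξ
  rw [symbol, symbol, smul_apply, inner_smul_left]
  ring

lemma continuous_coherent : Continuous (coherent : 𝓗 → Fock 𝓗) :=
  continuousOn_univ.1 entire_coherent.continuousOn

/-- The symbol sees `ξ` only through `S ξ` and `S (I ξ)`; the points `x m` themselves need not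
converge to `ξ`. -/
lemma tendsto_symbol {S : 𝓗 →L[ℝ] 𝓗} (A : Fock 𝓗 →L[ℂ] Fock 𝓗) {x : ℕ → 𝓗} {ξ : 𝓗}
    (h1 : Filter.Tendsto (fun m => S (x m)) Filter.atTop (nhds (S ξ)))
    (h2 : Filter.Tendsto (fun m => S (I • x m)) Filter.atTop (nhds (S (I • ξ)))) :
    Filter.Tendsto (fun m => symbol S A (x m)) Filter.atTop (nhds (symbol S A ξ)) := by
  have hl : Filter.Tendsto (fun m => linPart S (x m)) Filter.atTop (nhds (linPart S ξ)) :=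
    (h1.const_smul _).sub ((h2.const_smul _).const_smul _)
  have hc : Filter.Tendsto (fun m => conjPart S (x m)) Filter.atTop (nhds (conjPart S ξ)) :=
    (h1.const_smul _).add ((h2.const_smul _).const_smul _)
  refine Filter.Tendsto.mul ?_ ?_
  · exact (Complex.continuous_exp.tendsto _).comp (hc.inner hl).neg
  · exact (((A.continuous.comp continuous_coherent).tendsto _).comp hc).inner
      ((continuous_coherent.tendsto _).comp hl)

/-- The data of a diagonal bound for the real adjoint of an operator: an orthogonal sequence of
unit (or zero) vectors that exhausts the operator, and the bounds along the sequence. -/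
structure DiagonalBound (S : 𝓗 →L[ℝ] 𝓗) (u : ℕ → 𝓗) (c : ℕ → ℝ) (θ : ℝ) : Prop where
  orthogonal : ∀ i j, i ≠ j → inner ℂ (u i) (u j) = 0
  norm_le : ∀ i, ‖u i‖ ≤ 1
  lt_one : θ < 1
  pos : ∀ j, 0 < c j
  le : ∀ j, c j ≤ θ
  rapidDecay : RapidDecay c
  bound : ∀ (m : ℕ) (z : ℕ → ℂ), ‖S (I • ∑ j ∈ range m, z j • u j)‖ ^ 2 ≤
    ∑ j ∈ range m, c j * ‖z j‖ ^ 2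
  tendsto : ∀ ξ : 𝓗, Filter.Tendsto (fun m => S (∑ j ∈ range m, inner ℂ (u j) ξ • u j))
    Filter.atTop (nhds (S ξ))

namespace DiagonalBound

variable {S : 𝓗 →L[ℝ] 𝓗} {u : ℕ → 𝓗} {c : ℕ → ℝ} {θ : ℝ} (hu : DiagonalBound S u c θ)
include hu

lemma norm_symbol_sum_le (A : Fock 𝓗 →L[ℂ] Fock 𝓗) (m : ℕ) (z : ℕ → ℂ) :
    ‖symbol S A (∑ j ∈ range m, z j • u j)‖ ≤
      ‖A‖ * Real.exp ((∑ j ∈ range m, c j * ‖z j‖ ^ 2) / 2) := by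
  refine (norm_symbol_le S A _).trans ?_
  gcongr
  exact hu.bound m z

lemma norm_coherent_sum_le (m : ℕ) (z : ℕ → ℂ) :
    ‖coherent (∑ j ∈ range m, z j • u j)‖ ≤
      1 * Real.exp ((∑ j ∈ range m, (fun _ => 1 : ℕ → ℝ) j * ‖z j‖ ^ 2) / 2) := by
  rw [norm_coherent, one_mul]
  gcongr
  simpa using norm_sq_sum_smul_le hu.orthogonal hu.norm_le (range m) z

/-- Cauchy's estimates are combined for the symbol, with weights `c j`, and for `coherent`, with
weights `1`. -/
lemma norm_term_le (A : Fock 𝓗 →L[ℂ] Fock 𝓗) (n : ℕ →₀ ℕ) :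
    ‖((n.prod fun _ k => (k.factorial : ℂ)) * (starRingEnd ℂ) (taylorCoeff u (symbol S A) n)) •
      taylorCoeff u coherent n‖ ≤ (n.prod fun j k => termRate (c j) k) * ‖A‖ := by
  have h1 := norm_taylorCoeff_le (entire_symbol S A) u hu.pos (hu.norm_symbol_sum_le A) n
  have h2 := norm_taylorCoeff_le entire_coherent u (fun _ => one_pos) hu.norm_coherent_sum_le n
  have h3 : ‖n.prod fun _ k => (k.factorial : ℂ)‖ = n.prod fun _ k => (k.factorial : ℝ) := by
    simp [Finsupp.prod]
  have h4 : 0 ≤ n.prod fun _ k => (k.factorial : ℝ) := prod_nonneg fun _ _ => by positivity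
  have h5 : (n.prod fun j k => termRate (c j) k) = (n.prod fun _ k => (k.factorial : ℝ)) *
      (n.prod fun j k => cauchyRate (c j) k) * (n.prod fun _ k => cauchyRate 1 k) := by
    simp only [Finsupp.prod, termRate, prod_mul_distrib]
  have h6 : 0 ≤ n.prod fun j k => cauchyRate (c j) k :=
    prod_nonneg fun j _ => cauchyRate_nonneg (hu.pos j).le _
  rw [norm_smul, norm_mul, h3, RCLike.norm_conj, h5]
  calc _ ≤ (n.prod fun _ k => (k.factorial : ℝ)) *
        (‖A‖ * n.prod fun j k => cauchyRate (c j) k) * (1 * n.prod fun _ k => cauchyRate 1 k) := by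
        gcongr
    _ = _ := by ring

lemma prod_termRate_nonneg (n : ℕ →₀ ℕ) : 0 ≤ n.prod fun j k => termRate (c j) k :=
  prod_nonneg fun j _ => termRate_nonneg (hu.pos j).le _

lemma summable_term (A : Fock 𝓗 →L[ℂ] Fock 𝓗) : Summable fun n : ℕ →₀ ℕ =>
    ((n.prod fun _ k => (k.factorial : ℂ)) * (starRingEnd ℂ) (taylorCoeff u (symbol S A) n)) •
      taylorCoeff u coherent n := by
  have h := summable_prod_termRate_rpow hu.lt_one hu.pos hu.le hu.rapidDecay one_pos
  simp only [Real.rpow_one] at h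
  exact Summable.of_norm_bounded (h.mul_right ‖A‖) (hu.norm_term_le A)

/-- The coefficient of `coherent` pairs with `coherent ξ` to a monomial divided by `n!`, so the
factor `n!` restores the Taylor series of the symbol, conjugated. For finitely many directions this
series is summed exactly; the rest is a limit. -/
lemma inner_coherent_tsum (A : Fock 𝓗 →L[ℂ] Fock 𝓗) (ξ : 𝓗) :
    inner ℂ (coherent ξ) (∑' n : ℕ →₀ ℕ, ((n.prod fun _ k => (k.factorial : ℂ)) *
      (starRingEnd ℂ) (taylorCoeff u (symbol S A) n)) • taylorCoeff u coherent n) =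
      (starRingEnd ℂ) (symbol S A ξ) := by
  set a : (ℕ →₀ ℕ) → ℂ := fun n =>
    (n.prod fun j k => inner ℂ (u j) ξ ^ k) • taylorCoeff u (symbol S A) n with ha
  have h1 : ∀ n, inner ℂ (coherent ξ) (((n.prod fun _ k => (k.factorial : ℂ)) *
      (starRingEnd ℂ) (taylorCoeff u (symbol S A) n)) • taylorCoeff u coherent n) =
      (starRingEnd ℂ) (a n) := by
    intro n
    have e1 : inner ℂ (coherent ξ) (taylorCoeff u coherent n) =
        n.prod fun j k => (k.factorial : ℂ)⁻¹ * inner ℂ ξ (u j) ^ k := by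
      have e2 := taylorCoeff_clm_comp (innerSL ℂ (coherent ξ)) entire_coherent u n
      simp only [innerSL_apply_apply, inner_coherent] at e2
      rw [← e2]
      exact taylorCoeff_exp (innerSL ℂ ξ) u n
    simp only [ha, smul_eq_mul, map_mul]
    rw [inner_smul_right, e1]
    have e3 : (n.prod fun _ k => (k.factorial : ℂ)) *
        (n.prod fun j k => (k.factorial : ℂ)⁻¹ * inner ℂ ξ (u j) ^ k) =
        (starRingEnd ℂ) (n.prod fun j k => inner ℂ (u j) ξ ^ k) := by
      simp only [Finsupp.prod, map_prod, map_pow, inner_conj_symm]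
      rw [← prod_mul_distrib]
      refine prod_congr rfl fun j _ => ?_
      rw [← mul_assoc, mul_inv_cancel₀ (by exact_mod_cast (Nat.factorial_ne_zero _)), one_mul]
    rw [← e3]; ring
  have h2 : HasSum (fun n => (starRingEnd ℂ) (a n)) (inner ℂ (coherent ξ)
      (∑' n : ℕ →₀ ℕ, ((n.prod fun _ k => (k.factorial : ℂ)) *
      (starRingEnd ℂ) (taylorCoeff u (symbol S A) n)) • taylorCoeff u coherent n)) := by
    simp only [← h1]
    exact (innerSL ℂ (coherent ξ)).hasSum (hu.summable_term A).hasSum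
  have h3 : Summable a := by
    have := h2.summable.map (starRingEnd ℂ) RCLike.continuous_conj
    simpa [Function.comp_def] using this
  have h4 : ∑' n, a n = symbol S A ξ := by
    -- Cutting the coordinates off at `m` leaves a finite-dimensional expansion. Dominated
    -- convergence treats the series and `tendsto_symbol` the function values.
    set z : ℕ → ℕ → ℂ := fun m j => if j < m then inner ℂ (u j) ξ else 0 with hz
    have hsum : ∀ m, ∑ j ∈ range m, z m j • u j = ∑ j ∈ range m, inner ℂ (u j) ξ • u j :=
      fun m => sum_congr rfl fun j hj => by simp [hz, mem_range.1 hj]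
    have h5 : ∀ m, ∑' n : ℕ →₀ ℕ, (n.prod fun j k => z m j ^ k) • taylorCoeff u (symbol S A) n =
        symbol S A (∑ j ∈ range m, inner ℂ (u j) ξ • u j) := fun m => by
      rw [← hsum]
      exact (hasSum_taylorCoeff (entire_symbol S A) u hu.pos (hu.norm_symbol_sum_le A) m (z m)
        fun j hj => by simp [hz, hj]).tsum_eq
    have h6 : Filter.Tendsto (fun m => symbol S A (∑ j ∈ range m, inner ℂ (u j) ξ • u j))
        Filter.atTop (nhds (symbol S A ξ)) := by
      refine tendsto_symbol A (hu.tendsto ξ) ((hu.tendsto (I • ξ)).congr fun m => ?_)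
      rw [smul_sum]
      congr 1
      refine sum_congr rfl fun j _ => ?_
      rw [inner_smul_right, mul_smul]
    have h7 : Filter.Tendsto (fun m => ∑' n : ℕ →₀ ℕ,
        (n.prod fun j k => z m j ^ k) • taylorCoeff u (symbol S A) n)
        Filter.atTop (nhds (∑' n, a n)) := by
      refine tendsto_tsum_of_dominated_convergence h3.norm (fun n => ?_) ?_
      · refine tendsto_const_nhds.congr' ?_
        filter_upwards [Filter.eventually_ge_atTop (indexBound n)] with m hm
        simp only [ha]
        congr 1
        refine prod_congr rfl fun j hj => ?_
        have : j < m := by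
          by_contra h
          exact Finsupp.mem_support_iff.1 hj (eq_zero_of_indexBound_le (by omega))
        simp [hz, this]
      · refine Filter.Eventually.of_forall fun m n => ?_
        rw [ha, norm_smul, norm_smul]
        gcongr
        rw [Finsupp.prod, Finsupp.prod, norm_prod, norm_prod]
        refine prod_le_prod (fun _ _ => norm_nonneg _) fun j _ => ?_
        rw [norm_pow, norm_pow]
        gcongr
        simp only [hz]
        split_ifs <;> simp
    simp only [h5] at h7
    exact tendsto_nhds_unique h7 h6
  rw [← h2.tsum_eq, ← h4, Complex.conj_tsum]

variable {M : Type*} [NormedAddCommGroup M] [NormedSpace ℂ M]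

/-- The symbol is conjugate linear in the operator, so its conjugated coefficients are complex
linear functionals; Cauchy's estimate makes them bounded. -/
lemma exists_coefficient (J : M →ₗᵢ[ℂ] Fock 𝓗 →L[ℂ] Fock 𝓗) (n : ℕ →₀ ℕ) :
    ∃ φ : M →L[ℂ] ℂ, ∀ A : M, φ A =
      (n.prod fun _ k => (k.factorial : ℂ)) * (starRingEnd ℂ) (taylorCoeff u (symbol S (J A)) n) := by
  let φ₀ : M →ₗ[ℂ] ℂ :=
    { toFun := fun A => (n.prod fun _ k => (k.factorial : ℂ)) *
        (starRingEnd ℂ) (taylorCoeff u (symbol S (J A)) n)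
      map_add' := fun A B => by
        rw [map_add, symbol_add, taylorCoeff_add (entire_symbol S _)
          (entire_symbol S _), map_add, mul_add]
      map_smul' := fun a A => by
        rw [map_smul, symbol_smul, taylorCoeff_const_mul _ (entire_symbol S _), map_mul,
          conj_conj, RingHom.id_apply, smul_eq_mul]
        ring }
  have hφ₀ : ∀ A : M, ‖φ₀ A‖ ≤
      (‖n.prod fun _ k => (k.factorial : ℂ)‖ * n.prod fun j k => cauchyRate (c j) k) * ‖A‖ := by
    intro A
    have h1 := norm_taylorCoeff_le (entire_symbol S (J A)) u hu.pos (hu.norm_symbol_sum_le (J A)) n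
    change ‖(n.prod fun _ k => (k.factorial : ℂ)) *
        (starRingEnd ℂ) (taylorCoeff u (symbol S (J A)) n)‖ ≤ _
    rw [norm_mul, RCLike.norm_conj, mul_assoc, mul_comm _ ‖A‖, ← J.norm_map A]
    gcongr
  exact ⟨⟨φ₀, AddMonoidHomClass.continuous_of_bound φ₀ _ hφ₀⟩, fun A => rfl⟩

/-- Every symbol defined by an operator comes from a vector of the Fock space, and the vector
depends on the operator through a map of type `ℓ^p` for all `p > 0`. -/
theorem exists_isEllP (J : M →ₗᵢ[ℂ] Fock 𝓗 →L[ℂ] Fock 𝓗) :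
    ∃ Ξ : M →L[ℂ] Fock 𝓗,
      (∀ (A : M) (ξ : 𝓗), inner ℂ (coherent ξ) (Ξ A) = (starRingEnd ℂ) (symbol S (J A) ξ)) ∧
      ∀ p : ℝ, 0 < p → IsEllP ℂ p Ξ := by
  have hl := fun p (hp : (0 : ℝ) < p) =>
    summable_prod_termRate_rpow hu.lt_one hu.pos hu.le hu.rapidDecay hp
  have hl1 : Summable fun n : ℕ →₀ ℕ => n.prod fun j k => termRate (c j) k := by
    simpa using hl 1 one_pos
  choose φ hφ using hu.exists_coefficient J
  have hs : ∀ A : M, Summable fun n => φ n A • taylorCoeff u coherent n := fun A => by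
    simp only [hφ]; exact hu.summable_term (J A)
  have hb : ∀ n (A : M), ‖φ n A • taylorCoeff u coherent n‖ ≤
      (n.prod fun j k => termRate (c j) k) * ‖A‖ := fun n A => by
    rw [hφ, ← J.norm_map A]; exact hu.norm_term_le (J A) n
  let Ξ₀ : M →ₗ[ℂ] Fock 𝓗 :=
    { toFun := fun A => ∑' n : ℕ →₀ ℕ, φ n A • taylorCoeff u coherent n
      map_add' := fun A B => by
        rw [← (hs A).tsum_add (hs B)]
        exact tsum_congr fun n => by rw [map_add, add_smul]
      map_smul' := fun a A => by
        rw [RingHom.id_apply, ← (hs A).tsum_const_smul a]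
        exact tsum_congr fun n => by rw [map_smul, smul_assoc] }
  have hΞ₀ : ∀ A, ‖Ξ₀ A‖ ≤ (∑' n : ℕ →₀ ℕ, n.prod fun j k => termRate (c j) k) * ‖A‖ := by
    intro A
    rw [← tsum_mul_right]
    exact tsum_of_norm_bounded (hl1.mul_right ‖A‖).hasSum fun n => hb n A
  obtain ⟨Ξ, hΞ⟩ : ∃ Ξ : M →L[ℂ] Fock 𝓗, ∀ A : M,
      Ξ A = ∑' n : ℕ →₀ ℕ, φ n A • taylorCoeff u coherent n :=
    ⟨⟨Ξ₀, AddMonoidHomClass.continuous_of_bound Ξ₀ _ hΞ₀⟩, fun A => rfl⟩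
  refine ⟨Ξ, fun A ξ => ?_, fun p hp => ?_⟩
  · rw [hΞ, ← hu.inner_coherent_tsum]
    simp only [hφ]
  · have hT : ∀ A : M, HasSum (fun n => φ n A • taylorCoeff u coherent n) (Ξ A) :=
      fun A => by rw [hΞ]; exact (hs A).hasSum
    exact isEllP_of_hasSum hu.prod_termRate_nonneg hl hb hT hp

end DiagonalBound

variable [CompleteSpace 𝓗]

lemma exists_diagonalBound (T : 𝓗 →L[ℝ] 𝓗) (hT1 : ‖T‖ < 1)
    (hT : ∀ p : ℝ, 0 < p → IsEllP ℝ p T) :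
    ∃ u c θ, DiagonalBound (ContinuousLinearMap.adjoint T) u c θ := by
  obtain ⟨u, c, θ, h1, h2, h3, h4, h5, h6, h7, h8⟩ := exists_diagonal_bound T hT1 hT
  refine ⟨u, c, θ, h1, fun i => ?_, h3, h4, h5, h6, h7, h8⟩
  rcases h2 i with h | h <;> simp [h]

/-- Transfer of a construction from normed spaces of operators to subalgebras. -/
lemma exists_isEllP_subalgebra {F : Type u} [NormedAddCommGroup F] [NormedSpace ℂ F]
    (M : Subalgebra ℂ (F →L[ℂ] F)) {Q : (F →L[ℂ] F) → F → Prop}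
    (h : ∀ (N : Type u) [NormedAddCommGroup N] [NormedSpace ℂ N] (J : N →ₗᵢ[ℂ] F →L[ℂ] F),
      ∃ Ξ : N →L[ℂ] F, (∀ A : N, Q (J A) (Ξ A)) ∧ ∀ p : ℝ, 0 < p → IsEllP ℂ p Ξ) :
    ∃ Ξ : M →L[ℂ] F,
      (∀ A : M, Q A (Ξ A)) ∧ ∀ p : ℝ, 0 < p → IsEllP ℂ (E := M) (F := F) p Ξ :=
  h (Subalgebra.toSubmodule M) ⟨Submodule.subtype _, fun _ => rfl⟩

theorem exists_map_symbol (M : Subalgebra ℂ (Fock 𝓗 →L[ℂ] Fock 𝓗)) (T : 𝓗 →L[ℝ] 𝓗)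
    (hT1 : ‖T‖ < 1) (hT : ∀ p : ℝ, 0 < p → IsEllP ℝ p T) :
    ∃ Ξ : M →L[ℂ] Fock 𝓗,
      (∀ (A : M) (ξ : 𝓗), inner ℂ (coherent ξ) (Ξ A) =
        (starRingEnd ℂ) (symbol (ContinuousLinearMap.adjoint T) A ξ)) ∧
      ∀ p : ℝ, 0 < p → IsEllP ℂ (E := M) (F := Fock 𝓗) p Ξ := by
  obtain ⟨u, c, θ, hu⟩ := exists_diagonalBound T hT1 hT
  refine exists_isEllP_subalgebra (F := Fock 𝓗) M (Q := fun A Ψ => ∀ ξ, inner ℂ (coherent ξ) Ψ =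
    (starRingEnd ℂ) (symbol (ContinuousLinearMap.adjoint T) A ξ)) fun N _ _ J => ?_
  exact hu.exists_isEllP J

end Xi

/-! ### The bounded operator `(1 + Δ)⁻¹` -/

/-- Von Neumann's argument: `(x, y)` is the orthogonal projection of `(z, 0)` onto the closed graph,
and orthogonality of `(z - x, -y)` to the graph is the adjoint relation. This solves `x + S* S x =
z`. -/
lemma exists_mem_graph_adjoint {E : Type*} [NormedAddCommGroup E] [InnerProductSpace ℝ E]
    [CompleteSpace E] {G : Submodule ℝ (E × E)} (hG : IsClosed (G : Set (E × E))) (z : E) :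
    ∃ x y, (x, y) ∈ G ∧ (y, z - x) ∈ G.adjoint := by
  set G' : Submodule ℝ (WithLp 2 (E × E)) :=
    G.comap (WithLp.linearEquiv 2 ℝ (E × E)).toLinearMap with hG'
  have hcl : IsClosed (G' : Set (WithLp 2 (E × E))) :=
    hG.preimage (WithLp.prod_continuous_ofLp 2 E E)
  have : CompleteSpace G' := hcl.completeSpace_coe
  set q := G'.starProjection (WithLp.toLp 2 (z, 0)) with hq
  refine ⟨q.fst, q.snd, G'.starProjection_apply_mem _, ?_⟩
  rw [Submodule.mem_adjoint_iff]
  intro a b hab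
  have h1 := (Submodule.mem_orthogonal _ _).1
    (G'.sub_starProjection_mem_orthogonal (WithLp.toLp 2 (z, 0))) (WithLp.toLp 2 (a, b)) hab
  rw [← hq, WithLp.prod_inner_apply] at h1
  simp only [WithLp.ofLp_sub, Prod.fst_sub, Prod.snd_sub, zero_sub, inner_neg_right] at h1
  have h2 : inner ℝ a (z - q.fst) + -inner ℝ b q.snd = 0 := h1
  change inner ℝ b q.snd - inner ℝ a (z - q.fst) = 0
  linarith

section Modular

variable {𝓗 : Type u} [NormedAddCommGroup 𝓗] [InnerProductSpace ℂ 𝓗]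

lemma isClosed_standardPart (H : ClosedSubmodule ℝ 𝓗) : IsClosed (standardPart H : Set 𝓗) :=
  H.isClosed.inter (Submodule.isClosed_orthogonal (complexPart H))

variable [CompleteSpace 𝓗]

/-- The components are continuous functions of the pair: with `x'` the part of `x` orthogonal to
`H^⊥` and `H ∩ iH`, one has `h₁ = (x' + y) / 2` and `h₂ = -i (x' - y) / 2`. -/
lemma isClosed_tomita_graph (H : ClosedSubmodule ℝ 𝓗) :
    IsClosed ((tomita H).graph : Set (𝓗 × 𝓗)) := by
  have : CompleteSpace (complexPart H) := (isClosed_complexPart H).completeSpace_coe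
  have : CompleteSpace (complexOrthogonal H) :=
    (Submodule.isClosed_orthogonal _).completeSpace_coe
  set P := (complexOrthogonal H).starProjection
  set Q := (complexPart H).starProjection
  have heq : ((tomita H).graph : Set (𝓗 × 𝓗)) =
      {q | (2 : ℂ)⁻¹ • (q.1 - P q.1 - Q q.1 + q.2) ∈ (standardPart H : Set 𝓗)} ∩
      {q | (2 : ℂ)⁻¹ • (-(I • (q.1 - P q.1 - Q q.1 - q.2))) ∈ (standardPart H : Set 𝓗)} := by
    ext ⟨x, y⟩
    rw [SetLike.mem_coe, mem_tomita_graph]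
    constructor
    · rintro ⟨a, ha, b, hb, h₁, hh₁, h₂, hh₂, rfl, rfl⟩
      have hs : ∀ h ∈ H, h ∈ Submodule.span ℂ (H : Set 𝓗) := fun h hh => Submodule.subset_span hh
      have hw : h₁ + I • h₂ ∈ Submodule.span ℂ (H : Set 𝓗) :=
        add_mem (hs _ hh₁.1) (Submodule.smul_mem _ _ (hs _ hh₂.1))
      have hw' : h₁ + I • h₂ ∈ (complexPart H)ᗮ :=
        add_mem (mem_standardPart.1 hh₁).2 (Submodule.smul_mem _ _ (mem_standardPart.1 hh₂).2)
      have hP : P (a + b + (h₁ + I • h₂)) = a := by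
        have h0 : P (b + (h₁ + I • h₂)) = 0 := by
          rw [Submodule.starProjection_apply_eq_zero_iff]
          exact Submodule.le_orthogonal_orthogonal _ (add_mem (hs _ hb.1) hw)
        rw [add_assoc, map_add, h0, add_zero]
        exact Submodule.starProjection_eq_self_iff.2 ha
      have hQ : Q (a + b + (h₁ + I • h₂)) = b := by
        have h0 : Q (a + (h₁ + I • h₂)) = 0 := by
          rw [Submodule.starProjection_apply_eq_zero_iff]
          refine add_mem ?_ hw'
          rw [Submodule.mem_orthogonal]
          exact fun v hv => ha v (hs _ hv.1)
        rw [add_comm a b, add_assoc, map_add, h0, add_zero]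
        exact Submodule.starProjection_eq_self_iff.2 hb
      have e₁ : (2 : ℂ)⁻¹ • (a + b + (h₁ + I • h₂) - a - b + (h₁ - I • h₂)) = h₁ := by
        module
      have e₂ : (2 : ℂ)⁻¹ • (-(I • (a + b + (h₁ + I • h₂) - a - b - (h₁ - I • h₂)))) = h₂ := by
        have : a + b + (h₁ + I • h₂) - a - b - (h₁ - I • h₂) = (2 : ℂ) • (I • h₂) := by module
        rw [this, smul_comm I, smul_smul I I, I_mul_I]
        module
      refine ⟨?_, ?_⟩
      · simp only [Set.mem_ofPred_eq, hP, hQ, e₁]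
        exact hh₁
      · simp only [Set.mem_ofPred_eq, hP, hQ, e₂]
        exact hh₂
    · rintro ⟨h₁, h₂⟩
      refine ⟨P x, Submodule.starProjection_apply_mem _ _, Q x,
        Submodule.starProjection_apply_mem _ _, _, h₁, _, h₂, ?_, ?_⟩
      all_goals
        simp only [smul_comm I, smul_neg, smul_smul I I, I_mul_I, neg_one_smul]
        module
  rw [heq]
  exact ((isClosed_standardPart H).preimage (by fun_prop)).inter
    ((isClosed_standardPart H).preimage (by fun_prop))

variable {H : ClosedSubmodule ℝ 𝓗}

lemma exists_mem_modularOperator_graph (H : ClosedSubmodule ℝ 𝓗) (z : 𝓗) :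
    ∃ x, (x, z - x) ∈ (modularOperator H).graph := by
  obtain ⟨x, y, hxy, hy⟩ := exists_mem_graph_adjoint (isClosed_tomita_graph H) z
  refine ⟨x, mem_modularOperator_graph.2 ⟨y, hxy, ?_⟩⟩
  rwa [LinearPMap.adjoint_graph_eq_graph_adjoint (dense_tomita_domain H)]

/-- Both sides equal the real scalar product of the images under the Tomita operator. -/
lemma re_inner_of_mem_modularOperator_graph {x w x' w' : 𝓗}
    (h : (x, w) ∈ (modularOperator H).graph) (h' : (x', w') ∈ (modularOperator H).graph) :
    (inner ℂ x w').re = (inner ℂ w x').re := by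
  obtain ⟨y, hy, hw⟩ := mem_modularOperator_graph.1 h
  obtain ⟨y', hy', hw'⟩ := mem_modularOperator_graph.1 h'
  rw [LinearPMap.adjoint_graph_eq_graph_adjoint (dense_tomita_domain H),
    Submodule.mem_adjoint_iff] at hw hw'
  have h1 := hw _ _ hy'
  have h2 := hw' _ _ hy
  simp only [ClosedSubmodule.inner_real_eq_re_inner] at h1 h2
  have h3 : (inner ℂ w x').re = (inner ℂ x' w).re := inner_re_symm (𝕜 := ℂ) _ _
  have h4 : (inner ℂ y y').re = (inner ℂ y' y).re := inner_re_symm (𝕜 := ℂ) _ _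
  linarith

lemma re_inner_nonneg_of_mem_modularOperator_graph {x w : 𝓗}
    (h : (x, w) ∈ (modularOperator H).graph) : 0 ≤ (inner ℂ x w).re := by
  obtain ⟨y, hy, hw⟩ := mem_modularOperator_graph.1 h
  rw [LinearPMap.adjoint_graph_eq_graph_adjoint (dense_tomita_domain H),
    Submodule.mem_adjoint_iff] at hw
  have h1 := hw _ _ hy
  simp only [ClosedSubmodule.inner_real_eq_re_inner] at h1
  have h2 : 0 ≤ (inner ℂ y y).re := inner_self_nonneg (𝕜 := ℂ)
  linarith

/-- Real symmetry applied to the pair and its multiple by `I`; the modular graph is complex linear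
although the Tomita graph is not. -/
lemma im_inner_of_mem_modularOperator_graph {x w : 𝓗}
    (h : (x, w) ∈ (modularOperator H).graph) : (inner ℂ x w).im = 0 := by
  have h' : (I • x, I • w) ∈ (modularOperator H).graph := Submodule.smul_mem _ I h
  have h1 := re_inner_of_mem_modularOperator_graph h h'
  rw [inner_smul_right, inner_smul_right, I_mul_re, I_mul_re] at h1
  have h2 : (inner ℂ w x).im = -(inner ℂ x w).im := inner_im_symm (𝕜 := ℂ) _ _
  linarith

lemma norm_sq_le_of_mem_modularOperator_graph {x z : 𝓗}
    (h : (x, z - x) ∈ (modularOperator H).graph) : ‖x‖ ^ 2 ≤ (inner ℂ x z).re := by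
  have h1 := re_inner_nonneg_of_mem_modularOperator_graph h
  have h2 : (inner ℂ x x).re = ‖x‖ ^ 2 := inner_self_eq_norm_sq (𝕜 := ℂ) x
  rw [inner_sub_right, sub_re, h2] at h1
  linarith

lemma norm_le_of_mem_modularOperator_graph {x z : 𝓗}
    (h : (x, z - x) ∈ (modularOperator H).graph) : ‖x‖ ≤ ‖z‖ := by
  have h1 := norm_sq_le_of_mem_modularOperator_graph h
  have h2 : (inner ℂ x z).re ≤ ‖x‖ * ‖z‖ := re_inner_le_norm (𝕜 := ℂ) x z
  rcases (norm_nonneg x).eq_or_lt with h0 | h0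
  · rw [← h0]; positivity
  · nlinarith

lemma eq_of_mem_modularOperator_graph {x x' z : 𝓗} (h : (x, z - x) ∈ (modularOperator H).graph)
    (h' : (x', z - x') ∈ (modularOperator H).graph) : x = x' := by
  have h1 := sub_mem h h'
  rw [Prod.mk_sub_mk, show z - x - (z - x') = 0 - (x - x') by abel] at h1
  have h2 := norm_le_of_mem_modularOperator_graph h1
  rw [norm_zero, norm_le_zero_iff, sub_eq_zero] at h2
  exact h2

lemma exists_isShiftInverse (H : ClosedSubmodule ℝ 𝓗) :
    ∃ B, IsShiftInverse (modularOperator H) B := by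
  choose b hb using exists_mem_modularOperator_graph H
  let B₀ : 𝓗 →ₗ[ℂ] 𝓗 :=
    { toFun := b
      map_add' := fun z z' => by
        refine eq_of_mem_modularOperator_graph (hb _) ?_
        have := add_mem (hb z) (hb z')
        rwa [Prod.mk_add_mk, show z - b z + (z' - b z') = z + z' - (b z + b z') by abel] at this
      map_smul' := fun c z => by
        refine eq_of_mem_modularOperator_graph (hb _) ?_
        have := Submodule.smul_mem _ c (hb z)
        rwa [Prod.smul_mk, smul_sub] at this }
  refine ⟨B₀.mkContinuous 1 fun z => ?_, fun x y => ⟨fun h => ?_, fun h => ?_⟩⟩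
  · rw [one_mul]; exact norm_le_of_mem_modularOperator_graph (hb z)
  · exact eq_of_mem_modularOperator_graph (hb (x + y)) (by rwa [add_sub_cancel_left])
  · have h' : b (x + y) = x := h
    have := hb (x + y)
    rwa [h', add_sub_cancel_left] at this

lemma isShiftInverse_shiftInverse (H : ClosedSubmodule ℝ 𝓗) :
    IsShiftInverse (modularOperator H) (shiftInverse (modularOperator H)) := by
  have h := exists_isShiftInverse H
  rw [shiftInverse, dif_pos h]
  exact h.choose_spec

lemma shiftInverse_mem_graph (H : ClosedSubmodule ℝ 𝓗) (z : 𝓗) :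
    (shiftInverse (modularOperator H) z, z - shiftInverse (modularOperator H) z) ∈
      (modularOperator H).graph := by
  rw [isShiftInverse_shiftInverse H, add_sub_cancel]

lemma shiftInverse_injective (H : ClosedSubmodule ℝ 𝓗) :
    Function.Injective (shiftInverse (modularOperator H)) := by
  rw [injective_iff_map_eq_zero]
  intro z hz
  have h := shiftInverse_mem_graph H z
  rw [hz, sub_zero] at h
  exact LinearPMap.graph_fst_eq_zero_snd _ h rfl

lemma shiftInverse_nonneg (H : ClosedSubmodule ℝ 𝓗) : 0 ≤ shiftInverse (modularOperator H) := by
  rw [ContinuousLinearMap.nonneg_iff_isPositive, ContinuousLinearMap.isPositive_iff_complex]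
  intro z
  have h := shiftInverse_mem_graph H z
  have h1 := norm_sq_le_of_mem_modularOperator_graph h
  have h2 := im_inner_of_mem_modularOperator_graph h
  have h3 : (inner ℂ (shiftInverse (modularOperator H) z)
    (shiftInverse (modularOperator H) z)).im = 0 := inner_self_im (𝕜 := ℂ) _
  rw [inner_sub_right, sub_im, h3, sub_zero] at h2
  exact ⟨Complex.ext (by simp) (by simp [h2]), (sq_nonneg _).trans h1⟩

/-! ### Powers of the modular operator -/

/-- From the factorization `B = B ^ (1 - α) B ^ α`, any kernel of the power would be a kernel of
`B`. -/
lemma rpow_injective {B : 𝓗 →L[ℂ] 𝓗} (hB : 0 ≤ B) (hinj : Function.Injective B) {α : ℝ}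
    (h0 : 0 < α) (h1 : α < 1) : Function.Injective (B ^ α) := by
  obtain ⟨a, rfl⟩ : ∃ a : NNReal, (a : ℝ) = α := ⟨⟨α, h0.le⟩, rfl⟩
  obtain ⟨b, hb⟩ : ∃ b : NNReal, (b : ℝ) = 1 - a := ⟨⟨1 - a, by linarith⟩, rfl⟩
  have ha : 0 < a := by exact_mod_cast h0
  have hb0 : 0 < b := by rw [← NNReal.coe_pos, hb]; linarith
  have hba : b + a = 1 := by ext; push_cast; linarith
  have hα : B = B ^ b * B ^ a := by rw [← CFC.nnrpow_add hb0 ha, hba, CFC.nnrpow_one B]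
  rw [← CFC.nnrpow_eq_rpow ha]
  intro x y hxy
  refine hinj ?_
  rw [hα, mul_apply_eq_comp, mul_apply_eq_comp]
  exact congrArg _ hxy

lemma commute_rpow {A B : 𝓗 →L[ℂ] 𝓗} (h : Commute A B) (α : ℝ) : Commute (A ^ α) (B ^ α) := by
  have h1 : Commute (A ^ α) B := h.cfc_nnreal _
  exact (h1.symm.cfc_nnreal _).symm

lemma mem_positivePower_graph {α : ℝ} (h0 : 0 < α) (h1 : α < 1) {x y : 𝓗} :
    (x, y) ∈ (positivePower (modularOperator H) α).graph ↔
      ∃ w, (shiftInverse (modularOperator H) ^ α) w = x ∧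
        ((1 - shiftInverse (modularOperator H)) ^ α) w = y := by
  rw [positivePower, Submodule.toLinearPMap_graph_eq]
  · simp
  · rintro _ ⟨w, rfl⟩ hw
    have : w = 0 := (injective_iff_map_eq_zero _).1
      (rpow_injective (shiftInverse_nonneg H) (shiftInverse_injective H) h0 h1) w hw
    subst this
    simp

end Modular

/-! ### The graph of a second quantization -/

/-- For commuting self-adjoint bounded operators `R`, `C` with `R` injective, the pairs with
`C p = R q` form the closed graph of the operator `R w ↦ C w`. -/
lemma mem_of_map_eq_map {E : Type*} [NormedAddCommGroup E] [InnerProductSpace ℂ E]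
    [CompleteSpace E] {R C : E →L[ℂ] E} (hR : R.toLinearMap.IsSymmetric)
    (hC : C.toLinearMap.IsSymmetric) (hRC : ∀ x, R (C x) = C (R x)) (hinj : ∀ x, R x = 0 → x = 0)
    {G : Submodule ℂ (E × E)} (hG : IsClosed (G : Set (E × E))) (hw : ∀ w, (R w, C w) ∈ G)
    {p q : E} (h : C p = R q) : (p, q) ∈ G := by
  have hR' : ∀ x y, inner ℂ (R x) y = inner ℂ x (R y) := hR
  have hC' : ∀ x y, inner ℂ (C x) y = inner ℂ x (C y) := hC
  set L : E × E →L[ℂ] E := C.comp (ContinuousLinearMap.fst ℂ E E) -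
    R.comp (ContinuousLinearMap.snd ℂ E E) with hL
  -- It is shown that the component of `(p, q)` orthogonal to this closed subspace vanishes.
  set K : Submodule ℂ (WithLp 2 (E × E)) :=
    (G ⊓ L.toLinearMap.ker).comap (WithLp.linearEquiv 2 ℂ (E × E)).toLinearMap with hK
  have hcl : IsClosed (K : Set (WithLp 2 (E × E))) :=
    (hG.inter L.isClosed_ker).preimage (WithLp.prod_continuous_ofLp 2 E E)
  have : CompleteSpace K := hcl.completeSpace_coe
  set x : WithLp 2 (E × E) := WithLp.toLp 2 (p, q) with hx
  have hmem := K.starProjection_apply_mem x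
  set y := x - K.starProjection x with hy
  have hyo : y ∈ Kᗮ := K.sub_starProjection_mem_orthogonal x
  have h1 : C y.fst = R y.snd := by
    have e1 : C (K.starProjection x).fst - R (K.starProjection x).snd = 0 := hmem.2
    have e2 : y.fst = p - (K.starProjection x).fst := rfl
    have e3 : y.snd = q - (K.starProjection x).snd := rfl
    rw [e2, e3, map_sub, map_sub, h, sub_eq_zero.1 e1]
  have h2 : R y.fst + C y.snd = 0 := by
    refine ext_inner_left ℂ fun w => ?_
    have hwK : WithLp.toLp 2 (R w, C w) ∈ K := by
      refine ⟨hw w, ?_⟩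
      change C (R w) - R (C w) = 0
      rw [hRC, sub_self]
    have e := (Submodule.mem_orthogonal _ _).1 hyo _ hwK
    rw [WithLp.prod_inner_apply] at e
    have e' : inner ℂ (R w) y.fst + inner ℂ (C w) y.snd = 0 := e
    rw [inner_add_right, inner_zero_right, ← hR', ← hC']
    exact e'
  -- The two relations combine to `(R² + C²) y.fst = 0`. Pairing with `y.fst` gives `R y.fst = 0`,
  -- and injectivity of `R` removes both components.
  have h3 : R (R y.fst) + C (C y.fst) = 0 := by
    rw [h1, ← hRC, ← map_add, h2, map_zero]
  have h4 : ‖R y.fst‖ ^ 2 + ‖C y.fst‖ ^ 2 = 0 := by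
    have e := congrArg (fun v => (inner ℂ y.fst v).re) h3
    simp only [inner_add_right, inner_zero_right, add_re, zero_re] at e
    rw [← hR', ← hC'] at e
    have e1 : (inner ℂ (R y.fst) (R y.fst)).re = ‖R y.fst‖ ^ 2 := inner_self_eq_norm_sq (𝕜 := ℂ) _
    have e2 : (inner ℂ (C y.fst) (C y.fst)).re = ‖C y.fst‖ ^ 2 := inner_self_eq_norm_sq (𝕜 := ℂ) _
    rw [← e1, ← e2]
    exact e
  have h5 : R y.fst = 0 := by
    rw [← norm_eq_zero, ← sq_eq_zero_iff]
    nlinarith [sq_nonneg ‖R y.fst‖, sq_nonneg ‖C y.fst‖]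
  have h6 : y.fst = 0 := hinj _ h5
  have h7 : y.snd = 0 := hinj _ (by rw [← h1, h6, map_zero])
  have h8 : K.starProjection x = x := by
    have : y = 0 := by
      have e : y = WithLp.toLp 2 (y.fst, y.snd) := rfl
      rw [e, h6, h7]; rfl
    rw [hy, sub_eq_zero] at this
    exact this.symm
  rw [h8] at hmem
  exact hmem.1

section Graph

variable {𝓗 : Type u} [NormedAddCommGroup 𝓗] [InnerProductSpace ℂ 𝓗]

/-- The `n`-fold tensor power of a bounded operator. -/
def tensorPower (R : 𝓗 →L[ℂ] 𝓗) : (n : ℕ) → TPow 𝓗 n →L[ℂ] TPow 𝓗 n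
  | 0 => ContinuousLinearMap.id ℂ _
  | n + 1 => (TensorProduct.mapL R (tensorPower R n)).completion

lemma tensorPower_diagTensor (R : 𝓗 →L[ℂ] 𝓗) (x : 𝓗) (n : ℕ) :
    tensorPower R n (diagTensor x n) = diagTensor (R x) n := by
  induction n with
  | zero => rfl
  | succ n ih =>
    rw [diagTensor, diagTensor, tensorLeft_apply, tensorLeft_apply, ← ih]
    exact ContinuousLinearMap.completion_apply_coe _ _

/-- The `n`-fold symmetric tensor power of a bounded operator. -/
def symPower (R : 𝓗 →L[ℂ] 𝓗) (n : ℕ) : SymPow 𝓗 n →L[ℂ] SymPow 𝓗 n :=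
  (SymPow 𝓗 n).orthogonalProjectionOnto.comp ((tensorPower R n).comp (SymPow 𝓗 n).subtypeL)

lemma symPower_symTensor (R : 𝓗 →L[ℂ] 𝓗) (x : 𝓗) (n : ℕ) :
    symPower R n (symTensor x n) = symTensor (R x) n := by
  have h : symPower R n (symTensor x n) =
      (SymPow 𝓗 n).orthogonalProjectionOnto (tensorPower R n (diagTensor x n)) := rfl
  rw [h, tensorPower_diagTensor]
  exact Submodule.orthogonalProjectionOnto_mem_subspace_eq_self (symTensor (R x) n)

lemma topologicalClosure_span_symTensor (n : ℕ) :
    (Submodule.span ℂ (Set.range fun x : 𝓗 => symTensor x n)).topologicalClosure = ⊤ := by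
  rw [Submodule.topologicalClosure_eq_top_iff, Submodule.eq_bot_iff]
  intro p hp
  refine symPow_ext fun x => ?_
  rw [inner_zero_right]
  exact (Submodule.mem_orthogonal _ _).1 hp _ (Submodule.subset_span ⟨x, rfl⟩)

lemma clm_symPow_ext {E : Type*} [NormedAddCommGroup E] [NormedSpace ℂ E] {n : ℕ}
    {S T : SymPow 𝓗 n →L[ℂ] E} (h : ∀ x, S (symTensor x n) = T (symTensor x n)) : S = T := by
  refine ContinuousLinearMap.ext_on (s := Set.range fun x : 𝓗 => symTensor x n) ?_ ?_
  · rw [Submodule.dense_iff_topologicalClosure_eq_top]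
    exact topologicalClosure_span_symTensor n
  · rintro _ ⟨x, rfl⟩
    exact h x

lemma symPower_commute {R C : 𝓗 →L[ℂ] 𝓗} (hRC : ∀ x, R (C x) = C (R x)) (n : ℕ) (p : SymPow 𝓗 n) :
    symPower R n (symPower C n p) = symPower C n (symPower R n p) := by
  have : (symPower R n).comp (symPower C n) = (symPower C n).comp (symPower R n) :=
    clm_symPow_ext fun x => by
      simp only [ContinuousLinearMap.comp_apply, symPower_symTensor, hRC]
  exact congrArg (fun f => f p) this

lemma symPower_isSymmetric {R : 𝓗 →L[ℂ] 𝓗} (hR : R.toLinearMap.IsSymmetric) (n : ℕ) :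
    (symPower R n).toLinearMap.IsSymmetric := by
  have : ContinuousLinearMap.adjoint (symPower R n) = symPower R n :=
    clm_symPow_ext fun x => symPow_ext fun y => by
      rw [ContinuousLinearMap.adjoint_inner_right, symPower_symTensor, symPower_symTensor,
        inner_symTensor, inner_symTensor]
      exact congrArg (· ^ n) (hR y x)
  intro p q
  change inner ℂ (symPower R n p) q = inner ℂ p (symPower R n q)
  rw [← ContinuousLinearMap.adjoint_inner_right, this]

/-- Replacing `w` by its multiples gives an identity of power series, hence equality at every
particle number. -/
lemma inner_symTensor_of_inner_coherent {R C : 𝓗 →L[ℂ] 𝓗} {Ψ Φ : Fock 𝓗}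
    (h : ∀ w, inner ℂ (coherent (C w)) Ψ = inner ℂ (coherent (R w)) Φ) (n : ℕ) (w : 𝓗) :
    inner ℂ (symTensor (C w) n) (Ψ n) = inner ℂ (symTensor (R w) n) (Φ n) := by
  have h1 : ∀ z : ℂ, HasSum (fun n : ℕ => z ^ n * (((√(n.factorial) : ℝ) : ℂ)⁻¹ *
      (inner ℂ (symTensor (C w) n) (Ψ n) - inner ℂ (symTensor (R w) n) (Φ n)))) 0 := fun z => by
    have e := (lp.hasSum_inner (𝕜 := ℂ) (coherent (C ((starRingEnd ℂ) z • w))) Ψ).sub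
      (lp.hasSum_inner (𝕜 := ℂ) (coherent (R ((starRingEnd ℂ) z • w))) Φ)
    rw [h, sub_self] at e
    refine e.congr_fun fun n => ?_
    rw [coherent_apply, coherent_apply, map_smul, map_smul, symTensor_smul, symTensor_smul,
      inner_smul_left, inner_smul_left, inner_smul_left, inner_smul_left]
    simp only [map_pow, map_inv₀, conj_conj, conj_ofReal]
    ring
  have h2 := eq_zero_of_hasSum_pow h1 n
  rw [mul_eq_zero, or_iff_right (by simp [Nat.factorial_ne_zero]), sub_eq_zero] at h2
  exact h2

variable [CompleteSpace 𝓗]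

lemma dense_range_of_injective {R : 𝓗 →L[ℂ] 𝓗} (hR : R.toLinearMap.IsSymmetric)
    (hinj : ∀ x, R x = 0 → x = 0) : DenseRange R := by
  have : (R.toLinearMap.range).topologicalClosure = ⊤ := by
    rw [Submodule.topologicalClosure_eq_top_iff, Submodule.eq_bot_iff]
    intro x hx
    refine hinj x (ext_inner_left ℂ fun w => ?_)
    rw [inner_zero_right]
    exact (hR w x).symm.trans ((Submodule.mem_orthogonal _ _).1 hx _ ⟨w, rfl⟩)
  rw [← Submodule.dense_iff_topologicalClosure_eq_top] at this
  exact this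

lemma eq_zero_of_inner_symTensor {R : 𝓗 →L[ℂ] 𝓗} (hR : R.toLinearMap.IsSymmetric)
    (hinj : ∀ x, R x = 0 → x = 0) {n : ℕ} {p : SymPow 𝓗 n}
    (h : ∀ w, inner ℂ (symTensor (R w) n) p = 0) : p = 0 := by
  refine symPow_ext fun x => ?_
  rw [inner_zero_right]
  have hc : Continuous fun x : 𝓗 => inner ℂ (symTensor x n) p :=
    (continuous_symTensor n).inner continuous_const
  exact congrFun ((dense_range_of_injective hR hinj).equalizer hc continuous_const
    (funext fun w => h w)) x

/-- The graph of the second quantization of the operator `R w ↦ C w`. -/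
theorem mem_secondQuantization_graph {A : 𝓗 →ₗ.[ℂ] 𝓗} {R C : 𝓗 →L[ℂ] 𝓗}
    (hA : ∀ x y, (x, y) ∈ A.graph ↔ ∃ w, R w = x ∧ C w = y) (hR : R.toLinearMap.IsSymmetric)
    (hC : C.toLinearMap.IsSymmetric) (hRC : ∀ x, R (C x) = C (R x)) (hinj : ∀ x, R x = 0 → x = 0)
    {Ψ Φ : Fock 𝓗} (h : ∀ n w, inner ℂ (symTensor (C w) n) (Ψ n) =
      inner ℂ (symTensor (R w) n) (Φ n)) :
    (Ψ, Φ) ∈ (secondQuantization A).graph := by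
  set G₀ : Set (Fock 𝓗 × Fock 𝓗) := {q | ∃ (n : ℕ) (x : A.domain),
    q = (fockTensor (x : 𝓗) n, fockTensor (A x) n)} with hG₀
  have hmem : ∀ n w, (fockTensor (R w) n, fockTensor (C w) n) ∈ G₀ := by
    intro n w
    obtain ⟨x, hx, hx'⟩ := (LinearPMap.mem_graph_iff _).1 ((hA (R w) (C w)).2 ⟨w, rfl, rfl⟩)
    exact ⟨n, x, by rw [show (x : 𝓗) = R w from hx, show A x = C w from hx']⟩
  have hmem' : ∀ q ∈ G₀, ∃ n w, q = (fockTensor (R w) n, fockTensor (C w) n) := by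
    rintro _ ⟨n, x, rfl⟩
    obtain ⟨w, hw, hw'⟩ := (hA _ _).1 (A.mem_graph x)
    exact ⟨n, w, by rw [hw, hw']⟩
  set G := (Submodule.span ℂ G₀).topologicalClosure with hG
  have hGcl : IsClosed (G : Set (Fock 𝓗 × Fock 𝓗)) := Submodule.isClosed_topologicalClosure _
  rw [secondQuantization, Submodule.toLinearPMap_graph_eq]
  -- At each level the hypothesis says `C^{⊗n} Ψ n = R^{⊗n} Φ n`, so `mem_of_map_eq_map` applies to
  -- the symmetric powers.
  · have hlev : ∀ n, ((lp.single 2 n (Ψ n) : Fock 𝓗), (lp.single 2 n (Φ n) : Fock 𝓗)) ∈ G := by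
      intro n
      set J := lp.singleContinuousLinearMap ℂ (fun n => SymPow 𝓗 n) 2 n with hJ
      set JJ := J.prodMap J
      have key : (Ψ n, Φ n) ∈ G.comap JJ.toLinearMap := by
        have hcl : IsClosed (G.comap JJ.toLinearMap : Set (SymPow 𝓗 n × SymPow 𝓗 n)) :=
          hGcl.preimage JJ.continuous
        refine mem_of_map_eq_map (symPower_isSymmetric hR n) (symPower_isSymmetric hC n)
          (symPower_commute hRC n) (fun p hp => ?_) hcl (fun p => ?_) ?_
        · refine eq_zero_of_inner_symTensor hR hinj fun w => ?_
          rw [← symPower_symTensor]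
          exact (symPower_isSymmetric hR n _ p).trans ((congrArg _ hp).trans (inner_zero_right _))
        · set N : Submodule ℂ (SymPow 𝓗 n) := (G.comap JJ.toLinearMap).comap
            ((symPower R n).prod (symPower C n)).toLinearMap with hN
          have hNcl : IsClosed (N : Set (SymPow 𝓗 n)) :=
            hcl.preimage ((symPower R n).prod (symPower C n)).continuous
          have hle : (Submodule.span ℂ (Set.range fun x : 𝓗 => symTensor x n)).topologicalClosure
              ≤ N := by
            refine Submodule.topologicalClosure_minimal _ (Submodule.span_le.2 ?_) hNcl
            rintro _ ⟨x, rfl⟩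
            change (J (symPower R n (symTensor x n)), J (symPower C n (symTensor x n))) ∈ G
            rw [symPower_symTensor, symPower_symTensor]
            exact Submodule.le_topologicalClosure _ (Submodule.subset_span (hmem n x))
          rw [topologicalClosure_span_symTensor] at hle
          exact hle Submodule.mem_top
        · refine symPow_ext fun x => ?_
          have e1 : inner ℂ (symTensor x n) (symPower C n (Ψ n)) =
              inner ℂ (symPower C n (symTensor x n)) (Ψ n) :=
            (symPower_isSymmetric hC n _ _).symm
          have e2 : inner ℂ (symTensor x n) (symPower R n (Φ n)) =
              inner ℂ (symPower R n (symTensor x n)) (Φ n) :=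
            (symPower_isSymmetric hR n _ _).symm
          rw [e1, e2, symPower_symTensor, symPower_symTensor, h]
      exact key
    have hsum := (lp.hasSum_single (by simp) Ψ).prodMk (lp.hasSum_single (by simp) Φ)
    exact hGcl.mem_of_tendsto hsum (Filter.Eventually.of_forall fun s =>
      Submodule.sum_mem _ fun n _ => hlev n)
  -- The closed span must be shown to be single valued. The relation in the hypothesis is closed and
  -- holds on the generators, so `Ψ' = 0` forces `Φ'` to be orthogonal to all `(R w)^{⊗n}`, which
  -- are total.
  · rintro ⟨Ψ', Φ'⟩ hq hΨ'
    simp only at hΨ' ⊢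
    have hcond : ∀ n w, inner ℂ (symTensor (C w) n) (Ψ' n) =
        inner ℂ (symTensor (R w) n) (Φ' n) := by
      intro n w
      let L : Fock 𝓗 × Fock 𝓗 →L[ℂ] ℂ :=
        ((innerSL ℂ (symTensor (C w) n)).comp (lp.evalCLM ℂ (fun n => SymPow 𝓗 n) 2 n)).comp
          (ContinuousLinearMap.fst ℂ _ _) -
        ((innerSL ℂ (symTensor (R w) n)).comp (lp.evalCLM ℂ (fun n => SymPow 𝓗 n) 2 n)).comp
          (ContinuousLinearMap.snd ℂ _ _)
      have hle : G ≤ L.toLinearMap.ker := by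
        refine Submodule.topologicalClosure_minimal _ (Submodule.span_le.2 ?_) L.isClosed_ker
        intro q hq
        obtain ⟨m, y, rfl⟩ := hmem' q hq
        change inner ℂ (symTensor (C w) n) (fockTensor (R y) m n) -
          inner ℂ (symTensor (R w) n) (fockTensor (C y) m n) = 0
        rcases eq_or_ne n m with rfl | hnm
        · rw [fockTensor, fockTensor, lp.single_apply_self, lp.single_apply_self, inner_symTensor,
            inner_symTensor, sub_eq_zero]
          congr 1
          calc inner ℂ (C w) (R y) = inner ℂ (R (C w)) y := (hR (C w) y).symm
            _ = inner ℂ (C (R w)) y := by rw [hRC]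
            _ = _ := hC (R w) y
        · rw [fockTensor, fockTensor, lp.single_apply_ne _ _ _ hnm, lp.single_apply_ne _ _ _ hnm,
            inner_zero_right, inner_zero_right, sub_self]
      exact sub_eq_zero.1 (hle hq)
    refine lp.ext (funext fun n => eq_zero_of_inner_symTensor hR hinj fun w => ?_)
    rw [← hcond, hΨ']
    exact inner_zero_right _

end Graph

end BoseFock

end

/-! ### The theorem on the map `A ↦ X A Ω` -/

theorem theorem3p8 {𝓗 : Type*} [NormedAddCommGroup 𝓗] [InnerProductSpace ℂ 𝓗] [CompleteSpace 𝓗]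
    (K H : ClosedSubmodule ℝ 𝓗) (hKH : K ≤ H) (α : ℝ) (hα₀ : 0 < α) (hα₁ : α < 1 / 2)
    -- `T` is the bounded real linear operator `Δ_H ^ α E_K`
    (T : 𝓗 →L[ℝ] 𝓗)
    (hT : ∀ x, (BoseFock.realProjection K x, T x) ∈
      (BoseFock.positivePower (BoseFock.modularOperator H) α).graph)
    (hT_norm : ‖T‖ < 1) (hT_ellP : ∀ p : ℝ, 0 < p → BoseFock.IsEllP ℝ p T) :
    -- `Ξ A = X A Ω`, where `X` is the second quantization of `Δ_H ^ α`
    ∃ Ξ : BoseFock.weylAlgebra K →L[ℂ] BoseFock.Fock 𝓗,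
      (∀ A : BoseFock.weylAlgebra K,
        ((A : BoseFock.Fock 𝓗 →L[ℂ] BoseFock.Fock 𝓗) (BoseFock.vacuum 𝓗), Ξ A) ∈
          (BoseFock.secondQuantization
            (BoseFock.positivePower (BoseFock.modularOperator H) α)).graph) ∧
      ∀ p : ℝ, 0 < p → BoseFock.IsEllP ℂ (E := BoseFock.weylAlgebra K) (F := BoseFock.Fock 𝓗) p Ξ := by
  obtain ⟨Ξ, hΞ, hΞp⟩ := BoseFock.exists_map_symbol (BoseFock.weylAlgebra K) T hT_norm hT_ellP
  refine ⟨Ξ, fun A => ?_, hΞp⟩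
  set B := BoseFock.shiftInverse (BoseFock.modularOperator H) with hB
  have hα1 : α < 1 := by linarith
  have hgraph : ∀ x y, (x, y) ∈ (BoseFock.positivePower (BoseFock.modularOperator H) α).graph ↔
      ∃ w, (B ^ α) w = x ∧ ((1 - B) ^ α) w = y :=
    fun x y => BoseFock.mem_positivePower_graph hα₀ hα1
  have hR : IsSelfAdjoint (B ^ α) := IsSelfAdjoint.of_nonneg CFC.rpow_nonneg
  have hC : IsSelfAdjoint ((1 - B) ^ α) := IsSelfAdjoint.of_nonneg CFC.rpow_nonneg
  have hcomm : ∀ x, (B ^ α) (((1 - B) ^ α) x) = ((1 - B) ^ α) ((B ^ α) x) := fun x =>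
    congrArg (fun f : 𝓗 →L[ℂ] 𝓗 => f x)
      (BoseFock.commute_rpow ((Commute.one_right B).sub_right (Commute.refl B)) α).eq
  have hinj := BoseFock.rpow_injective (BoseFock.shiftInverse_nonneg H)
    (BoseFock.shiftInverse_injective H) hα₀ hα1
  -- On `K` one has `h = R w` and `T h = C w` for some `w`, so commutation of `R` and `C` gives `C h
  -- = R (T h)`.
  have hTK : ∀ h ∈ K, ((1 - B) ^ α) h = (B ^ α) (T h) := by
    intro h hh
    obtain ⟨w, hw, hw'⟩ := (hgraph _ _).1 (hT h)
    have e : BoseFock.realProjection K h = h := Submodule.starProjection_eq_self_iff.2 hh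
    rw [e] at hw
    rw [← hw', hcomm, hw]
  refine BoseFock.mem_secondQuantization_graph hgraph hR.isSymmetric hC.isSymmetric hcomm
    ((injective_iff_map_eq_zero _).1 hinj)
    (BoseFock.inner_symTensor_of_inner_coherent fun w => ?_)
  -- At `ξ = R w` the defining property of `Ξ` returns the matrix element of `A Ω` with `coherent (C
  -- w)`.
  rw [hΞ, BoseFock.conj_symbol_eq A.2 hR hC hTK]
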